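/- Let $\mathbb{T}^1=\mathbb{R}/\mathbb{Z}$, with normalized Lebesgue measure $m$, and let $\mathcal{E}^1$ be the set of all $C^1$ maps $f:\mathbb{T}^1\to\mathbb{T}^1$ that are expanding, i.e. for which there are $c>0$ and $\lambda>1$ with $|(f^n)'(x)|>c\lambda^n$ for all $x\in\mathbb{T}^1$ and all $n\in\mathbb{N}$. Endow $\mathcal{E}^1$ with the $C^1$ topology (uniform convergence of the maps and of their derivatives). An aci$\sigma$ of a map $f:\mathbb{T}^1\to\mathbb{T}^1$ is a nonzero $\sigma$-finite Borel measure on $\mathbb{T}^1$ that is absolutely continuous with respect to $m$ and $f$-invariant. Then there is a residual set $\mathcal{R}\subset\mathcal{E}^1$ (one containing a countable intersection of dense open subsets of $\mathcal{E}^1$) such that no $f\in\mathcal{R}$ has an aci$\sigma$. In other words, the type III property is $C^1$-generic for circle expanding maps: every $f\in\mathcal{R}$ is non-singular, i.e. $m(A)=0$ if and only if $m(f^{-1}(A))=0$ for every Borel set $A$, and has no aci$\sigma$. -/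

import Mathlib

open MeasureTheory

noncomputable section

/-- The representative in `(-1/2, 1/2]` of a point of the circle `ℝ / ℤ`. -/
def circleRep (y : UnitAddCircle) : ℝ :=
  (AddCircle.equivIoc (1 : ℝ) (-1 / 2) y : ℝ)

/-- The map `f : ℝ / ℤ → ℝ / ℤ` read near the point `x` in the coordinates given by
translations, `t ↦ f (x + t) - f x`, with values represented in `(-1/2, 1/2]`. -/
def circleLocal (f : UnitAddCircle → UnitAddCircle) (x : UnitAddCircle) (t : ℝ) : ℝ :=
  circleRep (f (x + (t : UnitAddCircle)) - f x)

/-- Differentiability at a point of a self-map of the circle `ℝ / ℤ`. -/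
def CircleDifferentiableAt (f : UnitAddCircle → UnitAddCircle) (x : UnitAddCircle) : Prop :=
  DifferentiableAt ℝ (circleLocal f x) 0

/-- The derivative `f' x`, a real number, of a self-map of the circle `ℝ / ℤ`. -/
def circleDeriv (f : UnitAddCircle → UnitAddCircle) (x : UnitAddCircle) : ℝ :=
  deriv (circleLocal f x) 0

/-- The `C¹` maps of the circle `ℝ / ℤ` to itself. -/
structure C1CircleMap extends C(UnitAddCircle, UnitAddCircle) where
  differentiable : ∀ x, CircleDifferentiableAt toFun x
  continuous_deriv : Continuous (circleDeriv toFun)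

/-- The derivative of a `C¹` circle map, as a continuous function. -/
def C1CircleMap.derivMap (f : C1CircleMap) : C(UnitAddCircle, ℝ) :=
  ⟨circleDeriv f.toFun, f.continuous_deriv⟩

/-- The `C¹` topology: uniform convergence of the map and of its derivative. (The circle is
compact, so the compact-open topologies on the two factors are those of uniform convergence.) -/
instance C1CircleMap.instTopologicalSpace : TopologicalSpace C1CircleMap :=
  TopologicalSpace.induced
    (fun f : C1CircleMap => (f.toContinuousMap, f.derivMap)) inferInstance

/-- `f` is expanding: `|(f^n)' x| > c λ^n` for some `c > 0`, `λ > 1`, all `x` and all `n`. -/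
def IsExpandingCircleMap (f : UnitAddCircle → UnitAddCircle) : Prop :=
  ∃ c : ℝ, 0 < c ∧ ∃ lam : ℝ, 1 < lam ∧
    ∀ (x : UnitAddCircle) (n : ℕ), c * lam ^ n < |circleDeriv (f^[n]) x|

/-- The space of `C¹` expanding maps of the circle, with the `C¹` topology
(the subspace topology from the space of `C¹` maps). -/
abbrev ExpandingC1 : Type := {f : C1CircleMap // IsExpandingCircleMap f.toFun}

/-- `f` is non-singular: a set is Lebesgue null iff its preimage is. -/
def IsNonsingularCircleMap (f : UnitAddCircle → UnitAddCircle) : Prop :=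
  ∀ A : Set UnitAddCircle, MeasurableSet A →
    (volume A = 0 ↔ volume (f ⁻¹' A) = 0)

/-- `μ` is an absolutely continuous invariant `σ`-finite measure of `f`
(the zero measure does not count). -/
structure IsAciSigma (f : UnitAddCircle → UnitAddCircle) (μ : Measure UnitAddCircle) : Prop where
  ne_zero : μ ≠ 0
  sigmaFinite : SigmaFinite μ
  absolutelyContinuous : μ ≪ volume
  invariant : MeasurePreserving f μ μ

end

section CircleRep

open Set Filter Topology

theorem circleRep_coe {t : ℝ} (h₁ : -1 / 2 < t) (h₂ : t ≤ 1 / 2) :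
    circleRep (t : UnitAddCircle) = t := by
  unfold circleRep
  rw [AddCircle.equivIoc_coe_of_mem]
  constructor <;> linarith

theorem coe_circleRep (y : UnitAddCircle) : ((circleRep y : ℝ) : UnitAddCircle) = y := by
  unfold circleRep
  exact AddCircle.coe_equivIoc

theorem circleRep_mem (y : UnitAddCircle) : -1 / 2 < circleRep y ∧ circleRep y ≤ 1 / 2 := by
  have := ((AddCircle.equivIoc (1 : ℝ) (-1 / 2)) y).2
  refine ⟨this.1, this.2.trans (by norm_num)⟩

theorem exists_coe_eq (y : UnitAddCircle) : ∃ x : ℝ, (x : UnitAddCircle) = y :=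
  ⟨_, coe_circleRep y⟩

theorem coe_add_int (x : ℝ) (n : ℤ) : ((x + n : ℝ) : UnitAddCircle) = x := by
  have h : ((n : ℝ) : UnitAddCircle) = 0 := (AddCircle.coe_eq_zero_iff 1).2 ⟨n, by simp⟩
  rw [AddCircle.coe_add, h, add_zero]

theorem coe_add_nat (x : ℝ) (n : ℕ) : ((x + n : ℝ) : UnitAddCircle) = x := by
  exact_mod_cast coe_add_int x n

theorem coe_eq_coe_iff_int {x y : ℝ} :
    (x : UnitAddCircle) = y ↔ ∃ n : ℤ, y = x + n := by
  constructor
  · intro h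
    have : ((y - x : ℝ) : UnitAddCircle) = 0 := by rw [AddCircle.coe_sub, h, sub_self]
    obtain ⟨n, hn⟩ := (AddCircle.coe_eq_zero_iff 1).1 this
    refine ⟨n, ?_⟩
    simp at hn
    linarith
  · rintro ⟨n, rfl⟩
    exact (coe_add_int x n).symm

theorem dist_coe_le (x y : ℝ) : dist (x : UnitAddCircle) y ≤ |x - y| := by
  rw [dist_eq_norm, ← AddCircle.coe_sub]
  exact QuotientAddGroup.norm_mk_le_norm

theorem abs_circleRep (y : UnitAddCircle) : |circleRep y| = ‖y‖ := by
  conv_rhs => rw [← coe_circleRep y]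
  have h := circleRep_mem y
  rw [((AddCircle.norm_coe_eq_abs_iff (p := (1 : ℝ)) one_ne_zero)).2]
  rw [abs_le, abs_one]
  constructor <;> linarith [h.1, h.2]

theorem circleRep_sub_eventually {F : ℝ → ℝ} {x : ℝ} (hF : ContinuousAt F x) :
    ∀ᶠ t in 𝓝 (0 : ℝ), circleRep ((F (x + t) : UnitAddCircle) - (F x : UnitAddCircle))
      = F (x + t) - F x := by
  have h1 : ContinuousAt (fun t : ℝ => F (x + t) - F x) 0 := by
    have : ContinuousAt (fun t : ℝ => F (x + t)) 0 :=
      ContinuousAt.comp (f := fun t : ℝ => x + t) (by simpa using hF) (by fun_prop)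
    exact this.sub continuousAt_const
  have h2 := h1.eventually (Ioo_mem_nhds (a := -1 / 2) (b := 1 / 2)
    (by simp; norm_num) (by simp))
  filter_upwards [h2] with t ht
  rw [← AddCircle.coe_sub, circleRep_coe ht.1 ht.2.le]

theorem hasDerivAt_circleLocal {f : UnitAddCircle → UnitAddCircle} {F : ℝ → ℝ} {x D : ℝ}
    (hF : ∀ t : ℝ, (F t : UnitAddCircle) = f t) (hD : HasDerivAt F D x) :
    HasDerivAt (circleLocal f x) D 0 := by
  have h1 : HasDerivAt (fun t : ℝ => F (x + t) - F x) D 0 := by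
    have := (HasDerivAt.comp_const_add x 0 (by simpa using hD)).sub_const (F x)
    simpa using this
  refine h1.congr_of_eventuallyEq ?_
  filter_upwards [circleRep_sub_eventually hD.continuousAt] with t ht
  unfold circleLocal
  rw [← ht, hF, hF, AddCircle.coe_add]

theorem circleDeriv_eq {f : UnitAddCircle → UnitAddCircle} {F : ℝ → ℝ} {x D : ℝ}
    (hF : ∀ t : ℝ, (F t : UnitAddCircle) = f t) (hD : HasDerivAt F D x) :
    circleDeriv f x = D := (hasDerivAt_circleLocal hF hD).deriv

/-- A differentiable circle map is the projection of a primitive of its derivative. -/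
theorem C1CircleMap.coe_primitive (f : C1CircleMap) (y₀ : ℝ)
    (hy₀ : (y₀ : UnitAddCircle) = f.toFun 0) (x : ℝ) :
    ((y₀ + ∫ t in (0 : ℝ)..x, circleDeriv f.toFun t : ℝ) : UnitAddCircle) = f.toFun x := by
  set F : ℝ → ℝ := fun x => y₀ + ∫ t in (0 : ℝ)..x, circleDeriv f.toFun t with hFdef
  have hc : Continuous fun t : ℝ => circleDeriv f.toFun (t : UnitAddCircle) :=
    f.continuous_deriv.comp (AddCircle.continuous_mk' 1)
  have hF : ∀ x : ℝ, HasDerivAt F (circleDeriv f.toFun x) x := fun x =>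
    (hc.integral_hasStrictDerivAt 0 x).hasDerivAt.const_add y₀
  let e : ℝ → ℂ := fun t => ((AddCircle.toCircle (f.toFun t) : Circle) : ℂ) *
    Complex.exp (-(2 * Real.pi * F t * Complex.I))
  have he : ∀ x, HasDerivAt e 0 x := by
    intro x
    have h1 : HasDerivAt (fun s : ℝ => circleLocal f.toFun x (s - x))
        (circleDeriv f.toFun x) x := by
      have h0 : HasDerivAt (circleLocal f.toFun x) (circleDeriv f.toFun x) (x - x) := by
        rw [sub_self]; exact (f.differentiable x).hasDerivAt
      simpa using HasDerivAt.comp_sub_const x x h0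
    have key : ∀ s : ℝ, ((AddCircle.toCircle (f.toFun s) : Circle) : ℂ)
        = ((AddCircle.toCircle (f.toFun x) : Circle) : ℂ) *
          Complex.exp (2 * Real.pi * (circleLocal f.toFun x (s - x) : ℝ) * Complex.I) := by
      intro s
      have h2 : f.toFun s = f.toFun x + ((circleLocal f.toFun x (s - x) : ℝ) : UnitAddCircle) := by
        unfold circleLocal
        rw [coe_circleRep, ← AddCircle.coe_add]
        simp
      conv_lhs => rw [h2]
      rw [AddCircle.toCircle_add, AddCircle.toCircle_apply_mk]
      push_cast
      simp
    have h3 : e = fun s => ((AddCircle.toCircle (f.toFun x) : Circle) : ℂ) *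
        Complex.exp ((2 * Real.pi * (circleLocal f.toFun x (s - x) - F s : ℝ)) * Complex.I) := by
      funext s
      simp only [e]
      rw [key s, mul_assoc, ← Complex.exp_add]
      congr 2
      push_cast
      ring
    rw [h3]
    have h4 : HasDerivAt (fun s => circleLocal f.toFun x (s - x) - F s) 0 x := by
      have := h1.sub (hF x)
      rw [sub_self] at this
      exact this
    have h5 := (((h4.ofReal_comp.const_mul (2 * Real.pi : ℂ)).mul_const Complex.I).cexp).const_mul
      ((AddCircle.toCircle (f.toFun x) : Circle) : ℂ)
    simpa using h5
  have hconst : e x = e 0 := is_const_of_deriv_eq_zero (fun x => (he x).differentiableAt)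
    (fun x => (he x).deriv) x 0
  have hval : ∀ t, e t = ((AddCircle.toCircle (f.toFun t - (F t : UnitAddCircle)) : Circle) : ℂ) := by
    intro t
    simp only [e]
    rw [sub_eq_add_neg, AddCircle.toCircle_add, ← AddCircle.coe_neg, AddCircle.toCircle_apply_mk]
    push_cast
    congr 2
    ring
  rw [hval, hval] at hconst
  have h6 := AddCircle.injective_toCircle (T := (1 : ℝ)) one_ne_zero (Subtype.ext hconst)
  have h7 : F 0 = y₀ := by simp [hFdef]
  rw [h7, hy₀] at h6
  have h8 : ((0 : ℝ) : UnitAddCircle) = 0 := rfl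
  rw [h8, sub_self] at h6
  exact (sub_eq_zero.1 h6).symm

end CircleRep

section CircleLift

open Set Filter Topology

/-- A `C¹` covering map of the circle given by its lift `F` to the line, the derivative `F'` of
the lift, the inverse `Φ` of the lift, and the degree `d`. -/
structure CircleLift where
  F : ℝ → ℝ
  F' : ℝ → ℝ
  Φ : ℝ → ℝ
  d : ℤ
  hasDerivAt : ∀ x, HasDerivAt F (F' x) x
  continuous_deriv : Continuous F'
  deriv_ne_zero : ∀ x, F' x ≠ 0
  map_add_one : ∀ x, F (x + 1) = F x + d
  left_inv : ∀ x, Φ (F x) = x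
  right_inv : ∀ x, F (Φ x) = x

theorem exists_pos_le_abs_of_periodic {g : ℝ → ℝ} (hg : Continuous g) (h1 : Function.Periodic g 1)
    (h0 : ∀ x, g x ≠ 0) : ∃ c : ℝ, 0 < c ∧ ∀ x, c ≤ |g x| := by
  obtain ⟨x₀, -, hx₀⟩ := isCompact_Icc.exists_isMinOn (nonempty_Icc.2 (zero_le_one' ℝ))
    (hg.abs.continuousOn (s := Icc 0 1))
  refine ⟨|g x₀|, abs_pos.2 (h0 _), fun x => ?_⟩
  obtain ⟨y, hy, hxy⟩ := h1.exists_mem_Ico₀ one_pos x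
  rw [hxy]
  exact hx₀ ⟨hy.1, hy.2.le⟩

theorem exists_abs_le_of_periodic {g : ℝ → ℝ} (hg : Continuous g) (h1 : Function.Periodic g 1) :
    ∃ C : ℝ, 0 < C ∧ ∀ x, |g x| ≤ C := by
  obtain ⟨x₀, -, hx₀⟩ := isCompact_Icc.exists_isMaxOn (nonempty_Icc.2 (zero_le_one' ℝ))
    (hg.abs.continuousOn (s := Icc 0 1))
  refine ⟨|g x₀| + 1, by positivity, fun x => ?_⟩
  obtain ⟨y, hy, hxy⟩ := h1.exists_mem_Ico₀ one_pos x
  rw [hxy]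
  have : |g y| ≤ |g x₀| := hx₀ ⟨hy.1, hy.2.le⟩
  linarith

theorem map_add_int_of_map_add_one {F : ℝ → ℝ} {d : ℝ} (h : ∀ x, F (x + 1) = F x + d) (x : ℝ)
    (n : ℤ) : F (x + n) = F x + n * d := by
  induction n using Int.induction_on with
  | zero => simp
  | succ i ih =>
    have := h (x + i)
    push_cast at *
    rw [← add_assoc, this, ih]
    ring
  | pred i ih =>
    have := h (x + (-(i : ℝ) - 1))
    push_cast at *
    rw [show x + (-(i : ℝ) - 1) + 1 = x + -(i : ℝ) by ring, ih] at this
    linarith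

theorem periodic_of_hasDerivAt {F F' : ℝ → ℝ} {d : ℝ} (hF : ∀ x, HasDerivAt F (F' x) x)
    (h : ∀ x, F (x + 1) = F x + d) : Function.Periodic F' 1 := by
  intro x
  have h1 : HasDerivAt (fun y => F (y + 1)) (F' (x + 1)) x :=
    HasDerivAt.comp_add_const x 1 (hF (x + 1))
  have h2 : HasDerivAt (fun y => F (y + 1)) (F' x) x := by
    simp_rw [h]
    exact (hF x).add_const _
  exact h1.unique h2

theorem mul_abs_sub_le_abs_sub {F F' : ℝ → ℝ} (hF : ∀ x, HasDerivAt F (F' x) x) {c : ℝ}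
    (hc : ∀ x, c ≤ |F' x|) (x y : ℝ) : c * |x - y| ≤ |F x - F y| := by
  wlog hxy : x < y generalizing x y
  · rcases eq_or_lt_of_le (not_lt.1 hxy) with rfl | h
    · simp
    · rw [abs_sub_comm x, abs_sub_comm (F x)]
      exact this y x h
  obtain ⟨z, -, hz⟩ := exists_hasDerivAt_eq_slope F F' hxy
    (fun x _ => (hF x).continuousAt.continuousWithinAt) (fun x _ => hF x)
  have h1 : F y - F x = F' z * (y - x) := by
    rw [hz]; field_simp [sub_ne_zero.2 hxy.ne']
  rw [abs_sub_comm x, abs_sub_comm (F x), h1, abs_mul]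
  exact mul_le_mul_of_nonneg_right (hc z) (abs_nonneg _)

theorem exists_circleLift {F F' : ℝ → ℝ} {d : ℤ} (hF : ∀ x, HasDerivAt F (F' x) x)
    (hc : Continuous F') (h0 : ∀ x, F' x ≠ 0) (h1 : ∀ x, F (x + 1) = F x + d) :
    ∃ A : CircleLift, A.F = F ∧ A.F' = F' ∧ A.d = d := by
  obtain ⟨c, hc0, hcle⟩ := exists_pos_le_abs_of_periodic hc (periodic_of_hasDerivAt hF h1) h0
  have hinj : Function.Injective F := by
    intro x y hxy
    have := mul_abs_sub_le_abs_sub hF hcle x y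
    rw [hxy, sub_self, abs_zero] at this
    have h2 : |x - y| ≤ 0 := by
      by_contra h
      push Not at h
      nlinarith
    linarith [abs_nonpos_iff.1 h2]
  have hd : d ≠ 0 := by
    rintro rfl
    have := hinj (a₁ := 0 + 1) (a₂ := 0) (by rw [h1]; simp)
    simp at this
  have hcont : Continuous F := continuous_iff_continuousAt.2 fun x => (hF x).continuousAt
  have hadd := map_add_int_of_map_add_one h1
  have hsurj : Function.Surjective F := by
    intro y
    have hd' : (1 : ℝ) ≤ (d : ℝ) * d := by
      have : (1 : ℤ) ≤ d * d := by
        have := Int.one_le_abs hd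
        nlinarith [abs_mul_abs_self d]
      exact_mod_cast this
    obtain ⟨n, hn⟩ := exists_nat_ge |y - F 0|
    have hn0 : (0 : ℝ) ≤ n := Nat.cast_nonneg n
    refine mem_range_of_exists_le_of_exists_ge hcont ⟨0 + ((-(n * d) : ℤ) : ℝ), ?_⟩
      ⟨0 + ((n * d : ℤ) : ℝ), ?_⟩
    · rw [hadd]
      push_cast
      nlinarith [neg_abs_le (y - F 0)]
    · rw [hadd]
      push_cast
      nlinarith [le_abs_self (y - F 0)]
  let e := Equiv.ofBijective F ⟨hinj, hsurj⟩
  exact ⟨⟨F, F', e.symm, d, hF, hc, h0, h1, e.left_inv, e.right_inv⟩, rfl, rfl, rfl⟩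

namespace CircleLift

variable (A : CircleLift)

theorem continuous_F : Continuous A.F :=
  continuous_iff_continuousAt.2 fun x => (A.hasDerivAt x).continuousAt

theorem periodic_deriv : Function.Periodic A.F' 1 := periodic_of_hasDerivAt A.hasDerivAt A.map_add_one

theorem exists_lower : ∃ c : ℝ, 0 < c ∧ ∀ x, c ≤ |A.F' x| :=
  exists_pos_le_abs_of_periodic A.continuous_deriv A.periodic_deriv A.deriv_ne_zero

theorem map_add_int (x : ℝ) (n : ℤ) : A.F (x + n) = A.F x + n * A.d :=
  map_add_int_of_map_add_one A.map_add_one x n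

theorem inv_add (x : ℝ) (n : ℤ) : A.Φ (x + n * A.d) = A.Φ x + n := by
  rw [← A.left_inv (A.Φ x + n), A.map_add_int, A.right_inv]

theorem d_ne_zero : A.d ≠ 0 := by
  intro h
  have h1 := A.inv_add 0 1
  rw [h] at h1
  simp at h1

theorem abs_inv_sub_le {c : ℝ} (hc0 : 0 < c) (hc : ∀ x, c ≤ |A.F' x|) (x y : ℝ) :
    |A.Φ x - A.Φ y| ≤ |x - y| / c := by
  have := mul_abs_sub_le_abs_sub A.hasDerivAt hc (A.Φ x) (A.Φ y)
  rw [A.right_inv, A.right_inv] at this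
  rw [le_div_iff₀ hc0]
  linarith

theorem continuous_inv : Continuous A.Φ := by
  obtain ⟨c, hc0, hc⟩ := A.exists_lower
  refine LipschitzWith.continuous (K := (1 / c).toNNReal) (LipschitzWith.of_dist_le_mul ?_)
  intro x y
  rw [Real.dist_eq, Real.dist_eq, Real.coe_toNNReal _ (by positivity)]
  have := A.abs_inv_sub_le hc0 hc x y
  rw [div_eq_mul_inv] at this
  rw [one_div, mul_comm]
  exact this

theorem hasDerivAt_inv (x : ℝ) : HasDerivAt A.Φ (A.F' (A.Φ x))⁻¹ x :=
  HasDerivAt.of_local_left_inverse A.continuous_inv.continuousAt (A.hasDerivAt _)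
    (A.deriv_ne_zero _) (Eventually.of_forall A.right_inv)

/-- The circle map with the given lift. -/
noncomputable def toMap (y : UnitAddCircle) : UnitAddCircle := (A.F (circleRep y) : UnitAddCircle)

theorem toMap_coe (x : ℝ) : A.toMap x = (A.F x : UnitAddCircle) := by
  obtain ⟨n, hn⟩ := coe_eq_coe_iff_int.1 (coe_circleRep x)
  unfold toMap
  conv_rhs => rw [hn, A.map_add_int]
  have := coe_add_int (A.F (circleRep x)) (n * A.d)
  push_cast at this
  exact this.symm

theorem continuous_toMap : Continuous A.toMap := by
  have : Continuous fun x : ℝ => A.toMap x := by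
    simp_rw [A.toMap_coe]
    exact (AddCircle.continuous_mk' 1).comp A.continuous_F
  exact (isQuotientMap_quotient_mk').continuous_iff.2 this

theorem circleDeriv_toMap (x : ℝ) : circleDeriv A.toMap x = A.F' x :=
  circleDeriv_eq (fun t => (A.toMap_coe t).symm) (A.hasDerivAt x)

/-- The `C¹` circle map with the given lift. -/
noncomputable def toC1 : C1CircleMap where
  toFun := A.toMap
  continuous_toFun := A.continuous_toMap
  differentiable := fun y => by
    obtain ⟨x, rfl⟩ := exists_coe_eq y
    exact (hasDerivAt_circleLocal (fun t => (A.toMap_coe t).symm) (A.hasDerivAt x)).differentiableAt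
  continuous_deriv := by
    have : Continuous fun x : ℝ => circleDeriv A.toMap x := by
      simp_rw [A.circleDeriv_toMap]
      exact A.continuous_deriv
    exact (isQuotientMap_quotient_mk').continuous_iff.2 this

theorem iterate_toMap_coe (n : ℕ) (x : ℝ) : A.toMap^[n] x = (A.F^[n] x : UnitAddCircle) := by
  induction n with
  | zero => rfl
  | succ n ih => rw [Function.iterate_succ_apply', ih, A.toMap_coe, Function.iterate_succ_apply']

theorem hasDerivAt_iterate (n : ℕ) (x : ℝ) :
    HasDerivAt A.F^[n] (∏ i ∈ Finset.range n, A.F' (A.F^[i] x)) x := by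
  induction n with
  | zero => simpa using hasDerivAt_id x
  | succ n ih =>
    rw [Finset.prod_range_succ, mul_comm, Function.iterate_succ']
    exact (A.hasDerivAt _).comp x ih

theorem circleDeriv_iterate (n : ℕ) (x : ℝ) :
    circleDeriv (A.toMap^[n]) x = ∏ i ∈ Finset.range n, A.F' (A.F^[i] x) :=
  circleDeriv_eq (fun t => (A.iterate_toMap_coe n t).symm) (A.hasDerivAt_iterate n x)

/-- A continuous conformal factor for which the lift expands by the factor `lam`. -/
structure IsAdapted (κ : ℝ → ℝ) (lam : ℝ) : Prop where
  continuous : Continuous κ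
  periodic : Function.Periodic κ 1
  pos : ∀ x, 0 < κ x
  one_lt : 1 < lam
  le : ∀ x, lam * κ x ≤ |A.F' x| * κ (A.F x)

variable {A}

theorem IsAdapted.isExpanding {κ : ℝ → ℝ} {lam : ℝ} (h : A.IsAdapted κ lam) :
    IsExpandingCircleMap A.toMap := by
  obtain ⟨c, hc0, hc⟩ := exists_pos_le_abs_of_periodic h.continuous h.periodic fun x => (h.pos x).ne'
  obtain ⟨C, hC0, hC⟩ := exists_abs_le_of_periodic h.continuous h.periodic
  simp only [abs_of_pos (h.pos _)] at hc hC
  have hl : 0 < lam := one_pos.trans h.one_lt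
  refine ⟨c / C / 2, by positivity, lam, h.one_lt, fun y n => ?_⟩
  obtain ⟨x, rfl⟩ := exists_coe_eq y
  rw [A.circleDeriv_iterate]
  have key : lam ^ n * κ x ≤ |∏ i ∈ Finset.range n, A.F' (A.F^[i] x)| * κ (A.F^[n] x) := by
    induction n with
    | zero => simp
    | succ n ih =>
      rw [Finset.prod_range_succ, abs_mul, Function.iterate_succ_apply', pow_succ]
      have := h.le (A.F^[n] x)
      calc lam ^ n * lam * κ x = lam * (lam ^ n * κ x) := by ring
        _ ≤ lam * (|∏ i ∈ Finset.range n, A.F' (A.F^[i] x)| * κ (A.F^[n] x)) := by gcongr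
        _ = |∏ i ∈ Finset.range n, A.F' (A.F^[i] x)| * (lam * κ (A.F^[n] x)) := by ring
        _ ≤ _ := by rw [mul_assoc]; gcongr
  have h2 : lam ^ n * c ≤ |∏ i ∈ Finset.range n, A.F' (A.F^[i] x)| * C :=
    (mul_le_mul_of_nonneg_left (hc x) (by positivity)).trans
      (key.trans (mul_le_mul_of_nonneg_left (hC _) (abs_nonneg _)))
  have h3 : c / C * lam ^ n ≤ |∏ i ∈ Finset.range n, A.F' (A.F^[i] x)| := by
    rw [div_mul_eq_mul_div, div_le_iff₀ hC0]
    linarith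
  have : 0 < c / C * lam ^ n := by positivity
  linarith

variable (A)

theorem exists_isAdapted (h : IsExpandingCircleMap A.toMap) :
    ∃ (κ : ℝ → ℝ) (lam : ℝ), A.IsAdapted κ lam := by
  obtain ⟨c, hc, lam, hlam, h⟩ := h
  obtain ⟨l, hl1, hl2⟩ := exists_between hlam
  have hl0 : 0 < l := one_pos.trans hl1
  obtain ⟨q, hq⟩ : ∃ q : ℕ, 1 / c < (lam / l) ^ q :=
    pow_unbounded_of_one_lt _ ((one_lt_div hl0).2 hl2)
  let D : ℕ → ℝ → ℝ := fun j x => ∏ i ∈ Finset.range j, A.F' (A.F^[i] x)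
  have hDc : ∀ j, Continuous (D j) := fun j =>
    continuous_finsetProd _ fun i _ => A.continuous_deriv.comp (A.continuous_F.iterate i)
  have hDp : ∀ j, Function.Periodic (D j) 1 := by
    intro j x
    simp only [D]
    rw [← A.circleDeriv_iterate, ← A.circleDeriv_iterate]
    have := coe_add_int x 1
    rw [Int.cast_one] at this
    rw [this]
  have hD1 : ∀ j x, D (j + 1) x = A.F' x * D j (A.F x) := by
    intro j x
    simp only [D]
    rw [Finset.prod_range_succ', mul_comm]
    simp [Function.iterate_succ_apply]
  have hDl : ∀ j x, c * lam ^ j < |D j x| := by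
    intro j x
    have := h (x : UnitAddCircle) j
    rwa [A.circleDeriv_iterate] at this
  let κ : ℝ → ℝ := fun x => 1 + ∑ j ∈ Finset.range q, l⁻¹ ^ (j + 1) * |D (j + 1) x|
  refine ⟨κ, l, ?_, ?_, ?_, hl1, ?_⟩
  · exact continuous_const.add (continuous_finsetSum _ fun j _ => ((hDc _).abs.const_mul _))
  · intro x
    simp only [κ]
    congr 1
    refine Finset.sum_congr rfl fun j _ => ?_
    rw [hDp]
  · intro x
    have : 0 ≤ ∑ j ∈ Finset.range q, l⁻¹ ^ (j + 1) * |D (j + 1) x| :=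
      Finset.sum_nonneg fun j _ => by positivity
    simp only [κ]
    linarith
  · intro x
    have e1 : |A.F' x| * κ (A.F x) = ∑ j ∈ Finset.range (q + 1), l⁻¹ ^ j * |D (j + 1) x| := by
      rw [Finset.sum_range_succ']
      simp only [κ]
      rw [mul_add, Finset.mul_sum, add_comm]
      congr 1
      · refine Finset.sum_congr rfl fun j _ => ?_
        rw [hD1 (j + 1), abs_mul]
        ring
      · simp [D]
    have e2 : l * κ x = l + ∑ j ∈ Finset.range q, l⁻¹ ^ j * |D (j + 1) x| := by
      simp only [κ]
      rw [mul_add, Finset.mul_sum, mul_one]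
      congr 1
      refine Finset.sum_congr rfl fun j _ => ?_
      rw [pow_succ]
      field_simp
    rw [e1, e2, Finset.sum_range_succ, add_comm]
    have h3 : l ≤ l⁻¹ ^ q * |D (q + 1) x| := by
      have h4 := (hDl (q + 1) x).le
      have h5 : 1 ≤ c * (lam / l) ^ q := by
        rw [div_lt_iff₀ hc] at hq
        linarith
      calc l ≤ lam * 1 := by linarith
        _ ≤ lam * (c * (lam / l) ^ q) := by gcongr
        _ = l⁻¹ ^ q * (c * lam ^ (q + 1)) := by
          rw [div_pow, inv_pow, pow_succ]; field_simp
        _ ≤ _ := by gcongr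
    linarith

end CircleLift

theorem C1CircleMap.exists_circleLift (f : C1CircleMap) (h0 : ∀ x, circleDeriv f.toFun x ≠ 0)
    (y₀ : ℝ) (hy₀ : (y₀ : UnitAddCircle) = f.toFun 0) :
    ∃ A : CircleLift, A.toMap = f.toFun ∧ A.F 0 = y₀ ∧
      ∀ x : ℝ, A.F' x = circleDeriv f.toFun x := by
  set F : ℝ → ℝ := fun x => y₀ + ∫ t in (0 : ℝ)..x, circleDeriv f.toFun t with hFdef
  have hc : Continuous fun t : ℝ => circleDeriv f.toFun (t : UnitAddCircle) :=
    f.continuous_deriv.comp (AddCircle.continuous_mk' 1)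
  have hF : ∀ x : ℝ, HasDerivAt F (circleDeriv f.toFun x) x := fun x =>
    (hc.integral_hasStrictDerivAt 0 x).hasDerivAt.const_add y₀
  have hcoe := f.coe_primitive y₀ hy₀
  obtain ⟨d, hd⟩ : ∃ d : ℤ, F 1 = F 0 + d := by
    refine coe_eq_coe_iff_int.1 ?_
    simp only [hFdef]
    rw [hcoe, hcoe]
    congr 1
    have := coe_add_int 0 1
    simp only [Int.cast_one, zero_add] at this
    exact this.symm
  have h1 : ∀ x, F (x + 1) = F x + d := by
    have hper : ∀ x : ℝ, circleDeriv f.toFun ((x + 1 : ℝ) : UnitAddCircle)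
        = circleDeriv f.toFun x := by
      intro x
      have := coe_add_int x 1
      rw [Int.cast_one] at this
      rw [this]
    have hder : ∀ x, HasDerivAt (fun x => F (x + 1) - F x) 0 x := by
      intro x
      have := (HasDerivAt.comp_add_const x 1 (hF (x + 1))).sub (hF x)
      rw [hper, sub_self] at this
      exact this
    intro x
    have := is_const_of_deriv_eq_zero (fun x => (hder x).differentiableAt)
      (fun x => (hder x).deriv) x 0
    simp only [zero_add] at this
    linarith
  obtain ⟨A, hA, hA', -⟩ := _root_.exists_circleLift hF hc (fun x => h0 x) h1
  refine ⟨A, ?_, by rw [hA]; simp [hFdef], fun x => by rw [hA']⟩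
  funext y
  obtain ⟨x, rfl⟩ := exists_coe_eq y
  rw [A.toMap_coe, hA]
  exact hcoe x

theorem IsExpandingCircleMap.deriv_ne_zero {f : UnitAddCircle → UnitAddCircle}
    (hf : IsExpandingCircleMap f) (x : UnitAddCircle) : circleDeriv f x ≠ 0 := by
  obtain ⟨c, hc, lam, hlam, h⟩ := hf
  have := h x 1
  rw [Function.iterate_one] at this
  intro h0
  rw [h0, abs_zero] at this
  have : 0 < c * lam ^ 1 := by positivity
  linarith

end CircleLift

section Transfer

open Set Filter Topology
open scoped ENNReal

theorem sum_range_add_int {H : ℝ → ℝ} {D : ℕ} (hH : ∀ x, H (x + D) = H x) (x : ℝ) (n : ℤ) :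
    ∑ i ∈ Finset.range D, H (x + n + i) = ∑ i ∈ Finset.range D, H (x + i) := by
  have step : ∀ x, ∑ i ∈ Finset.range D, H (x + 1 + i) = ∑ i ∈ Finset.range D, H (x + i) := by
    intro x
    have h1 := Finset.sum_range_succ (fun i : ℕ => H (x + i)) D
    rw [Finset.sum_range_succ', hH] at h1
    push_cast at h1
    simp only [add_zero] at h1
    have h2 := add_right_cancel h1
    rw [← h2]
    refine Finset.sum_congr rfl fun i _ => ?_
    congr 1
    ring
  induction n using Int.induction_on with
  | zero => simp
  | succ i ih =>
    rw [← ih, ← step (x + (i : ℤ))]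
    push_cast
    refine Finset.sum_congr rfl fun j _ => ?_
    congr 1
    ring
  | pred i ih =>
    rw [← ih, ← step]
    push_cast
    refine Finset.sum_congr rfl fun i _ => ?_
    congr 1
    ring

theorem lintegral_Ioc_add_nat (G : ℝ → ℝ≥0∞) (c : ℝ) (D : ℕ) :
    ∫⁻ x in Ioc c (c + D), G x = ∑ i ∈ Finset.range D, ∫⁻ x in Ioc c (c + 1), G (x + i) := by
  induction D with
  | zero => simp
  | succ D ih =>
    have h0 : (0 : ℝ) ≤ D := Nat.cast_nonneg D
    have h1 : Ioc c (c + (D + 1 : ℕ)) = Ioc c (c + D) ∪ Ioc (c + D) (c + D + 1) := by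
      rw [Ioc_union_Ioc_eq_Ioc (by linarith) (by linarith)]
      push_cast
      rw [add_assoc]
    rw [h1, lintegral_union measurableSet_Ioc (Ioc_disjoint_Ioc_of_le le_rfl), ih,
      Finset.sum_range_succ]
    congr 1
    have h2 := (measurePreserving_add_right (volume : Measure ℝ) (D : ℝ)).setLIntegral_comp_preimage_emb
      (measurableEmbedding_addRight (D : ℝ)) G (Ioc (c + D) (c + D + 1))
    rw [← h2]
    congr 2
    simp [add_sub_right_comm]

namespace CircleLift

variable (A : CircleLift)

theorem strictMono_or_strictAnti : StrictMono A.F ∨ StrictAnti A.F :=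
  A.continuous_F.strictMono_of_inj (Function.LeftInverse.injective A.left_inv)

theorem exists_image_Ioc_ae_eq :
    ∃ c : ℝ, A.F '' Ioc 0 1 =ᵐ[volume] Ioc c (c + A.d.natAbs) := by
  have h1 : A.F 1 = A.F 0 + A.d := by simpa using A.map_add_one 0
  rcases A.strictMono_or_strictAnti with h | h
  · refine ⟨A.F 0, ?_⟩
    have hd : (0 : ℝ) < A.d := by linarith [h (zero_lt_one' ℝ)]
    have hd' : ((A.d.natAbs : ℕ) : ℝ) = A.d := by
      have : 0 < A.d := by exact_mod_cast hd
      rw [Nat.cast_natAbs, abs_of_pos this]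
    rw [hd', ← h1]
    refine Eq.eventuallyEq ?_
    ext y
    constructor
    · rintro ⟨x, hx, rfl⟩
      exact ⟨h hx.1, h.monotone hx.2⟩
    · rintro ⟨hy1, hy2⟩
      rw [← A.right_inv y] at hy1 hy2
      exact ⟨A.Φ y, ⟨h.lt_iff_lt.1 hy1, h.le_iff_le.1 hy2⟩, A.right_inv y⟩
  · refine ⟨A.F 1, ?_⟩
    have hd : (A.d : ℝ) < 0 := by linarith [h (zero_lt_one' ℝ)]
    have hd' : ((A.d.natAbs : ℕ) : ℝ) = -A.d := by
      have : A.d < 0 := by exact_mod_cast hd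
      rw [Nat.cast_natAbs, abs_of_neg this]
      push_cast
      rfl
    rw [hd', show A.F 1 + -(A.d : ℝ) = A.F 0 by linarith]
    have : A.F '' Ioc 0 1 = Ico (A.F 1) (A.F 0) := by
      ext y
      constructor
      · rintro ⟨x, hx, rfl⟩
        exact ⟨h.antitone hx.2, h hx.1⟩
      · rintro ⟨hy1, hy2⟩
        rw [← A.right_inv y] at hy1 hy2
        exact ⟨A.Φ y, ⟨h.lt_iff_gt.1 hy2, h.le_iff_ge.1 hy1⟩, A.right_inv y⟩
    rw [this]
    exact Ico_ae_eq_Ioc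

/-- The transfer operator with respect to Lebesgue measure. -/
noncomputable def transfer (v : UnitAddCircle → ℝ) (y : UnitAddCircle) : ℝ :=
  ∑ i ∈ Finset.range A.d.natAbs,
    v (A.Φ (circleRep y + i) : ℝ) / |A.F' (A.Φ (circleRep y + i))|

theorem weight_add_natAbs (v : UnitAddCircle → ℝ) (x : ℝ) :
    v (A.Φ (x + A.d.natAbs) : ℝ) / |A.F' (A.Φ (x + A.d.natAbs))|
      = v (A.Φ x : ℝ) / |A.F' (A.Φ x)| := by
  have hper : ∀ (x : ℝ) (n : ℤ), A.F' (x + n) = A.F' x := fun x n => by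
    simpa using A.periodic_deriv.int_mul n x
  rcases Int.natAbs_eq A.d with h | h
  · have h2 := A.inv_add x 1
    rw [Int.cast_one, one_mul] at h2
    have h3 : (A.d : ℝ) = A.d.natAbs := by
      exact (congrArg (Int.cast (R := ℝ)) h).trans (Int.cast_natCast _)
    rw [← h3, h2]
    have h4 := hper (A.Φ x) 1
    have h5 := coe_add_int (A.Φ x) 1
    push_cast at h4 h5
    rw [h4, h5]
  · have h2 := A.inv_add x (-1)
    have h3 : (A.d : ℝ) = -A.d.natAbs := by
      refine (congrArg (Int.cast (R := ℝ)) h).trans ?_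
      rw [Int.cast_neg, Int.cast_natCast]
    push_cast at h2
    rw [show (A.d.natAbs : ℝ) = -1 * (A.d : ℝ) by rw [h3]; simp, h2]
    have h4 := hper (A.Φ x) (-1)
    have h5 := coe_add_int (A.Φ x) (-1)
    push_cast at h4 h5
    rw [h4, h5]

theorem transfer_coe (v : UnitAddCircle → ℝ) (x : ℝ) :
    A.transfer v x = ∑ i ∈ Finset.range A.d.natAbs,
      v (A.Φ (x + i) : ℝ) / |A.F' (A.Φ (x + i))| := by
  obtain ⟨n, hn⟩ := coe_eq_coe_iff_int.1 (coe_circleRep x)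
  have := sum_range_add_int (H := fun x => v (A.Φ x : ℝ) / |A.F' (A.Φ x)|)
    (A.weight_add_natAbs v) (circleRep x) n
  rw [← hn] at this
  exact this.symm

theorem transfer_nonneg {v : UnitAddCircle → ℝ} (hv : ∀ y, 0 ≤ v y) (y : UnitAddCircle) :
    0 ≤ A.transfer v y :=
  Finset.sum_nonneg fun _ _ => div_nonneg (hv _) (abs_nonneg _)

theorem transfer_add (v w : UnitAddCircle → ℝ) :
    A.transfer (v + w) = A.transfer v + A.transfer w := by
  funext y
  simp [transfer, add_div, Finset.sum_add_distrib]

theorem transfer_smul (c : ℝ) (v : UnitAddCircle → ℝ) :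
    A.transfer (c • v) = c • A.transfer v := by
  funext y
  simp [transfer, mul_div_assoc, Finset.mul_sum]

theorem transfer_mul_comp (v w : UnitAddCircle → ℝ) :
    A.transfer (fun y => v y * w (A.toMap y)) = fun y => A.transfer v y * w y := by
  funext y
  obtain ⟨x, rfl⟩ := exists_coe_eq y
  rw [A.transfer_coe, A.transfer_coe, Finset.sum_mul]
  refine Finset.sum_congr rfl fun i _ => ?_
  rw [A.toMap_coe, A.right_inv, coe_add_nat]
  ring

theorem transfer_pos {v : UnitAddCircle → ℝ} (hv : ∀ y, 0 < v y) (y : UnitAddCircle) :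
    0 < A.transfer v y := by
  refine Finset.sum_pos (fun _ _ => div_pos (hv _) (abs_pos.2 (A.deriv_ne_zero _))) ?_
  rw [Finset.nonempty_range_iff]
  exact Int.natAbs_ne_zero.2 A.d_ne_zero

theorem continuous_transfer {v : UnitAddCircle → ℝ} (hv : Continuous v) :
    Continuous (A.transfer v) := by
  have : Continuous fun x : ℝ => A.transfer v x := by
    simp_rw [A.transfer_coe]
    refine continuous_finsetSum _ fun i _ => ?_
    have h1 : Continuous fun x : ℝ => A.Φ (x + i) :=
      A.continuous_inv.comp (continuous_id.add continuous_const)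
    exact (hv.comp ((AddCircle.continuous_mk' 1).comp h1)).div (A.continuous_deriv.comp h1).abs
      fun x => abs_ne_zero.2 (A.deriv_ne_zero _)
  exact (isQuotientMap_quotient_mk').continuous_iff.2 this

theorem measurable_circleRep : Measurable circleRep :=
  measurable_subtype_coe.comp (AddCircle.measurableEquivIoc (1 : ℝ) (-1 / 2)).measurable

theorem measurable_transfer {v : UnitAddCircle → ℝ} (hv : Measurable v) :
    Measurable (A.transfer v) := by
  refine Finset.measurable_fun_sum _ fun i _ => ?_
  have h1 : Measurable fun y => A.Φ (circleRep y + i) :=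
    A.continuous_inv.measurable.comp (measurable_circleRep.add_const _)
  exact (hv.comp (AddCircle.measurable_mk'.comp h1)).div
    (A.continuous_deriv.abs.measurable.comp h1)

theorem map_withDensity {v : UnitAddCircle → ℝ} (hv : Measurable v) (h0 : ∀ y, 0 ≤ v y) :
    Measure.map A.toMap (volume.withDensity fun y => ENNReal.ofReal (v y))
      = volume.withDensity fun y => ENNReal.ofReal (A.transfer v y) := by
  ext B hB
  have hf : Measurable A.toMap := A.continuous_toMap.measurable
  rw [Measure.map_apply hf hB, withDensity_apply _ (hf hB), withDensity_apply _ hB,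
    ← lintegral_indicator (hf hB), ← lintegral_indicator hB]
  obtain ⟨c, hc⟩ := A.exists_image_Ioc_ae_eq
  rw [← UnitAddCircle.lintegral_preimage 0, ← UnitAddCircle.lintegral_preimage c]
  let H : ℝ → ℝ := fun x => v (A.Φ x : ℝ) / |A.F' (A.Φ x)|
  have hHm : Measurable H :=
    (hv.comp (AddCircle.measurable_mk'.comp A.continuous_inv.measurable)).div
      (A.continuous_deriv.abs.measurable.comp A.continuous_inv.measurable)
  let G : ℝ → ℝ≥0∞ := fun x => B.indicator 1 (x : UnitAddCircle) * ENNReal.ofReal (H x)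
  have hGm : Measurable G :=
    ((measurable_one.indicator hB).comp AddCircle.measurable_mk').mul hHm.ennreal_ofReal
  calc ∫⁻ x : ℝ in Ioc 0 (0 + 1), (A.toMap ⁻¹' B).indicator (fun y => ENNReal.ofReal (v y)) (x : UnitAddCircle)
      = ∫⁻ x in Ioc 0 1, ENNReal.ofReal |A.F' x| * G (A.F x) := by
        rw [zero_add]
        refine lintegral_congr fun x => ?_
        have hne := abs_pos.2 (A.deriv_ne_zero x)
        simp only [G, H, A.left_inv]
        by_cases hx : A.toMap x ∈ B
        · rw [indicator_of_mem (show (x : UnitAddCircle) ∈ A.toMap ⁻¹' B from hx), ← A.toMap_coe,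
            indicator_of_mem hx, Pi.one_apply, one_mul, ← ENNReal.ofReal_mul hne.le,
            mul_div_cancel₀ _ hne.ne']
        · rw [indicator_of_notMem (show (x : UnitAddCircle) ∉ A.toMap ⁻¹' B from hx), ← A.toMap_coe,
            indicator_of_notMem hx]
          simp
    _ = ∫⁻ x in A.F '' Ioc 0 1, G x :=
        (lintegral_image_eq_lintegral_abs_deriv_mul measurableSet_Ioc
          (fun x _ => (A.hasDerivAt x).hasDerivWithinAt)
          (Function.LeftInverse.injective A.left_inv).injOn G).symm
    _ = ∫⁻ x in Ioc c (c + A.d.natAbs), G x := setLIntegral_congr hc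
    _ = ∑ i ∈ Finset.range A.d.natAbs, ∫⁻ x in Ioc c (c + 1), G (x + i) :=
        lintegral_Ioc_add_nat G c _
    _ = ∫⁻ x in Ioc c (c + 1), ∑ i ∈ Finset.range A.d.natAbs, G (x + i) :=
        (lintegral_finsetSum _ fun i _ => hGm.comp (measurable_add_const _)).symm
    _ = _ := by
        refine lintegral_congr fun x => ?_
        simp only [G, coe_add_nat]
        rw [← Finset.mul_sum, ← ENNReal.ofReal_sum_of_nonneg
          fun i _ => div_nonneg (h0 _) (abs_nonneg _)]
        by_cases hx : (x : UnitAddCircle) ∈ B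
        · rw [indicator_of_mem hx, indicator_of_mem hx, A.transfer_coe]
          simp
        · simp [indicator_of_notMem hx]

theorem integral_comp_mul_of_nonneg {v w : UnitAddCircle → ℝ} (hv : Measurable v)
    (h0 : ∀ y, 0 ≤ v y) (hw : Measurable w) :
    ∫ y, w (A.toMap y) * v y = ∫ y, w y * A.transfer v y := by
  have hf : Measurable A.toMap := A.continuous_toMap.measurable
  have e : ∀ (u w : UnitAddCircle → ℝ), Measurable u → (∀ y, 0 ≤ u y) →
      ∫ y, w y ∂(volume.withDensity fun y => ENNReal.ofReal (u y)) = ∫ y, w y * u y := by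
    intro u w hu hu0
    rw [integral_withDensity_eq_integral_toReal_smul hu.ennreal_ofReal
      (Eventually.of_forall fun _ => ENNReal.ofReal_lt_top)]
    refine integral_congr_ae (Eventually.of_forall fun y => ?_)
    simp [ENNReal.toReal_ofReal (hu0 y), mul_comm]
  rw [← e v (fun y => w (A.toMap y)) hv h0,
    ← e _ w (A.measurable_transfer hv) (A.transfer_nonneg h0), ← A.map_withDensity hv h0,
    integral_map hf.aemeasurable hw.aestronglyMeasurable]

theorem _root_.Continuous.integrable_circle {v : UnitAddCircle → ℝ} (hv : Continuous v) :
    Integrable v := hv.integrable_of_hasCompactSupport (HasCompactSupport.of_compactSpace v)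

theorem _root_.Continuous.exists_abs_le_circle {v : UnitAddCircle → ℝ} (hv : Continuous v) :
    ∃ C : ℝ, 0 < C ∧ ∀ y, |v y| ≤ C := by
  obtain ⟨y, -, hy⟩ := isCompact_univ.exists_isMaxOn univ_nonempty hv.abs.continuousOn
  exact ⟨|v y| + 1, by positivity, fun z => by have : |v z| ≤ |v y| := hy (mem_univ z); linarith⟩

theorem integral_comp_mul {v w : UnitAddCircle → ℝ} (hv : Continuous v) (hw : Continuous w) :
    ∫ y, w (A.toMap y) * v y = ∫ y, w y * A.transfer v y := by
  obtain ⟨C, hC0, hC⟩ := hv.exists_abs_le_circle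
  have h1 : Continuous (v + fun _ => C) := hv.add continuous_const
  have e1 := A.integral_comp_mul_of_nonneg (v := v + fun _ => C) h1.measurable
    (fun y => by have := neg_abs_le (v y); have := hC y; simp only [Pi.add_apply]; linarith)
    hw.measurable
  have e2 := A.integral_comp_mul_of_nonneg (v := fun _ => C) measurable_const
    (fun _ => hC0.le) hw.measurable
  rw [A.transfer_add] at e1
  simp only [Pi.add_apply, mul_add] at e1
  have hwf : Continuous fun y => w (A.toMap y) := hw.comp A.continuous_toMap
  rw [integral_add (f := fun y => w (A.toMap y) * v y) (g := fun y => w (A.toMap y) * C)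
      (hwf.mul hv).integrable_circle (hwf.mul continuous_const).integrable_circle,
    integral_add (f := fun y => w y * A.transfer v y) (g := fun y => w y * A.transfer (fun _ => C) y)
      (hw.mul (A.continuous_transfer hv)).integrable_circle
      (hw.mul (A.continuous_transfer continuous_const)).integrable_circle] at e1
  linarith

theorem integral_transfer {v : UnitAddCircle → ℝ} (hv : Measurable v) (h0 : ∀ y, 0 ≤ v y) :
    ∫ y, A.transfer v y = ∫ y, v y := by
  simpa using (A.integral_comp_mul_of_nonneg hv h0 (w := fun _ => 1) measurable_const).symm

theorem map_volume : Measure.map A.toMap volume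
    = volume.withDensity fun y => ENNReal.ofReal (A.transfer (fun _ => 1) y) := by
  simpa using A.map_withDensity (v := fun _ => 1) measurable_const fun _ => zero_le_one

theorem isNonsingular : IsNonsingularCircleMap A.toMap := by
  intro B hB
  rw [← Measure.map_apply A.continuous_toMap.measurable hB, A.map_volume]
  constructor
  · exact fun h => withDensity_absolutelyContinuous _ _ h
  · intro h
    refine withDensity_absolutelyContinuous' ?_ ?_ h
    · exact (A.measurable_transfer measurable_const).ennreal_ofReal.aemeasurable
    · refine Eventually.of_forall fun y => ?_
      rw [Ne, ENNReal.ofReal_eq_zero, not_le]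
      exact A.transfer_pos (fun _ => one_pos) y

end CircleLift

end Transfer

section Return

open Set Filter Topology Function
open scoped ENNReal

variable {X : Type*} [MeasurableSpace X]

/-- Push a measure supported on `I` along the first return to `I`, keeping the mass which has not
yet returned outside of `I`, during `n` steps. -/
noncomputable def stopped (f : X → X) (I : Set X) (ν : Measure X) : ℕ → Measure X
  | 0 => 0
  | n + 1 => Measure.map f (ν.restrict I + (stopped f I ν n).restrict Iᶜ)

/-- Iterated (truncated) first return pushforwards. -/
noncomputable def returnPush (f : X → X) (I : Set X) (ν : Measure X) : List ℕ → Measure X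
  | [] => ν
  | N :: l => stopped f I (returnPush f I ν l) N

variable {f : X → X} {I : Set X} {ν ν' μ : Measure X}

theorem stopped_add (hf : Measurable f) (n : ℕ) :
    stopped f I (ν + ν') n = stopped f I ν n + stopped f I ν' n := by
  induction n with
  | zero => simp [stopped]
  | succ n ih =>
    simp only [stopped]
    rw [ih, Measure.restrict_add, Measure.restrict_add, ← Measure.map_add _ _ hf]
    congr 1
    abel

theorem stopped_mono (hf : Measurable f) (h : ν ≤ ν') (n : ℕ) :
    stopped f I ν n ≤ stopped f I ν' n := by
  induction n with
  | zero => exact le_rfl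
  | succ n ih =>
    exact Measure.map_mono (add_le_add (Measure.restrict_mono_measure h _)
      (Measure.restrict_mono_measure ih _)) hf

theorem stopped_le (hf : Measurable f) (hI : MeasurableSet I) (hμ : Measure.map f μ = μ)
    (h : ν ≤ μ) (n : ℕ) : stopped f I ν n ≤ μ := by
  induction n with
  | zero => exact Measure.zero_le _
  | succ n ih =>
    calc stopped f I ν (n + 1) ≤ Measure.map f (μ.restrict I + μ.restrict Iᶜ) :=
          Measure.map_mono (add_le_add (Measure.restrict_mono_measure h _)
            (Measure.restrict_mono_measure ih _)) hf
      _ = μ := by rw [Measure.restrict_add_restrict_compl hI, hμ]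

theorem stopped_le_succ (hf : Measurable f) (n : ℕ) :
    stopped f I ν n ≤ stopped f I ν (n + 1) := by
  induction n with
  | zero => exact Measure.zero_le _
  | succ n ih =>
    exact Measure.map_mono (add_le_add le_rfl (Measure.restrict_mono_measure ih _)) hf

theorem stopped_univ (hf : Measurable f) (n : ℕ) :
    stopped f I ν (n + 1) univ = ν I + stopped f I ν n Iᶜ := by
  simp only [stopped]
  rw [Measure.map_apply hf MeasurableSet.univ]
  simp

theorem isFiniteMeasure_stopped [IsFiniteMeasure ν] (n : ℕ) :
    IsFiniteMeasure (stopped f I ν n) := by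
  induction n with
  | zero => simp only [stopped]; infer_instance
  | succ n ih => simp only [stopped]; infer_instance

theorem stopped_apply_le (hf : Measurable f) (hI : MeasurableSet I) [IsFiniteMeasure ν] (n : ℕ) :
    stopped f I ν n I ≤ ν I := by
  have := isFiniteMeasure_stopped (f := f) (I := I) (ν := ν) n
  have h1 : stopped f I ν n I + stopped f I ν n Iᶜ ≤ ν I + stopped f I ν n Iᶜ := by
    rw [measure_add_measure_compl hI, ← stopped_univ hf]
    exact stopped_le_succ hf n univ
  exact (ENNReal.add_le_add_iff_right (measure_ne_top _ _)).1 h1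

theorem returnPush_add (hf : Measurable f) (l : List ℕ) :
    returnPush f I (ν + ν') l = returnPush f I ν l + returnPush f I ν' l := by
  induction l with
  | nil => rfl
  | cons N l ih => simp only [returnPush]; rw [ih, stopped_add hf]

theorem returnPush_mono (hf : Measurable f) (h : ν ≤ ν') (l : List ℕ) :
    returnPush f I ν l ≤ returnPush f I ν' l := by
  induction l with
  | nil => exact h
  | cons N l ih => exact stopped_mono hf ih N

theorem returnPush_le (hf : Measurable f) (hI : MeasurableSet I) (hμ : Measure.map f μ = μ)
    (h : ν ≤ μ) (l : List ℕ) : returnPush f I ν l ≤ μ := by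
  induction l with
  | nil => exact h
  | cons N l ih => exact stopped_le hf hI hμ ih N

theorem isFiniteMeasure_returnPush [IsFiniteMeasure ν] (l : List ℕ) :
    IsFiniteMeasure (returnPush f I ν l) := by
  induction l with
  | nil => assumption
  | cons N l ih => exact isFiniteMeasure_stopped N

theorem returnPush_apply_le (hf : Measurable f) (hI : MeasurableSet I) [IsFiniteMeasure ν]
    (l : List ℕ) : returnPush f I ν l I ≤ ν I := by
  induction l with
  | nil => exact le_rfl
  | cons N l ih =>
    have := isFiniteMeasure_returnPush (f := f) (I := I) (ν := ν) l
    exact (stopped_apply_le hf hI N).trans ih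

/-- After finitely many returns to `I`, the measure `m` is distributed on `I` with a density which is
bounded above, at least `16 b` on a definite proportion of `I` and at most `b` on another one,
up to errors of relative size `ε`. -/
def IsGoodCell (m : Measure X) (δ M : ℝ) (f : X → X) (ε : ℝ) (I : Set X) : Prop :=
  ∃ (l : List ℕ) (U V : Set X) (b : ℝ), MeasurableSet U ∧ MeasurableSet V ∧ U ⊆ I ∧ V ⊆ I ∧
    δ * m.real I ≤ m.real U ∧ δ * m.real I ≤ m.real V ∧
    (1 - ε) * m.real I ≤ (returnPush f I m l).real I ∧
    (∀ B ⊆ I, MeasurableSet B →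
      (returnPush f I m l).real B ≤ M * m.real B + ε * m.real I) ∧
    (∀ B ⊆ U, MeasurableSet B →
      16 * b * m.real B ≤ (returnPush f I m l).real B + ε * m.real I) ∧
    ∀ B ⊆ V, MeasurableSet B →
      (returnPush f I m l).real B ≤ b * m.real B + ε * m.real I

theorem IsGoodCell.false {m : Measure X} [IsFiniteMeasure m] {δ M ε : ℝ} (hf : Measurable f)
    (hI : MeasurableSet I) (h : IsGoodCell m δ M f ε I) (hδ : 0 < δ) (hM : 1 ≤ M) (hε0 : 0 ≤ ε)
    (hε : 100 * M * ε ≤ δ) (hI0 : 0 < m.real I) (hμ : Measure.map f μ = μ) {A : Set X}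
    (hA : MeasurableSet A) (hle : m.restrict A ≤ μ.restrict A)
    (hle2 : μ.restrict A ≤ m.restrict A + m.restrict A) (hIA : m.real (I \ A) ≤ ε * m.real I) :
    False := by
  obtain ⟨l, U, V, b, hU, hV, hUI, hVI, hδU, hδV, hmass, hup, hUb, hVb⟩ := h
  set T : Measure X → Measure X := fun ν => returnPush f I ν l with hT
  have hμfin : IsFiniteMeasure (μ.restrict A) :=
    ⟨(hle2 univ).trans_lt (measure_lt_top _ _)⟩
  have hfin : ∀ ν : Measure X, IsFiniteMeasure ν → IsFiniteMeasure (T ν) :=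
    fun ν _ => isFiniteMeasure_returnPush l
  have i1 := hfin (m.restrict A) inferInstance
  have i2 := hfin (m.restrict Aᶜ) inferInstance
  have i3 := hfin (μ.restrict A) inferInstance
  have hτ : T m = T (m.restrict A) + T (m.restrict Aᶜ) := by
    rw [← returnPush_add hf, Measure.restrict_add_restrict_compl hA]
  have hτr : ∀ B, (T m).real B = (T (m.restrict A)).real B + (T (m.restrict Aᶜ)).real B := by
    intro B
    rw [hτ, measureReal_add_apply]
  have hreal : ∀ {ν₁ ν₂ : Measure X} [IsFiniteMeasure ν₂], ν₁ ≤ ν₂ → ∀ B, ν₁.real B ≤ ν₂.real B := by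
    intro ν₁ ν₂ _ h B
    exact ENNReal.toReal_mono (measure_ne_top _ _) (h B)
  have hασ : ∀ B, (T (m.restrict A)).real B ≤ (T (μ.restrict A)).real B :=
    hreal (returnPush_mono hf hle l)
  have hσα : ∀ B, (T (μ.restrict A)).real B ≤ 2 * (T (m.restrict A)).real B := by
    intro B
    have := hreal (returnPush_mono (I := I) hf hle2 l |>.trans_eq (returnPush_add hf l)) B
    rw [measureReal_add_apply] at this
    linarith
  have hσμ : ∀ B ⊆ A, MeasurableSet B → (T (μ.restrict A)).real B ≤ μ.real B := by
    intro B hB hBm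
    refine ENNReal.toReal_mono ?_ (returnPush_le hf hI hμ Measure.restrict_le_self l B)
    have := measure_ne_top (μ.restrict A) B
    rwa [Measure.restrict_eq_self μ hB] at this
  have hrA : ∀ B ⊆ A, (μ.restrict A).real B = μ.real B := fun B hB => by
    simp [Measure.real, Measure.restrict_eq_self μ hB]
  have hrm : ∀ B ⊆ A, (m.restrict A).real B = m.real B := fun B hB => by
    simp [Measure.real, Measure.restrict_eq_self m hB]
  have hmμ : ∀ B ⊆ A, m.real B ≤ μ.real B := fun B hB => by
    have := hreal hle B; rwa [hrA B hB, hrm B hB] at this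
  have hμm : ∀ B ⊆ A, μ.real B ≤ 2 * m.real B := fun B hB => by
    have := hreal hle2 B
    rw [measureReal_add_apply, hrA B hB, hrm B hB] at this
    linarith
  have hβ : (T (m.restrict Aᶜ)).real I ≤ ε * m.real I := by
    refine le_trans (ENNReal.toReal_mono (measure_ne_top _ _) (returnPush_apply_le hf hI l)) ?_
    rw [Measure.restrict_apply hI, ← sdiff_eq]
    exact hIA
  have key1 : ∀ B ⊆ A ∩ I, MeasurableSet B → (T m).real B ≤ 2 * m.real B + ε * m.real I := by
    intro B hB hBm
    have h1 : (T (m.restrict Aᶜ)).real B ≤ (T (m.restrict Aᶜ)).real I :=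
      measureReal_mono (hB.trans inter_subset_right)
    have h2 := hσμ B (hB.trans inter_subset_left) hBm
    have h3 := hμm B (hB.trans inter_subset_left)
    linarith [hτr B, hασ B]
  have hmI : m.real I = m.real (I ∩ A) + m.real (I \ A) := (measureReal_inter_add_sdiff hA).symm
  have hσI : μ.real (A ∩ I) - 4 * ε * m.real I ≤ (T (μ.restrict A)).real I := by
    set ν' := m.restrict A + m.restrict A - μ.restrict A
    have hsub : ν' + μ.restrict A = m.restrict A + m.restrict A :=
      Measure.sub_add_cancel_of_le hle2
    have i4 : IsFiniteMeasure ν' := by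
      refine ⟨lt_of_le_of_lt ?_ (measure_lt_top (m.restrict A + m.restrict A) univ)⟩
      rw [← hsub]
      exact le_add_right le_rfl
    have i5 := hfin ν' i4
    have h1 : (T ν').real I ≤ ν'.real I :=
      ENNReal.toReal_mono (measure_ne_top _ _) (returnPush_apply_le hf hI l)
    have h2 : (T ν').real I + (T (μ.restrict A)).real I
        = (T (m.restrict A)).real I + (T (m.restrict A)).real I := by
      rw [← measureReal_add_apply, ← measureReal_add_apply]
      simp only [hT]
      rw [← returnPush_add hf, ← returnPush_add hf, hsub]
    have h3 : ν'.real I + (μ.restrict A).real I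
        = (m.restrict A).real I + (m.restrict A).real I := by
      rw [← measureReal_add_apply, ← measureReal_add_apply, hsub]
    have h4 : (μ.restrict A).real I = μ.real (A ∩ I) := by
      simp [Measure.real, Measure.restrict_apply hI, inter_comm]
    have h5 : (m.restrict A).real I ≤ m.real I := hreal Measure.restrict_le_self I
    have h6 := hτr I
    nlinarith
  have hσd : (T (μ.restrict A)).real (I \ A) ≤ 4 * M * ε * m.real I := by
    have h1 := hup (I \ A) sdiff_subset (hI.diff hA)
    have h2 : (T (m.restrict A)).real (I \ A) ≤ (T m).real (I \ A) := by
      rw [hτr]; linarith [measureReal_nonneg (μ := T (m.restrict Aᶜ)) (s := I \ A)]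
    have h3 := hσα (I \ A)
    have h4 : M * m.real (I \ A) ≤ M * (ε * m.real I) := by gcongr
    have h5 : 0 ≤ ε * m.real I := by positivity
    nlinarith
  have key2 : ∀ B ⊆ A ∩ I, MeasurableSet B → m.real B ≤ 2 * (T m).real B + 8 * M * ε * m.real I := by
    intro B hB hBm
    have hBA := hB.trans inter_subset_left
    have e1 : (T (μ.restrict A)).real I
        = (T (μ.restrict A)).real (I ∩ A) + (T (μ.restrict A)).real (I \ A) :=
      (measureReal_inter_add_sdiff hA).symm
    have e2 : (T (μ.restrict A)).real (I ∩ A)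
        = (T (μ.restrict A)).real B + (T (μ.restrict A)).real ((I ∩ A) \ B) := by
      rw [inter_comm]
      have := measureReal_sdiff_add_inter (μ := T (μ.restrict A)) (s := A ∩ I) hBm
      rw [inter_eq_self_of_subset_right hB] at this
      linarith
    have e3 : μ.real (A ∩ I) = μ.real B + μ.real ((A ∩ I) \ B) := by
      have := measureReal_sdiff_add_inter (μ := μ.restrict A) (s := A ∩ I) hBm
      rw [inter_eq_self_of_subset_right hB, hrA _ hBA, hrA _ inter_subset_left,
        hrA _ (sdiff_subset.trans inter_subset_left)] at this
      linarith
    have e4 := hσμ ((I ∩ A) \ B) (sdiff_subset.trans inter_subset_right) ((hI.inter hA).diff hBm)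
    rw [inter_comm I A] at e4 e2 e1
    have e5 := hmμ B hBA
    have e6 := hσα B
    have e7 : (T (m.restrict A)).real B ≤ (T m).real B := by
      rw [hτr]; linarith [measureReal_nonneg (μ := T (m.restrict Aᶜ)) (s := B)]
    have e8 : 0 ≤ ε * m.real I := by positivity
    nlinarith
  have hbig : ∀ W ⊆ I, MeasurableSet W → δ * m.real I ≤ m.real W →
      (δ / 2) * m.real I ≤ m.real (W ∩ A) := by
    intro W hW hWm hδW
    have h1 : m.real W = m.real (W ∩ A) + m.real (W \ A) := (measureReal_inter_add_sdiff hA).symm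
    have h2 : m.real (W \ A) ≤ m.real (I \ A) := measureReal_mono (sdiff_subset_sdiff_left hW)
    have h3 : ε * m.real I ≤ (δ / 2) * m.real I := by
      gcongr
      nlinarith
    linarith
  have hδε : ε ≤ δ / 100 := by nlinarith
  have hU1 := hbig U hUI hU hδU
  have hV1 := hbig V hVI hV hδV
  have f1 := hUb (U ∩ A) inter_subset_left (hU.inter hA)
  have f2 := key1 (U ∩ A) (fun x hx => ⟨hx.2, hUI hx.1⟩) (hU.inter hA)
  have f3 := hVb (V ∩ A) inter_subset_left (hV.inter hA)
  have f4 := key2 (V ∩ A) (fun x hx => ⟨hx.2, hVI hx.1⟩) (hV.inter hA)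
  have hpos : 0 < δ * m.real I := by positivity
  have g1 : ε * m.real I ≤ δ * m.real I / 100 := by nlinarith
  have g2 : M * ε * m.real I ≤ δ * m.real I / 100 := by nlinarith
  have hb : b ≤ 3 / 16 := by
    by_contra hb
    push Not at hb
    have : 3 * m.real (U ∩ A) ≤ 16 * b * m.real (U ∩ A) := by
      have := measureReal_nonneg (μ := m) (s := U ∩ A)
      nlinarith
    nlinarith
  have : b * m.real (V ∩ A) ≤ 3 / 16 * m.real (V ∩ A) := by
    gcongr
  nlinarith

theorem IsGoodCell.mono {m : Measure X} {δ M ε ε' : ℝ} (h : IsGoodCell m δ M f ε I)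
    (hε : ε ≤ ε') : IsGoodCell m δ M f ε' I := by
  obtain ⟨l, U, V, b, hU, hV, hUI, hVI, hδU, hδV, hmass, hup, hUb, hVb⟩ := h
  have h1 : ε * m.real I ≤ ε' * m.real I := by gcongr
  exact ⟨l, U, V, b, hU, hV, hUI, hVI, hδU, hδV, by linarith,
    fun B hB hBm => by linarith [hup B hB hBm], fun B hB hBm => by linarith [hUb B hB hBm],
    fun B hB hBm => by linarith [hVb B hB hBm]⟩

/-- The space is partitioned, up to a null set, into finitely many small good cells. -/
def HasGoodPartition {X : Type*} [MetricSpace X] [MeasurableSpace X] (m : Measure X) (δ M : ℝ)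
    (f : X → X) (ε : ℝ) : Prop :=
  ∃ (n : ℕ) (I : Fin n → Set X), (∀ i, MeasurableSet (I i)) ∧ Pairwise (Disjoint on I) ∧
    m (⋃ i, I i)ᶜ = 0 ∧ (∀ i, ∀ x ∈ I i, ∀ y ∈ I i, dist x y ≤ ε) ∧ (∀ i, 0 < m.real (I i)) ∧
    ∀ i, IsGoodCell m δ M f ε (I i)

theorem exists_dense_cell {X : Type*} [MetricSpace X] [MeasurableSpace X] [BorelSpace X]
    [ProperSpace X] {m : Measure X} [IsFiniteMeasure m] {A : Set X} (hA : MeasurableSet A)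
    (hA0 : m A ≠ 0) {η : ℝ} (hη : 0 < η) :
    ∃ r : ℝ, 0 < r ∧ ∀ (n : ℕ) (I : Fin n → Set X), (∀ i, MeasurableSet (I i)) →
      Pairwise (Disjoint on I) → m (⋃ i, I i)ᶜ = 0 →
      (∀ i, ∀ x ∈ I i, ∀ y ∈ I i, dist x y ≤ r) →
      ∃ i, m.real (I i \ A) ≤ η * m.real (I i) := by
  obtain ⟨C, hCA, hC, hC0⟩ := hA.exists_isCompact_lt_add (μ := m) (measure_ne_top _ _)
    (ε := m A) hA0
  have hmC : 0 < m.real C := by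
    refine ENNReal.toReal_pos ?_ (measure_ne_top _ _)
    intro h
    rw [h, zero_add] at hC0
    exact lt_irrefl _ hC0
  have ht := (ENNReal.tendsto_toReal (measure_ne_top m C)).comp
    (tendsto_measure_cthickening_of_isCompact hC (μ := m))
  have hev := ht.eventually (gt_mem_nhds (show m.real C < m.real C + η * m.real C by
    have : 0 < η * m.real C := by positivity
    linarith))
  obtain ⟨r, hr, hr0⟩ := ((hev.filter_mono nhdsWithin_le_nhds).and
    (self_mem_nhdsWithin (s := Ioi (0 : ℝ)) (a := 0))).exists
  refine ⟨r, hr0, fun n I hIm hId hI0 hIr => ?_⟩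
  by_contra! hcon
  classical
  let S : Finset (Fin n) := Finset.univ.filter fun i => (I i ∩ C).Nonempty
  have hd : Set.PairwiseDisjoint (↑S) I := fun i _ j _ hij => hId hij
  have h1 : m.real C ≤ ∑ i ∈ S, m.real (I i) := by
    rw [← measureReal_biUnion_finset hd fun i _ => hIm i]
    have : m.real C ≤ m.real ((⋃ i ∈ S, I i) ∪ (⋃ i, I i)ᶜ) := by
      refine measureReal_mono fun x hx => ?_
      by_cases hxI : x ∈ ⋃ i, I i
      · obtain ⟨i, hi⟩ := mem_iUnion.1 hxI
        exact Or.inl (mem_biUnion (show i ∈ S from Finset.mem_filter.2 ⟨Finset.mem_univ _, x, hi, hx⟩) hi)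
      · exact Or.inr hxI
    refine this.trans ((measureReal_union_le _ _).trans ?_)
    have h0 : m.real (⋃ i, I i)ᶜ = 0 := by rw [measureReal_def, hI0]; rfl
    rw [h0, add_zero]
  have h2 : ∑ i ∈ S, m.real (I i \ A) ≤ m.real (Metric.cthickening r C) - m.real C := by
    rw [← measureReal_biUnion_finset (fun i hi j hj hij => (hd hi hj hij).mono sdiff_subset sdiff_subset)
      fun i _ => (hIm i).diff hA]
    rw [← measureReal_sdiff (Metric.self_subset_cthickening C) hC.measurableSet]
    refine measureReal_mono fun x hx => ?_
    simp only [mem_iUnion] at hx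
    obtain ⟨i, hi, hxi, hxA⟩ := hx
    obtain ⟨y, hyI, hyC⟩ := (Finset.mem_filter.1 hi).2
    exact ⟨Metric.mem_cthickening_of_dist_le x y r C hyC (hIr i x hxi y hyI), fun h => hxA (hCA h)⟩
  have h3 : η * ∑ i ∈ S, m.real (I i) ≤ ∑ i ∈ S, m.real (I i \ A) := by
    rw [Finset.mul_sum]
    exact Finset.sum_le_sum fun i _ => (hcon i).le
  have h4 : m.real (Metric.cthickening r C) < m.real C + η * m.real C := hr
  nlinarith

theorem exists_comparable_set {m μ : Measure X} [IsFiniteMeasure m] [SigmaFinite μ]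
    (h0 : μ ≠ 0) (hac : μ ≪ m) :
    ∃ (a : ℝ≥0∞) (A : Set X), MeasurableSet A ∧ m A ≠ 0 ∧
      m.restrict A ≤ (a • μ).restrict A ∧
      (a • μ).restrict A ≤ m.restrict A + m.restrict A := by
  set φ := μ.rnDeriv m
  have hφ : Measurable φ := Measure.measurable_rnDeriv μ m
  have hμ : m.withDensity φ = μ := Measure.withDensity_rnDeriv_eq μ m hac
  obtain ⟨i, hi⟩ : ∃ i : ℤ, m (φ ⁻¹' Ico (2 ^ i) (2 ^ (i + 1))) ≠ 0 := by
    by_contra! hcon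
    apply h0
    rw [← hμ]
    have : φ =ᵐ[m] 0 := by
      have h1 : ∀ᵐ x ∂m, ∀ i : ℤ, φ x ∉ Ico (2 ^ i) (2 ^ (i + 1)) := by
        rw [ae_all_iff]
        intro i
        rw [ae_iff]
        simp only [not_not]
        exact hcon i
      filter_upwards [h1, Measure.rnDeriv_lt_top μ m] with x hx hx2
      by_contra hne
      obtain ⟨n, hn⟩ := ENNReal.exists_mem_Ico_zpow (x := φ x) (y := 2) hne hx2.ne
        (by norm_num) (by norm_num)
      exact hx n hn
    rw [withDensity_congr_ae this, withDensity_zero]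
  set a : ℝ≥0∞ := 2 ^ i with ha
  have ha0 : a ≠ 0 := (ENNReal.zpow_pos (by norm_num) (by norm_num) i).ne'
  have hat : a ≠ ⊤ := (ENNReal.zpow_lt_top (by norm_num) (by norm_num) i).ne
  have ha2 : (2 : ℝ≥0∞) ^ (i + 1) = a * 2 := by
    rw [ENNReal.zpow_add (by norm_num) (by norm_num), zpow_one]
  have hA : MeasurableSet (φ ⁻¹' Ico (2 ^ i) (2 ^ (i + 1))) := hφ measurableSet_Ico
  have hB : ∀ B ⊆ φ ⁻¹' Ico (2 ^ i) (2 ^ (i + 1)), MeasurableSet B →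
      a * m B ≤ μ B ∧ μ B ≤ a * 2 * m B := by
    intro B hB hBm
    rw [← hμ, withDensity_apply _ hBm, ← setLIntegral_const, ← setLIntegral_const]
    exact ⟨setLIntegral_mono' hBm fun x hx => (hB hx).1,
      setLIntegral_mono' hBm fun x hx => ((hB hx).2.le).trans_eq ha2⟩
  refine ⟨a⁻¹, _, hA, hi, Measure.le_iff.2 fun B hBm => ?_, Measure.le_iff.2 fun B hBm => ?_⟩
  · rw [Measure.restrict_apply hBm, Measure.restrict_apply hBm, Measure.smul_apply, smul_eq_mul]
    have := (hB _ inter_subset_right (hBm.inter hA)).1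
    calc m (B ∩ _) = a⁻¹ * (a * m (B ∩ φ ⁻¹' Ico (2 ^ i) (2 ^ (i + 1)))) := by
          rw [← mul_assoc, ENNReal.inv_mul_cancel ha0 hat, one_mul]
      _ ≤ _ := by gcongr
  · rw [Measure.restrict_apply hBm, Measure.add_apply, Measure.restrict_apply hBm,
      Measure.smul_apply, smul_eq_mul]
    have := (hB _ inter_subset_right (hBm.inter hA)).2
    calc a⁻¹ * μ (B ∩ φ ⁻¹' Ico (2 ^ i) (2 ^ (i + 1)))
        ≤ a⁻¹ * (a * 2 * m (B ∩ φ ⁻¹' Ico (2 ^ i) (2 ^ (i + 1)))) := by gcongr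
      _ = _ := by
        rw [← mul_assoc, ← mul_assoc, ENNReal.inv_mul_cancel ha0 hat, one_mul, two_mul]

theorem not_exists_isAciSigma {f : UnitAddCircle → UnitAddCircle} (hf : Measurable f) {δ M : ℝ}
    (hδ : 0 < δ) (hM : 1 ≤ M) (h : ∀ ε > 0, HasGoodPartition volume δ M f ε) :
    ¬ ∃ μ : Measure UnitAddCircle, IsAciSigma f μ := by
  rintro ⟨μ, hμ⟩
  have := hμ.sigmaFinite
  obtain ⟨a, A, hA, hA0, hle, hle2⟩ := exists_comparable_set hμ.ne_zero hμ.absolutelyContinuous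
  have hη : 0 < δ / (100 * M) := by positivity
  obtain ⟨r, hr0, hr⟩ := exists_dense_cell (m := volume) hA hA0 hη
  obtain ⟨n, I, hIm, hId, hI0, hIr, hIpos, hIg⟩ := h (min r (δ / (100 * M))) (lt_min hr0 hη)
  obtain ⟨i, hi⟩ := hr n I hIm hId hI0 fun i x hx y hy => (hIr i x hx y hy).trans (min_le_left _ _)
  refine ((hIg i).mono (min_le_right _ _)).false hf (hIm i) hδ hM hη.le ?_ (hIpos i)
    (μ := a • μ) ?_ hA hle hle2 hi
  · rw [mul_div_cancel₀ _ (by positivity)]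
  · rw [Measure.map_smul, hμ.invariant.map_eq]

end Return

section Openness

open Set Filter Topology Function
open scoped ENNReal

theorem ExpandingC1.eventually_dist_lt (g : ExpandingC1) {η : ℝ} (hη : 0 < η) :
    ∀ᶠ f : ExpandingC1 in 𝓝 g, (∀ x, dist (f.1.toFun x) (g.1.toFun x) < η) ∧
      ∀ x, |circleDeriv f.1.toFun x - circleDeriv g.1.toFun x| < η := by
  have h1 : Continuous fun f : ExpandingC1 => (f.1.toContinuousMap, f.1.derivMap) :=
    (continuous_induced_dom (f := fun f : C1CircleMap => (f.toContinuousMap, f.derivMap))).comp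
      continuous_subtype_val
  have h2 := h1.continuousAt.eventually (Metric.ball_mem_nhds
    (g.1.toContinuousMap, g.1.derivMap) hη)
  filter_upwards [h2] with f hf
  rw [Prod.dist_eq, max_lt_iff] at hf
  exact ⟨fun x => (ContinuousMap.dist_lt_iff hη).1 hf.1 x,
    fun x => (ContinuousMap.dist_lt_iff hη).1 hf.2 x⟩

theorem ExpandingC1.exists_forall_mem {g : ExpandingC1} {W : Set ExpandingC1} (hW : W ∈ 𝓝 g) :
    ∃ η : ℝ, 0 < η ∧ ∀ f : ExpandingC1, (∀ x, dist (f.1.toFun x) (g.1.toFun x) < η) →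
      (∀ x, |circleDeriv f.1.toFun x - circleDeriv g.1.toFun x| < η) → f ∈ W := by
  have h1 : 𝓝 g = comap (fun f : ExpandingC1 => (f.1.toContinuousMap, f.1.derivMap))
      (𝓝 (g.1.toContinuousMap, g.1.derivMap)) := by
    rw [nhds_subtype_eq_comap, nhds_induced, comap_comap]
    rfl
  rw [h1] at hW
  obtain ⟨t, ht, htW⟩ := hW
  obtain ⟨η, hη, hb⟩ := Metric.mem_nhds_iff.1 ht
  refine ⟨η, hη, fun f hf1 hf2 => htW (hb ?_)⟩
  rw [Metric.mem_ball, Prod.dist_eq, max_lt_iff]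
  exact ⟨(ContinuousMap.dist_lt_iff hη).2 hf1, (ContinuousMap.dist_lt_iff hη).2 hf2⟩

theorem ExpandingC1.exists_lift (f : ExpandingC1) (y₀ : ℝ)
    (hy₀ : (y₀ : UnitAddCircle) = f.1.toFun 0) :
    ∃ A : CircleLift, A.toMap = f.1.toFun ∧ A.F 0 = y₀ :=
  let ⟨A, h, h0, _⟩ := f.1.exists_circleLift f.2.deriv_ne_zero y₀ hy₀
  ⟨A, h, h0⟩

namespace CircleLift

/-- Two lifts of the same degree are uniformly `η`-close in the `C¹` topology. -/
structure Close (A B : CircleLift) (η : ℝ) : Prop where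
  d_eq : B.d = A.d
  abs_sub_le : ∀ x, |B.F x - A.F x| ≤ η
  abs_deriv_sub_le : ∀ x, |B.F' x - A.F' x| ≤ η

theorem abs_sub_sub_le {A B : CircleLift} {η : ℝ} (h : ∀ x, |B.F' x - A.F' x| ≤ η) (x y : ℝ) :
    |(B.F x - A.F x) - (B.F y - A.F y)| ≤ η * |x - y| :=
  Convex.norm_image_sub_le_of_norm_hasDerivWithin_le (f := fun x => B.F x - A.F x)
    (fun x _ => ((B.hasDerivAt x).sub (A.hasDerivAt x)).hasDerivWithinAt)
    (fun x _ => h x) convex_univ (mem_univ y) (mem_univ x)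

theorem close_of_abs_sub_le {A B : CircleLift} {η : ℝ} (hη : η < 1) (h0 : |B.F 0 - A.F 0| ≤ η)
    (h : ∀ x, |B.F' x - A.F' x| ≤ η) : A.Close B (2 * η) := by
  have hη0 : 0 ≤ η := (abs_nonneg _).trans h0
  have hd : B.d = A.d := by
    have h1 := abs_sub_sub_le h 1 0
    have hA := A.map_add_one 0
    have hB := B.map_add_one 0
    rw [zero_add] at hA hB
    rw [hA, hB, sub_zero, abs_one, mul_one,
      show B.F 0 + B.d - (A.F 0 + A.d) - (B.F 0 - A.F 0) = ((B.d - A.d : ℤ) : ℝ) by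
        push_cast; ring] at h1
    have h2 : |B.d - A.d| < 1 := by
      have : ((|B.d - A.d| : ℤ) : ℝ) < 1 := by rw [Int.cast_abs]; linarith
      exact_mod_cast this
    exact sub_eq_zero.1 (Int.abs_lt_one_iff.1 h2)
  refine ⟨hd, fun x => ?_, fun x => (h x).trans (by linarith)⟩
  have hper : Function.Periodic (fun x => B.F x - A.F x) 1 := by
    intro x
    simp only [A.map_add_one, B.map_add_one, hd]
    ring
  obtain ⟨y, hy, hxy⟩ := hper.exists_mem_Ico₀ one_pos x
  change B.F x - A.F x = B.F y - A.F y at hxy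
  rw [hxy]
  have h1 := abs_sub_sub_le h y 0
  have h2 : |y - 0| ≤ 1 := by rw [sub_zero, abs_of_nonneg hy.1]; exact hy.2.le
  have h3 : |B.F y - A.F y| ≤ |(B.F y - A.F y) - (B.F 0 - A.F 0)| + |B.F 0 - A.F 0| := by
    have := abs_add_le ((B.F y - A.F y) - (B.F 0 - A.F 0)) (B.F 0 - A.F 0)
    simpa using this
  nlinarith

theorem eventually_exists_close {g : ExpandingC1} {A : CircleLift} (hA : A.toMap = g.1.toFun)
    {η : ℝ} (hη : 0 < η) :
    ∀ᶠ f : ExpandingC1 in 𝓝 g, ∃ B : CircleLift, B.toMap = f.1.toFun ∧ A.Close B η := by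
  have hη' : 0 < min (η / 2) (1 / 2) := lt_min (by linarith) (by norm_num)
  filter_upwards [g.eventually_dist_lt hη'] with f hf
  have hA0 : (A.F 0 : UnitAddCircle) = g.1.toFun 0 := by rw [← A.toMap_coe, hA]; rfl
  obtain ⟨B, hB, hB0⟩ := f.exists_lift (A.F 0 + circleRep (f.1.toFun 0 - g.1.toFun 0)) (by
    rw [AddCircle.coe_add, coe_circleRep, hA0]
    abel)
  have hc : A.Close B (2 * min (η / 2) (1 / 2)) := by
    refine close_of_abs_sub_le ((min_le_right _ _).trans_lt (by norm_num)) ?_ fun x => ?_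
    · rw [hB0, add_sub_cancel_left, abs_circleRep, ← dist_eq_norm]
      exact (hf.1 0).le
    · rw [← A.circleDeriv_toMap, ← B.circleDeriv_toMap, hA, hB]
      exact (hf.2 x).le
  have h2 : 2 * min (η / 2) (1 / 2) ≤ η := by linarith [min_le_left (η / 2) (1 / 2 : ℝ)]
  exact ⟨B, hB, hc.d_eq, fun x => (hc.abs_sub_le x).trans h2,
    fun x => (hc.abs_deriv_sub_le x).trans h2⟩

theorem exists_transfer_close (A : CircleLift) {v : UnitAddCircle → ℝ} (hv : Continuous v) {ε : ℝ}
    (hε : 0 < ε) : ∃ η : ℝ, 0 < η ∧ ∀ B : CircleLift, A.Close B η →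
      ∀ y, |B.transfer v y - A.transfer v y| ≤ ε := by
  obtain ⟨c, hc0, hc⟩ := A.exists_lower
  obtain ⟨C, hC0, hC⟩ := hv.exists_abs_le_circle
  set D : ℝ := ((A.d.natAbs : ℕ) : ℝ) with hD
  have hD0 : 0 < D := by
    rw [hD]; exact_mod_cast Nat.pos_of_ne_zero (Int.natAbs_ne_zero.2 A.d_ne_zero)
  let w : UnitAddCircle → ℝ := fun y => v y / |circleDeriv A.toMap y|
  have hw : Continuous w := by
    refine hv.div A.toC1.continuous_deriv.abs fun y => ?_
    obtain ⟨x, rfl⟩ := exists_coe_eq y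
    have := A.deriv_ne_zero x
    rw [← A.circleDeriv_toMap] at this
    exact abs_ne_zero.2 this
  obtain ⟨r, hr0, hr⟩ := Metric.uniformContinuous_iff.1
    (CompactSpace.uniformContinuous_of_continuous hw) (ε / (2 * D)) (by positivity)
  set η := min (c / 2) (min (r * c / 2) (ε * c * c / (4 * D * C))) with hηdef
  have hη : 0 < η := by positivity
  have h1 : η ≤ c / 2 := min_le_left _ _
  have h2 : η ≤ r * c / 2 := (min_le_right _ _).trans (min_le_left _ _)
  have h3 : η ≤ ε * c * c / (4 * D * C) := (min_le_right _ _).trans (min_le_right _ _)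
  refine ⟨η, hη, fun B hB y => ?_⟩
  have key : ∀ x, abs (v (B.Φ x : ℝ) / |B.F' (B.Φ x)| - v (A.Φ x : ℝ) / |A.F' (A.Φ x)|) ≤ ε / D := by
    intro x
    set a := A.Φ x
    set b := B.Φ x with hb
    have hab : |b - a| < r := by
      have e1 := A.abs_inv_sub_le hc0 hc (A.F b) x
      rw [A.left_inv] at e1
      have e2 : |A.F b - x| ≤ η := by
        have := hB.abs_sub_le b
        rw [hb, B.right_inv] at this
        rw [abs_sub_comm]
        exact this
      refine e1.trans_lt ?_
      rw [div_lt_iff₀ hc0]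
      nlinarith
    have e3 : |w b - w a| ≤ ε / (2 * D) := (hr ((dist_coe_le b a).trans_lt hab)).le
    simp only [w, A.circleDeriv_toMap] at e3
    have hca := hc b
    have hcb : c / 2 ≤ |B.F' b| := by
      have := hB.abs_deriv_sub_le b
      have := abs_sub_abs_le_abs_sub (A.F' b) (B.F' b)
      rw [abs_sub_comm] at this
      linarith
    have hA0 : 0 < |A.F' b| := by linarith
    have hB0 : 0 < |B.F' b| := by linarith
    have e4 : abs (v b / |B.F' b| - v b / |A.F' b|) ≤ ε / (2 * D) := by
      have : v b / |B.F' b| - v b / |A.F' b| = v b * (|A.F' b| - |B.F' b|) / (|B.F' b| * |A.F' b|) := by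
        field_simp
      rw [this, abs_div, abs_mul, abs_mul, abs_abs, abs_abs, div_le_iff₀ (by positivity)]
      have e5 : |(|A.F' b| - |B.F' b|)| ≤ η :=
        (abs_abs_sub_abs_le _ _).trans (by rw [abs_sub_comm]; exact hB.abs_deriv_sub_le b)
      calc |v b| * |(|A.F' b| - |B.F' b|)| ≤ C * (ε * c * c / (4 * D * C)) :=
            mul_le_mul (hC _) (e5.trans h3) (abs_nonneg _) hC0.le
        _ = ε / (2 * D) * (c / 2 * c) := by field_simp; norm_num
        _ ≤ _ := by gcongr
    have e6 : ε / D = ε / (2 * D) + ε / (2 * D) := by field_simp; norm_num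
    rw [e6]
    refine le_trans ?_ (add_le_add e4 e3)
    refine le_trans (le_of_eq ?_) (abs_add_le _ _)
    congr 1
    ring
  obtain ⟨x, rfl⟩ := exists_coe_eq y
  rw [A.transfer_coe, B.transfer_coe, hB.d_eq, ← Finset.sum_sub_distrib]
  calc |∑ i ∈ Finset.range A.d.natAbs, _| ≤ ∑ i ∈ Finset.range A.d.natAbs, ε / D :=
        (Finset.abs_sum_le_sum_abs _ _).trans (Finset.sum_le_sum fun i _ => key _)
    _ = ε := by
        rw [Finset.sum_const, Finset.card_range, nsmul_eq_mul, ← hD]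
        field_simp

end CircleLift

/-- Continuity at `g`, in total variation, of a family of measures indexed by expanding maps. -/
def TVContinuousAt (ν : ExpandingC1 → Measure UnitAddCircle) (g : ExpandingC1) : Prop :=
  ∀ ε > 0, ∀ᶠ f in 𝓝 g, ∀ B, MeasurableSet B → |(ν f).real B - (ν g).real B| ≤ ε

theorem abs_withDensity_real_sub_le {v w : UnitAddCircle → ℝ} (hv : Integrable v)
    (hw : Integrable w) (hv0 : ∀ y, 0 ≤ v y) (hw0 : ∀ y, 0 ≤ w y) {ε : ℝ}
    (h : ∫ y, |v y - w y| ≤ ε) {B : Set UnitAddCircle} (hB : MeasurableSet B) :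
    |(volume.withDensity fun y => ENNReal.ofReal (v y)).real B
      - (volume.withDensity fun y => ENNReal.ofReal (w y)).real B| ≤ ε := by
  have e : ∀ u : UnitAddCircle → ℝ, Integrable u → (∀ y, 0 ≤ u y) →
      (volume.withDensity fun y => ENNReal.ofReal (u y)).real B = ∫ y in B, u y := by
    intro u hu hu0
    rw [measureReal_def, withDensity_apply _ hB,
      integral_eq_lintegral_of_nonneg_ae (Eventually.of_forall hu0) hu.restrict.aestronglyMeasurable]
  rw [e v hv hv0, e w hw hw0, ← integral_sub hv.restrict hw.restrict]
  calc |∫ y in B, (v y - w y)| ≤ ∫ y in B, |v y - w y| := abs_integral_le_integral_abs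
    _ ≤ ∫ y, |v y - w y| := setIntegral_le_integral (hv.sub hw).abs
        (Eventually.of_forall fun _ => abs_nonneg _)
    _ ≤ ε := h

theorem tvContinuousAt_map {ν : Measure UnitAddCircle} [IsFiniteMeasure ν] (hν : ν ≪ volume)
    (g : ExpandingC1) : TVContinuousAt (fun f => Measure.map f.1.toFun ν) g := by
  intro ε hε
  obtain ⟨A, hA, -⟩ := g.exists_lift _ (coe_circleRep (g.1.toFun 0))
  set φ : UnitAddCircle → ℝ := fun y => (ν.rnDeriv volume y).toReal with hφdef
  have hφi : Integrable φ := Measure.integrable_toReal_rnDeriv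
  have hφ : volume.withDensity (fun y => ENNReal.ofReal (φ y)) = ν := by
    conv_rhs => rw [← Measure.withDensity_rnDeriv_eq ν volume hν]
    refine withDensity_congr_ae ?_
    filter_upwards [Measure.rnDeriv_lt_top ν volume] with y hy
    rw [hφdef, ENNReal.ofReal_toReal hy.ne]
  obtain ⟨u, hu, hui⟩ := hφi.exists_boundedContinuous_integral_sub_le (ε := ε / 3) (by positivity)
  let v : UnitAddCircle → ℝ := fun y => max (u y) 0
  have hvc : Continuous v := u.continuous.max continuous_const
  have hv0 : ∀ y, 0 ≤ v y := fun y => le_max_right _ _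
  have hvφ : ∫ y, |φ y - v y| ≤ ε / 3 := by
    refine le_trans (integral_mono (hφi.sub hvc.integrable_circle).abs (hφi.sub hui).norm
      fun y => ?_) hu
    have h0 : 0 ≤ φ y := ENNReal.toReal_nonneg
    simp only [v, Real.norm_eq_abs, Pi.sub_apply]
    rcases le_total (u y) 0 with h | h
    · rw [max_eq_right h, sub_zero, abs_of_nonneg h0, abs_of_nonneg (by linarith)]
      linarith
    · rw [max_eq_left h]
  have h1 : ∀ f : UnitAddCircle → UnitAddCircle, Measurable f → ∀ B, MeasurableSet B →
      |(Measure.map f ν).real B - (Measure.map f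
        (volume.withDensity fun y => ENNReal.ofReal (v y))).real B| ≤ ε / 3 := by
    intro f hf B hB
    rw [map_measureReal_apply hf hB, map_measureReal_apply hf hB, ← hφ]
    exact abs_withDensity_real_sub_le hφi hvc.integrable_circle (fun _ => ENNReal.toReal_nonneg)
      hv0 hvφ (hf hB)
  obtain ⟨η, hη, hclose⟩ := A.exists_transfer_close hvc (ε := ε / 3) (by positivity)
  filter_upwards [CircleLift.eventually_exists_close hA hη] with f ⟨B, hB, hAB⟩ S hS
  have e1 := h1 f.1.toFun f.1.continuous_toFun.measurable S hS
  have e2 := h1 g.1.toFun g.1.continuous_toFun.measurable S hS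
  have e3 : |(Measure.map f.1.toFun (volume.withDensity fun y => ENNReal.ofReal (v y))).real S
      - (Measure.map g.1.toFun (volume.withDensity fun y => ENNReal.ofReal (v y))).real S|
      ≤ ε / 3 := by
    rw [← hA, ← hB, A.map_withDensity hvc.measurable hv0, B.map_withDensity hvc.measurable hv0]
    refine abs_withDensity_real_sub_le (B.continuous_transfer hvc).integrable_circle
      (A.continuous_transfer hvc).integrable_circle (B.transfer_nonneg hv0) (A.transfer_nonneg hv0)
      ?_ hS
    have := integral_mono (μ := (volume : Measure UnitAddCircle))
      (((B.continuous_transfer hvc).sub (A.continuous_transfer hvc)).abs.integrable_circle)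
      (integrable_const (ε / 3)) (fun y => hclose B hAB y)
    simpa [measureReal_def] using this
  rw [abs_le] at *
  constructor <;> linarith [e1.1, e1.2, e2.1, e2.2, e3.1, e3.2]

theorem ExpandingC1.map_absolutelyContinuous (g : ExpandingC1) {ν : Measure UnitAddCircle}
    (h : ν ≪ volume) : Measure.map g.1.toFun ν ≪ volume := by
  obtain ⟨A, hA, -⟩ := g.exists_lift _ (coe_circleRep (g.1.toFun 0))
  refine Measure.AbsolutelyContinuous.mk fun B hB hB0 => ?_
  rw [Measure.map_apply g.1.continuous_toFun.measurable hB]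
  apply h
  rw [← hA]
  exact (A.isNonsingular B hB).1 hB0

theorem stopped_absolutelyContinuous (g : ExpandingC1) {I : Set UnitAddCircle}
    {ν : Measure UnitAddCircle} (hν : ν ≪ volume) (n : ℕ) :
    stopped g.1.toFun I ν n ≪ volume := by
  induction n with
  | zero => exact Measure.AbsolutelyContinuous.zero _
  | succ n ih =>
    refine g.map_absolutelyContinuous (Measure.AbsolutelyContinuous.add_left ?_ ?_)
    · exact Measure.restrict_le_self.absolutelyContinuous.trans hν
    · exact Measure.restrict_le_self.absolutelyContinuous.trans ih

theorem returnPush_absolutelyContinuous (g : ExpandingC1) {I : Set UnitAddCircle} (l : List ℕ) :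
    returnPush g.1.toFun I volume l ≪ volume := by
  induction l with
  | nil => exact Measure.AbsolutelyContinuous.rfl
  | cons N l ih => exact stopped_absolutelyContinuous g ih N

theorem TVContinuousAt.stopped {ν : ExpandingC1 → Measure UnitAddCircle} {g : ExpandingC1}
    (hν : TVContinuousAt ν g) [hfin : ∀ f, IsFiniteMeasure (ν f)] (hac : ν g ≪ volume)
    {I : Set UnitAddCircle} (hI : MeasurableSet I) (n : ℕ) :
    TVContinuousAt (fun f => stopped f.1.toFun I (ν f) n) g := by
  induction n with
  | zero => intro ε hε; exact Eventually.of_forall fun f B _ => by simp [_root_.stopped, hε.le]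
  | succ n ih =>
    intro ε hε
    have hfin2 : ∀ f : ExpandingC1, IsFiniteMeasure (_root_.stopped f.1.toFun I (ν f) n) :=
      fun f => isFiniteMeasure_stopped n
    set θ : ExpandingC1 → Measure UnitAddCircle := fun f =>
      (ν f).restrict I + (_root_.stopped f.1.toFun I (ν f) n).restrict Iᶜ with hθ
    have hθac : θ g ≪ volume := by
      refine Measure.AbsolutelyContinuous.add_left ?_ ?_
      · exact Measure.restrict_le_self.absolutelyContinuous.trans hac
      · exact Measure.restrict_le_self.absolutelyContinuous.trans (stopped_absolutelyContinuous g hac n)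
    have h3 : 0 < ε / 3 := by positivity
    filter_upwards [hν _ h3, ih _ h3, tvContinuousAt_map hθac g _ h3] with f h1 h2 h4 B hB
    have hfm : Measurable f.1.toFun := f.1.continuous_toFun.measurable
    have e1 := h4 B hB
    have e2 : |(Measure.map f.1.toFun (θ f)).real B - (Measure.map f.1.toFun (θ g)).real B|
        ≤ ε / 3 + ε / 3 := by
      rw [map_measureReal_apply hfm hB, map_measureReal_apply hfm hB]
      have hS := hfm hB
      simp only [hθ]
      rw [measureReal_add_apply, measureReal_add_apply, measureReal_restrict_apply hS,
        measureReal_restrict_apply hS, measureReal_restrict_apply hS,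
        measureReal_restrict_apply hS]
      have e3 := h1 _ (hS.inter hI)
      have e4 := h2 _ (hS.inter hI.compl)
      rw [abs_le] at *
      constructor <;> linarith [e3.1, e3.2, e4.1, e4.2]
    simp only [_root_.stopped]
    change |(Measure.map f.1.toFun (θ f)).real B - (Measure.map g.1.toFun (θ g)).real B| ≤ ε
    rw [abs_le] at *
    constructor <;> linarith [e1.1, e1.2, e2.1, e2.2]

theorem tvContinuousAt_returnPush (g : ExpandingC1) {I : Set UnitAddCircle}
    (hI : MeasurableSet I) (l : List ℕ) :
    TVContinuousAt (fun f => returnPush f.1.toFun I volume l) g := by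
  induction l with
  | nil => intro ε hε; exact Eventually.of_forall fun f B _ => by simp [returnPush, hε.le]
  | cons N l ih =>
    have : ∀ f : ExpandingC1, IsFiniteMeasure (returnPush f.1.toFun I volume l) :=
      fun f => isFiniteMeasure_returnPush l
    exact ih.stopped (returnPush_absolutelyContinuous g l) hI N

theorem eventually_hasGoodPartition {δ M ε : ℝ} (hε : 0 < ε) {g : ExpandingC1}
    (h : HasGoodPartition volume δ M g.1.toFun (ε / 2)) :
    ∀ᶠ f : ExpandingC1 in 𝓝 g, HasGoodPartition volume δ M f.1.toFun ε := by
  obtain ⟨n, I, hIm, hId, hI0, hIr, hIpos, hIg⟩ := h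
  have key : ∀ i, ∀ᶠ f : ExpandingC1 in 𝓝 g, IsGoodCell volume δ M f.1.toFun ε (I i) := by
    intro i
    obtain ⟨l, U, V, b, hU, hV, hUI, hVI, hδU, hδV, hmass, hup, hUb, hVb⟩ := hIg i
    have hpos : 0 < ε / 2 * volume.real (I i) := by have := hIpos i; positivity
    filter_upwards [tvContinuousAt_returnPush g (hIm i) l _ hpos] with f hf
    have hf' := fun B hB => abs_le.1 (hf B hB)
    refine ⟨l, U, V, b, hU, hV, hUI, hVI, hδU, hδV, ?_, fun B hB hBm => ?_, fun B hB hBm => ?_,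
      fun B hB hBm => ?_⟩
    · linarith [(hf' _ (hIm i)).1]
    · linarith [(hf' _ hBm).2, hup B hB hBm]
    · linarith [(hf' _ hBm).1, hUb B hB hBm]
    · linarith [(hf' _ hBm).2, hVb B hB hBm]
  filter_upwards [eventually_all.2 key] with f hf
  exact ⟨n, I, hIm, hId, hI0, fun i x hx y hy => (hIr i x hx y hy).trans (by linarith), hIpos, hf⟩

theorem exists_residual_of_dense {δ M : ℝ} (hδ : 0 < δ) (hM : 1 ≤ M)
    (h : ∀ ε > 0, Dense {g : ExpandingC1 | HasGoodPartition volume δ M g.1.toFun ε}) :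
    ∃ R : Set ExpandingC1, R ∈ residual ExpandingC1 ∧
      ∀ f ∈ R, IsNonsingularCircleMap f.1.toFun ∧
        ¬ ∃ μ : Measure UnitAddCircle, IsAciSigma f.1.toFun μ := by
  refine ⟨⋂ k : ℕ, {f | HasGoodPartition volume δ M f.1.toFun (1 / ((k : ℝ) + 1))}, ?_, ?_⟩
  · rw [countable_iInter_mem]
    intro k
    have hk : (0 : ℝ) < 1 / ((k : ℝ) + 1) := by positivity
    refine mem_of_superset (residual_of_dense_open isOpen_interior
      ((h (1 / ((k : ℝ) + 1) / 2) (by positivity)).mono fun g hg => ?_)) interior_subset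
    exact mem_interior_iff_mem_nhds.2 (eventually_hasGoodPartition hk hg)
  · intro f hf
    obtain ⟨A, hA, -⟩ := f.exists_lift _ (coe_circleRep (f.1.toFun 0))
    refine ⟨hA ▸ A.isNonsingular,
      not_exists_isAciSigma f.1.continuous_toFun.measurable hδ hM fun ε hε => ?_⟩
    obtain ⟨k, hk⟩ := exists_nat_one_div_lt hε
    obtain ⟨n, I, hIm, hId, hI0, hIr, hIpos, hIg⟩ := mem_iInter.1 hf k
    exact ⟨n, I, hIm, hId, hI0, fun i x hx y hy => (hIr i x hx y hy).trans hk.le, hIpos,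
      fun i => (hIg i).mono hk.le⟩

end Openness

section RuellePerronFrobenius

open Set Filter Topology Function

namespace CircleLift

/-- An adapted lift with bounded distortion, measured with a primitive `K` of the conformal
factor. -/
structure IsRegular (A : CircleLift) (κ K : ℝ → ℝ) (lam D : ℝ) : Prop extends
    A.IsAdapted κ lam where
  hasDerivAt_K : ∀ x, HasDerivAt K (κ x) x
  nonneg : 0 ≤ D
  distortion : ∀ x y, |A.F' y| ≤ Real.exp (D * |K x - K y|) * |A.F' x|

/-- Nonnegative functions whose logarithm varies on the components of the complement of `Z` by at
most `a |K x - K y| + b`, as long as `|K x - K y| ≤ R`. -/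
def InCone (K : ℝ → ℝ) (Z : Set ℝ) (a b R : ℝ) (v : UnitAddCircle → ℝ) : Prop :=
  (∀ y, 0 ≤ v y) ∧ ∀ x y : ℝ, Disjoint (uIcc x y) Z → |K x - K y| ≤ R →
    v x ≤ Real.exp (a * |K x - K y| + b) * v y

variable {A : CircleLift} {κ K : ℝ → ℝ} {lam D : ℝ} (h : A.IsRegular κ K lam D)

include h

theorem IsRegular.lam_pos : 0 < lam := one_pos.trans h.one_lt

theorem IsRegular.strictMono_K : StrictMono K :=
  strictMono_of_hasDerivAt_pos h.hasDerivAt_K h.pos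

theorem IsRegular.K_add_one (x : ℝ) : K (x + 1) = K x + (K 1 - K 0) := by
  have h1 : ∀ x, HasDerivAt (fun x => K (x + 1) - K x) 0 x := by
    intro x
    have := (HasDerivAt.comp_add_const x 1 (h.hasDerivAt_K (x + 1))).sub (h.hasDerivAt_K x)
    rw [h.periodic x, sub_self] at this
    exact this
  have := is_const_of_deriv_eq_zero (fun x => (h1 x).differentiableAt) (fun x => (h1 x).deriv) x 0
  simp only [zero_add] at this
  linarith

theorem IsRegular.K_add_int (x : ℝ) (n : ℤ) : K (x + n) = K x + n * (K 1 - K 0) :=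
  map_add_int_of_map_add_one h.K_add_one x n

theorem IsRegular.mul_abs_sub_le (x y : ℝ) : lam * |K x - K y| ≤ |K (A.F x) - K (A.F y)| := by
  wlog hxy : x < y generalizing x y
  · rcases eq_or_lt_of_le (not_lt.1 hxy) with rfl | h
    · simp
    · rw [abs_sub_comm (K x) (K y), abs_sub_comm (K (A.F x)) (K (A.F y))]
      exact this y x h
  have hKF : ∀ z, HasDerivAt (fun z => K (A.F z)) (κ (A.F z) * A.F' z) z := fun z =>
    (h.hasDerivAt_K (A.F z)).comp z (A.hasDerivAt z)
  obtain ⟨c, -, hc⟩ := exists_ratio_hasDerivAt_eq_ratio_slope (fun z => K (A.F z))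
    (fun z => κ (A.F z) * A.F' z) hxy (fun z _ => (hKF z).continuousAt.continuousWithinAt)
    (fun z _ => hKF z) K κ (fun z _ => (h.hasDerivAt_K z).continuousAt.continuousWithinAt)
    (fun z _ => h.hasDerivAt_K z)
  have h1 := congrArg abs hc
  rw [abs_mul, abs_mul, abs_mul, abs_of_pos (h.pos _), abs_of_pos (h.pos _)] at h1
  have h2 := h.le c
  rw [abs_sub_comm (K x) (K y), abs_sub_comm (K (A.F x)) (K (A.F y))]
  refine le_of_mul_le_mul_right ?_ (h.pos c)
  rw [← h1, mul_right_comm, mul_comm, mul_comm (κ (A.F c))]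
  exact mul_le_mul_of_nonneg_left h2 (abs_nonneg _)

theorem IsRegular.abs_inv_sub_le (x y : ℝ) : |K (A.Φ x) - K (A.Φ y)| ≤ |K x - K y| / lam := by
  have := h.mul_abs_sub_le (A.Φ x) (A.Φ y)
  rw [A.right_inv, A.right_inv] at this
  rw [le_div_iff₀ h.lam_pos]
  linarith

theorem IsRegular.two_le : 2 ≤ |A.d| := by
  have h1 := h.mul_abs_sub_le 1 0
  have h2 : A.F 1 = A.F 0 + A.d := by simpa using A.map_add_one 0
  have h3 : 0 < K 1 - K 0 := sub_pos.2 (h.strictMono_K one_pos)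
  rw [h2, h.K_add_int, add_sub_cancel_left, abs_mul, abs_of_pos h3] at h1
  have h4 := le_of_mul_le_mul_right h1 h3
  have h5 : (1 : ℝ) < |(A.d : ℝ)| := h.one_lt.trans_le h4
  have h6 : 1 < |A.d| := by exact_mod_cast h5
  omega

theorem IsRegular.exists_fixed : ∃ (q : ℝ) (n : ℤ), A.F q = q + n := by
  have hd := h.two_le
  have hg : Continuous fun x => A.F x - x := A.continuous_F.sub continuous_id
  have h2 : A.F 1 = A.F 0 + A.d := by simpa using A.map_add_one 0
  have hd' : (2 : ℝ) ≤ A.d ∨ (A.d : ℝ) ≤ -2 := by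
    rcases abs_cases A.d with ⟨h1, -⟩ | ⟨h1, -⟩
    · left; exact_mod_cast h1 ▸ hd
    · right
      have : A.d ≤ -2 := by omega
      exact_mod_cast this
  obtain ⟨q, hq⟩ : ((⌈min (A.F 0) (A.F 1 - 1)⌉ : ℤ) : ℝ) ∈ range fun x => A.F x - x := by
    have e1 := Int.le_ceil (min (A.F 0) (A.F 1 - 1))
    have e2 := Int.ceil_lt_add_one (min (A.F 0) (A.F 1 - 1))
    rcases hd' with hd' | hd'
    · rw [min_eq_left (by linarith)] at *
      exact mem_range_of_exists_le_of_exists_ge hg ⟨0, by linarith⟩ ⟨1, by linarith⟩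
    · rw [min_eq_right (by linarith)] at *
      exact mem_range_of_exists_le_of_exists_ge hg ⟨1, by linarith⟩ ⟨0, by linarith⟩
  exact ⟨q, _, by linarith⟩

omit h in
theorem map_mem_uIcc (A : CircleLift) {x y z : ℝ} (hz : z ∈ uIcc x y) :
    A.F z ∈ uIcc (A.F x) (A.F y) := by
  rcases A.strictMono_or_strictAnti with hm | hm
  · exact hm.monotone.image_uIcc_subset ⟨z, hz, rfl⟩
  · exact hm.antitone.image_uIcc_subset ⟨z, hz, rfl⟩

theorem IsRegular.inCone_transfer {Z Z' : Set ℝ} (hZ : ∀ z ∈ Z, A.F z ∈ Z')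
    (hZ' : ∀ z ∈ Z', ∀ n : ℤ, z + n ∈ Z') {a b R : ℝ} (ha : 0 ≤ a) {v : UnitAddCircle → ℝ}
    (hv : InCone K Z a b R v) : InCone K Z' ((a + D) / lam) b (lam * R) (A.transfer v) := by
  refine ⟨A.transfer_nonneg hv.1, fun x y hxy hR => ?_⟩
  rw [A.transfer_coe, A.transfer_coe, Finset.mul_sum]
  refine Finset.sum_le_sum fun i _ => ?_
  set x' := A.Φ (x + i)
  set y' := A.Φ (y + i)
  have hd : |K x' - K y'| ≤ |K x - K y| / lam := by
    have := h.abs_inv_sub_le (x + i) (y + i)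
    have e1 := h.K_add_int x i
    have e2 := h.K_add_int y i
    rw [Int.cast_natCast] at e1 e2
    rw [e1, e2] at this
    convert this using 3
    ring
  have hdis : Disjoint (uIcc x' y') Z := by
    rw [Set.disjoint_left]
    intro z hz hzZ
    have h1 := A.map_mem_uIcc hz
    rw [A.right_inv, A.right_inv] at h1
    have h2 : A.F z - i ∈ uIcc x y := by
      rw [mem_uIcc] at h1 ⊢
      rcases h1 with h1 | h1
      · left; constructor <;> linarith [h1.1, h1.2]
      · right; constructor <;> linarith [h1.1, h1.2]
    have h3 := hZ' _ (hZ z hzZ) (-(i : ℤ))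
    push_cast at h3
    exact Set.disjoint_left.1 hxy h2 (by simpa [sub_eq_add_neg] using h3)
  have hR' : |K x' - K y'| ≤ R := hd.trans (by rw [div_le_iff₀ h.lam_pos]; linarith)
  have h1 := hv.2 x' y' hdis hR'
  have h2 := h.distortion x' y'
  have p1 : 0 < |A.F' x'| := abs_pos.2 (A.deriv_ne_zero _)
  have p2 : 0 < |A.F' y'| := abs_pos.2 (A.deriv_ne_zero _)
  have h3 : v x' * |A.F' y'| ≤
      (Real.exp (a * |K x' - K y'| + b) * v y') * (Real.exp (D * |K x' - K y'|) * |A.F' x'|) :=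
    mul_le_mul h1 h2 (abs_nonneg _) (mul_nonneg (Real.exp_pos _).le (hv.1 _))
  have h4 : Real.exp (a * |K x' - K y'| + b) * Real.exp (D * |K x' - K y'|)
      ≤ Real.exp ((a + D) / lam * |K x - K y| + b) := by
    rw [← Real.exp_add]
    apply Real.exp_le_exp.2
    have : (a + D) * |K x' - K y'| ≤ (a + D) * (|K x - K y| / lam) :=
      mul_le_mul_of_nonneg_left hd (add_nonneg ha h.nonneg)
    calc _ = (a + D) * |K x' - K y'| + b := by ring
      _ ≤ (a + D) * (|K x - K y| / lam) + b := by linarith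
      _ = _ := by ring
  rw [← mul_div_assoc, div_le_div_iff₀ p1 p2]
  calc v x' * |A.F' y'| ≤ _ := h3
    _ = (Real.exp (a * |K x' - K y'| + b) * Real.exp (D * |K x' - K y'|)) * (v y' * |A.F' x'|) := by
      ring
    _ ≤ Real.exp ((a + D) / lam * |K x - K y| + b) * (v y' * |A.F' x'|) :=
      mul_le_mul_of_nonneg_right h4 (mul_nonneg (hv.1 _) (abs_nonneg _))
    _ = _ := by ring

omit h in
theorem InCone.mono {K : ℝ → ℝ} {Z Z' : Set ℝ} {a a' b R R' : ℝ} {v : UnitAddCircle → ℝ}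
    (hv : InCone K Z a b R v) (hZ : Z ⊆ Z') (ha : a ≤ a') (hR : R' ≤ R) :
    InCone K Z' a' b R' v := by
  refine ⟨hv.1, fun x y hxy hxR => (hv.2 x y (hxy.mono_right hZ) (hxR.trans hR)).trans ?_⟩
  refine mul_le_mul_of_nonneg_right (Real.exp_le_exp.2 ?_) (hv.1 _)
  have := mul_le_mul_of_nonneg_right ha (abs_nonneg (K x - K y))
  linarith

omit h in
/-- The orbit of `q` under integer translations. -/
def intOrbit (q : ℝ) : Set ℝ := range fun n : ℤ => q + n

omit h in
theorem exists_Ioo_of_ne {q : ℝ} {y : UnitAddCircle} (hy : y ≠ (q : UnitAddCircle)) :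
    ∃ x ∈ Ioo q (q + 1), (x : UnitAddCircle) = y := by
  have : y ∈ ((↑) : ℝ → UnitAddCircle) '' Ico q (q + 1) := by
    rw [AddCircle.coe_image_Ico_eq]; trivial
  obtain ⟨x, hx, rfl⟩ := this
  exact ⟨x, ⟨lt_of_le_of_ne hx.1 fun hq => hy (by rw [hq]), hx.2⟩, rfl⟩

omit h in
theorem disjoint_uIcc_intOrbit {q x y : ℝ} (n : ℤ) (hx : x ∈ Ioo (q + n) (q + n + 1))
    (hy : y ∈ Ioo (q + n) (q + n + 1)) : Disjoint (uIcc x y) (intOrbit q) := by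
  rw [Set.disjoint_left]
  rintro z hz ⟨m, rfl⟩
  have hz' : q + (m : ℝ) ∈ Ioo (q + n) (q + n + 1) := (ordConnected_Ioo.uIcc_subset hx hy) hz
  have h1 : n < m := by
    have := hz'.1
    have : (n : ℝ) < m := by linarith
    exact_mod_cast this
  have h2 : m < n + 1 := by
    have := hz'.2
    have : (m : ℝ) < n + 1 := by linarith
    exact_mod_cast this
  omega

theorem IsRegular.le_of_inCone {q a : ℝ} (ha : 0 ≤ a) {v : UnitAddCircle → ℝ}
    (hv : InCone K (intOrbit q) a 0 (K 1 - K 0) v) {y z : UnitAddCircle}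
    (hy : y ≠ (q : UnitAddCircle)) (hz : z ≠ (q : UnitAddCircle)) :
    v y ≤ Real.exp (a * (K 1 - K 0)) * v z := by
  obtain ⟨x, hx, rfl⟩ := exists_Ioo_of_ne hy
  obtain ⟨x', hx', rfl⟩ := exists_Ioo_of_ne hz
  have h1 : |K x - K x'| ≤ K 1 - K 0 := by
    have e := h.K_add_one q
    have a1 := h.strictMono_K hx.1
    have a2 := h.strictMono_K hx.2
    have a3 := h.strictMono_K hx'.1
    have a4 := h.strictMono_K hx'.2
    rw [abs_le]
    constructor <;> linarith
  refine (hv.2 x x' (disjoint_uIcc_intOrbit 0 (by simpa using hx) (by simpa using hx')) h1).trans ?_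
  refine mul_le_mul_of_nonneg_right (Real.exp_le_exp.2 ?_) (hv.1 _)
  have := mul_le_mul_of_nonneg_left h1 ha
  linarith

omit h in
theorem ae_ne (p : UnitAddCircle) : ∀ᵐ y : UnitAddCircle, y ≠ p := by
  rw [ae_iff]
  have := AddCircle.volume_closedBall (T := 1) (x := p) 0
  simpa using this

theorem IsRegular.integrable_of_inCone {q a : ℝ} (ha : 0 ≤ a) {v : UnitAddCircle → ℝ}
    (hvm : Measurable v) (hv : InCone K (intOrbit q) a 0 (K 1 - K 0) v) : Integrable v := by
  obtain ⟨z, hz⟩ := (ae_ne (q : UnitAddCircle)).exists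
  refine Integrable.of_bound hvm.aestronglyMeasurable (Real.exp (a * (K 1 - K 0)) * v z) ?_
  filter_upwards [ae_ne (q : UnitAddCircle)] with y hy
  rw [Real.norm_of_nonneg (hv.1 y)]
  exact h.le_of_inCone ha hv hy hz

theorem IsRegular.bounds_of_inCone {q a : ℝ} (ha : 0 ≤ a) {v : UnitAddCircle → ℝ}
    (hvm : Measurable v) (hv : InCone K (intOrbit q) a 0 (K 1 - K 0) v) {z : UnitAddCircle}
    (hz : z ≠ (q : UnitAddCircle)) :
    (∫ y, v y) ≤ Real.exp (a * (K 1 - K 0)) * v z ∧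
      v z ≤ Real.exp (a * (K 1 - K 0)) * ∫ y, v y := by
  have hi := h.integrable_of_inCone ha hvm hv
  constructor
  · have := integral_mono_ae hi (integrable_const (Real.exp (a * (K 1 - K 0)) * v z)) (by
      filter_upwards [ae_ne (q : UnitAddCircle)] with y hy
      exact h.le_of_inCone ha hv hy hz)
    simpa [measureReal_def] using this
  · rw [← integral_const_mul]
    have := integral_mono_ae (integrable_const (v z)) (hi.const_mul (Real.exp (a * (K 1 - K 0)))) (by
      filter_upwards [ae_ne (q : UnitAddCircle)] with y hy
      exact h.le_of_inCone ha hv hz hy)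
    simpa [measureReal_def] using this

omit h in
theorem transfer_congr {p : UnitAddCircle} (hp : A.toMap p = p) {u w : UnitAddCircle → ℝ}
    (huw : ∀ y, y ≠ p → u y = w y) {y : UnitAddCircle} (hy : y ≠ p) :
    A.transfer u y = A.transfer w y := by
  obtain ⟨x, rfl⟩ := exists_coe_eq y
  rw [A.transfer_coe, A.transfer_coe]
  refine Finset.sum_congr rfl fun i _ => ?_
  rw [huw]
  intro hx
  apply hy
  have := congrArg A.toMap hx
  rw [A.toMap_coe, A.right_inv, hp, coe_add_nat] at this
  exact this

omit h in
theorem map_mem_intOrbit {q : ℝ} {n₀ : ℤ} (hq : A.F q = q + n₀) : ∀ z ∈ intOrbit q, A.F z ∈ intOrbit q := by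
  rintro _ ⟨n, rfl⟩
  refine ⟨n₀ + n * A.d, ?_⟩
  simp only
  rw [A.map_add_int, hq]
  push_cast
  ring

omit h in
theorem add_mem_intOrbit {q : ℝ} : ∀ z ∈ intOrbit q, ∀ n : ℤ, z + n ∈ intOrbit q := by
  rintro _ ⟨m, rfl⟩ n
  exact ⟨m + n, by push_cast; ring⟩

omit h in
theorem toMap_fixed {q : ℝ} {n₀ : ℤ} (hq : A.F q = q + n₀) :
    A.toMap (q : UnitAddCircle) = (q : UnitAddCircle) := by
  rw [A.toMap_coe, hq, coe_add_int]

/-- The exponent of an invariant cone. -/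
noncomputable def coneExponent (lam D : ℝ) : ℝ := (D + 1) / (lam - 1)

theorem IsRegular.coneExponent_pos : 0 < coneExponent lam D :=
  div_pos (by linarith [h.nonneg]) (by linarith [h.one_lt])

theorem IsRegular.coneExponent_eq :
    (coneExponent lam D + D) / lam = coneExponent lam D - 1 / lam := by
  have h1 : lam - 1 ≠ 0 := by linarith [h.one_lt]
  have h2 := h.lam_pos.ne'
  unfold coneExponent
  field_simp
  ring

theorem IsRegular.K_pos : 0 < K 1 - K 0 := sub_pos.2 (h.strictMono_K one_pos)

omit h in
theorem exp_sub_one_le {a a' s : ℝ} (ha' : 0 ≤ a') (haa : a' ≤ a) (ha : 0 < a) :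
    Real.exp (a' * s) - 1 ≤ a' / a * (Real.exp (a * s) - 1) := by
  have h0 : 0 ≤ a' / a := by positivity
  have h1 : a' / a ≤ 1 := (div_le_one ha).2 haa
  have := convexOn_exp.2 (mem_univ (a * s)) (mem_univ 0) h0 (sub_nonneg.2 h1) (by ring)
  simp only [smul_eq_mul, mul_zero, add_zero, Real.exp_zero, mul_one] at this
  have e : a' / a * (a * s) = a' * s := by field_simp
  rw [e] at this
  linarith

/-- One application of the transfer operator splits off a constant. -/
theorem IsRegular.exists_split {q : ℝ} {n₀ : ℤ} (hq : A.F q = q + n₀) :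
    ∃ c : ℝ, 0 < c ∧ c < 1 ∧ ∀ v : UnitAddCircle → ℝ, Measurable v →
      InCone K (intOrbit q) (coneExponent lam D) 0 (K 1 - K 0) v → ∫ y, v y = 1 →
      ∃ w : UnitAddCircle → ℝ, Measurable w ∧
        InCone K (intOrbit q) (coneExponent lam D) 0 (K 1 - K 0) w ∧ ∫ y, w y = 1 ∧
        ∀ y, y ≠ (q : UnitAddCircle) → A.transfer v y = c + (1 - c) * w y := by
  set a := coneExponent lam D with ha
  set Δ := K 1 - K 0 with hΔ
  have ha0 : 0 < a := h.coneExponent_pos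
  have hΔ0 : 0 < Δ := h.K_pos
  set a' := (a + D) / lam with ha'
  have haa : a' < a := by
    rw [ha', ha, h.coneExponent_eq]
    have : 0 < 1 / lam := one_div_pos.2 h.lam_pos
    linarith
  have ha'0 : 0 ≤ a' := div_nonneg (by linarith [h.nonneg]) h.lam_pos.le
  set e := Real.exp (a * Δ) with he
  have he1 : 1 < e := Real.one_lt_exp_iff.2 (by positivity)
  have he0 : 0 < e := by linarith
  have hθ : 0 < 1 - a' / a := by rw [sub_pos, div_lt_one ha0]; exact haa
  have hθ1 : 1 - a' / a ≤ 1 := by have : 0 ≤ a' / a := by positivity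
                                  linarith
  set c := (1 - a' / a) * e⁻¹ with hc
  have hei : e⁻¹ < 1 := inv_lt_one_of_one_lt₀ he1
  have hei0 : 0 < e⁻¹ := by positivity
  have hc0 : 0 < c := by positivity
  have hce : c ≤ e⁻¹ := by nlinarith
  have hc1 : c < 1 := by linarith
  refine ⟨c, hc0, hc1, fun v hvm hv hv1 => ?_⟩
  have hLm := A.measurable_transfer hvm
  have hL' : InCone K (intOrbit q) a' 0 Δ (A.transfer v) :=
    (h.inCone_transfer (map_mem_intOrbit hq) add_mem_intOrbit ha0.le hv).mono Subset.rfl le_rfl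
      (by nlinarith [h.one_lt])
  have hL : InCone K (intOrbit q) a 0 Δ (A.transfer v) := hL'.mono Subset.rfl haa.le le_rfl
  have hLint : ∫ y, A.transfer v y = 1 := by rw [A.integral_transfer hvm hv.1, hv1]
  have hlow : ∀ y, y ≠ (q : UnitAddCircle) → e⁻¹ ≤ A.transfer v y := by
    intro y hy
    have := (h.bounds_of_inCone ha0.le hLm hL hy).1
    rw [hLint] at this
    rw [inv_le_iff_one_le_mul₀ he0]
    linarith
  refine ⟨fun y => max ((A.transfer v y - c) / (1 - c)) 0,
    ((hLm.sub_const c).div_const _).max measurable_const, ⟨fun y => le_max_right _ _, ?_⟩, ?_, ?_⟩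
  · intro x y hxy hR
    have hx : (x : UnitAddCircle) ≠ q := by
      intro hx
      obtain ⟨n, hn⟩ := coe_eq_coe_iff_int.1 hx.symm
      exact Set.disjoint_left.1 hxy left_mem_uIcc ⟨n, hn.symm⟩
    have hy : (y : UnitAddCircle) ≠ q := by
      intro hx
      obtain ⟨n, hn⟩ := coe_eq_coe_iff_int.1 hx.symm
      exact Set.disjoint_left.1 hxy right_mem_uIcc ⟨n, hn.symm⟩
    have p1 : 0 ≤ A.transfer v x - c := by linarith [hlow x hx]
    have p2 : 0 ≤ A.transfer v y - c := by linarith [hlow y hy]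
    have p3 : 0 < 1 - c := by linarith
    simp only
    rw [max_eq_left (div_nonneg p1 p3.le), max_eq_left (div_nonneg p2 p3.le), ← mul_div_assoc]
    refine div_le_div_of_nonneg_right ?_ p3.le
    have k1 := hL'.2 x y hxy hR
    have k2 := exp_sub_one_le (s := |K x - K y|) ha'0 haa.le ha0
    have k3 := hlow y hy
    set s := |K x - K y|
    have k4 : 0 ≤ Real.exp (a * s) - 1 := by
      have : 0 ≤ a * s := mul_nonneg ha0.le (abs_nonneg _)
      linarith [Real.add_one_le_exp (a * s)]
    rw [add_zero] at k1 ⊢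
    have k5 : c * (Real.exp (a * s) - 1) ≤ (Real.exp (a * s) - Real.exp (a' * s)) * e⁻¹ := by
      rw [hc]
      have : (1 - a' / a) * (Real.exp (a * s) - 1) ≤ Real.exp (a * s) - Real.exp (a' * s) := by
        linarith
      nlinarith
    have k6 : (Real.exp (a * s) - Real.exp (a' * s)) * e⁻¹
        ≤ (Real.exp (a * s) - Real.exp (a' * s)) * A.transfer v y := by
      refine mul_le_mul_of_nonneg_left k3 ?_
      have : a' * s ≤ a * s := mul_le_mul_of_nonneg_right haa.le (abs_nonneg _)
      linarith [Real.exp_le_exp.2 this]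
    nlinarith
  · have hi := h.integrable_of_inCone ha0.le hLm hL
    have : (fun y => max ((A.transfer v y - c) / (1 - c)) 0)
        =ᵐ[volume] fun y => (A.transfer v y - c) / (1 - c) := by
      filter_upwards [ae_ne (q : UnitAddCircle)] with y hy
      exact max_eq_left (div_nonneg (by linarith [hlow y hy]) (by linarith))
    rw [integral_congr_ae this, integral_div, integral_sub hi (integrable_const c), hLint]
    have : (1 - c) ≠ 0 := by linarith
    simp [measureReal_def, this]
  · intro y hy
    have p3 : (1 - c) ≠ 0 := by linarith
    simp only
    rw [max_eq_left (div_nonneg (by linarith [hlow y hy]) (by linarith)), mul_div_cancel₀ _ p3]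
    ring

omit h in
theorem iterate_transfer_succ (v : UnitAddCircle → ℝ) (n : ℕ) :
    A.transfer^[n + 1] v = A.transfer (A.transfer^[n] v) := Function.iterate_succ_apply' _ _ _

omit h in
theorem integral_iterate_comp {v : UnitAddCircle → ℝ} (n : ℕ) :
    ∀ {w : UnitAddCircle → ℝ}, Measurable v → (∀ y, 0 ≤ v y) → Measurable w →
      Measurable (A.transfer^[n] v) ∧ (∀ y, 0 ≤ A.transfer^[n] v y) ∧
      ∫ y, w (A.toMap^[n] y) * v y = ∫ y, w y * A.transfer^[n] v y := by
  induction n with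
  | zero => exact fun hv h0 hw => ⟨hv, h0, rfl⟩
  | succ n ih =>
    intro w hv h0 hw
    rw [iterate_transfer_succ]
    have hw' : Measurable fun y => w (A.toMap y) := hw.comp A.continuous_toMap.measurable
    obtain ⟨i1, i2, i3⟩ := ih hv h0 hw'
    refine ⟨A.measurable_transfer i1, A.transfer_nonneg i2, ?_⟩
    rw [← A.integral_comp_mul_of_nonneg i1 i2 hw, ← i3]
    simp only [Function.iterate_succ_apply']

/-- Any two densities in the cone are exponentially contracted towards each other. -/
theorem IsRegular.exists_contraction {q : ℝ} {n₀ : ℤ} (hq : A.F q = q + n₀) :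
    ∃ C θ : ℝ, 0 < C ∧ 0 < θ ∧ θ < 1 ∧ ∀ v₁ v₂ : UnitAddCircle → ℝ, Measurable v₁ → Measurable v₂ →
      InCone K (intOrbit q) (coneExponent lam D) 0 (K 1 - K 0) v₁ →
      InCone K (intOrbit q) (coneExponent lam D) 0 (K 1 - K 0) v₂ →
      ∫ y, v₁ y = 1 → ∫ y, v₂ y = 1 → ∀ (n : ℕ) (y : UnitAddCircle), y ≠ (q : UnitAddCircle) →
        |A.transfer^[n] v₁ y - A.transfer^[n] v₂ y| ≤ C * θ ^ n := by
  obtain ⟨c, hc0, hc1, hc⟩ := h.exists_split hq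
  have ha0 : 0 < coneExponent lam D := h.coneExponent_pos
  refine ⟨Real.exp (coneExponent lam D * (K 1 - K 0)), 1 - c, Real.exp_pos _, by linarith,
    by linarith, fun v₁ v₂ hm₁ hm₂ hv₁ hv₂ h1 h2 n => ?_⟩
  suffices H : ∃ w₁ w₂ : UnitAddCircle → ℝ, Measurable w₁ ∧ Measurable w₂ ∧
      InCone K (intOrbit q) (coneExponent lam D) 0 (K 1 - K 0) w₁ ∧
      InCone K (intOrbit q) (coneExponent lam D) 0 (K 1 - K 0) w₂ ∧
      ∫ y, w₁ y = 1 ∧ ∫ y, w₂ y = 1 ∧ ∀ y, y ≠ (q : UnitAddCircle) →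
        A.transfer^[n] v₁ y - A.transfer^[n] v₂ y = (1 - c) ^ n * (w₁ y - w₂ y) by
    obtain ⟨w₁, w₂, m1, m2, c1, c2, i1, i2, H⟩ := H
    intro y hy
    rw [H y hy, abs_mul, abs_of_pos (by have : 0 < 1 - c := by linarith
                                        positivity), mul_comm]
    refine mul_le_mul_of_nonneg_right ?_ (pow_nonneg (by linarith) n)
    have e1 := (h.bounds_of_inCone ha0.le m1 c1 hy).2
    have e2 := (h.bounds_of_inCone ha0.le m2 c2 hy).2
    rw [i1, mul_one] at e1
    rw [i2, mul_one] at e2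
    have e3 := c1.1 y
    have e4 := c2.1 y
    rw [abs_le]
    constructor <;> linarith
  induction n with
  | zero => exact ⟨v₁, v₂, hm₁, hm₂, hv₁, hv₂, h1, h2, fun y _ => by simp⟩
  | succ n ih =>
    obtain ⟨w₁, w₂, m1, m2, c1, c2, i1, i2, H⟩ := ih
    obtain ⟨u₁, um1, uc1, ui1, H1⟩ := hc w₁ m1 c1 i1
    obtain ⟨u₂, um2, uc2, ui2, H2⟩ := hc w₂ m2 c2 i2
    refine ⟨u₁, u₂, um1, um2, uc1, uc2, ui1, ui2, fun y hy => ?_⟩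
    have e1 : A.transfer^[n + 1] v₁ y
        = A.transfer (A.transfer^[n] v₂ + (1 - c) ^ n • (w₁ + (-1 : ℝ) • w₂)) y := by
      rw [iterate_transfer_succ]
      refine transfer_congr (toMap_fixed hq) (fun z hz => ?_) hy
      have := H z hz
      simp only [Pi.add_apply, Pi.smul_apply, smul_eq_mul]
      linarith
    rw [e1, iterate_transfer_succ, A.transfer_add, A.transfer_smul, A.transfer_add, A.transfer_smul]
    simp only [Pi.add_apply, Pi.smul_apply, smul_eq_mul]
    rw [H1 y hy, H2 y hy]
    ring

omit h in
theorem le_of_forall_ne {p : UnitAddCircle} {u : UnitAddCircle → ℝ} (hu : Continuous u) {c : ℝ}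
    (hc : ∀ y, y ≠ p → u y ≤ c) (y : UnitAddCircle) : u y ≤ c := by
  have h1 : Dense {y : UnitAddCircle | y ≠ p} := Measure.dense_of_ae (ae_ne p)
  have h2 : IsClosed {y | u y ≤ c} := isClosed_le hu continuous_const
  exact (h2.closure_subset_iff.2 fun z hz => hc z hz) (h1 y)

theorem IsRegular.inCone_transfer_self {q : ℝ} {n₀ : ℤ} (hq : A.F q = q + n₀)
    {v : UnitAddCircle → ℝ}
    (hv : InCone K (intOrbit q) (coneExponent lam D) 0 (K 1 - K 0) v) :
    InCone K (intOrbit q) (coneExponent lam D) 0 (K 1 - K 0) (A.transfer v) := by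
  refine (h.inCone_transfer (map_mem_intOrbit hq) add_mem_intOrbit h.coneExponent_pos.le hv).mono
    Subset.rfl ?_ ?_
  · rw [h.coneExponent_eq]
    have : 0 < 1 / lam := one_div_pos.2 h.lam_pos
    linarith
  · nlinarith [h.one_lt, h.K_pos]

/-- Existence of a continuous positive invariant density, and exponential convergence to it. -/
theorem IsRegular.exists_density {q : ℝ} {n₀ : ℤ} (hq : A.F q = q + n₀) :
    ∃ ρ : UnitAddCircle → ℝ, Continuous ρ ∧ (∀ y, 0 < ρ y) ∧ ∫ y, ρ y = 1 ∧ A.transfer ρ = ρ ∧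
      ∃ C θ : ℝ, 0 < C ∧ 0 < θ ∧ θ < 1 ∧ ∀ v : UnitAddCircle → ℝ, Measurable v →
        InCone K (intOrbit q) (coneExponent lam D) 0 (K 1 - K 0) v → ∫ y, v y = 1 →
        ∀ (n : ℕ) (y : UnitAddCircle), y ≠ (q : UnitAddCircle) →
          |A.transfer^[n] v y - ρ y| ≤ C * θ ^ n := by
  obtain ⟨C, θ, hC, hθ0, hθ1, hcon⟩ := h.exists_contraction hq
  set a := coneExponent lam D with ha
  have ha0 : 0 < a := h.coneExponent_pos
  let r : ℕ → UnitAddCircle → ℝ := fun n => A.transfer^[n] fun _ => 1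
  have hr : ∀ n, Continuous (r n) ∧ InCone K (intOrbit q) a 0 (K 1 - K 0) (r n) ∧
      ∫ y, r n y = 1 := by
    intro n
    induction n with
    | zero =>
      refine ⟨continuous_const, ⟨fun _ => zero_le_one, fun x y _ _ => ?_⟩, ?_⟩
      · simp only [r, iterate_zero, id, mul_one, add_zero]
        exact Real.one_le_exp (mul_nonneg ha0.le (abs_nonneg _))
      · simp [r, measureReal_def]
    | succ n ih =>
      obtain ⟨h1, h2, h3⟩ := ih
      have e : r (n + 1) = A.transfer (r n) := iterate_transfer_succ _ n
      rw [e]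
      exact ⟨A.continuous_transfer h1, h.inCone_transfer_self hq h2, by
        rw [A.integral_transfer h1.measurable h2.1, h3]⟩
  have hstep : ∀ n y, |r n y - r (n + 1) y| ≤ C * θ ^ n := by
    intro n
    refine le_of_forall_ne (p := (q : UnitAddCircle)) ((hr n).1.sub (hr (n + 1)).1).abs
      fun y hy => ?_
    have := hcon (r 0) (r 1) (hr 0).1.measurable (hr 1).1.measurable (hr 0).2.1 (hr 1).2.1
      (hr 0).2.2 (hr 1).2.2 n y hy
    simp only [r, ← Function.iterate_add_apply] at this
    exact this
  let f : ℕ → C(UnitAddCircle, ℝ) := fun n => ⟨r n, (hr n).1⟩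
  have hf : CauchySeq f := cauchySeq_of_le_geometric θ C hθ1 fun n =>
    (ContinuousMap.dist_le (by positivity)).2 fun y => hstep n y
  obtain ⟨ρ, hρ⟩ := cauchySeq_tendsto_of_complete hf
  have hpt : ∀ y, Tendsto (fun n => r n y) atTop (𝓝 (ρ y)) := fun y =>
    ((continuous_eval_const y).tendsto ρ).comp hρ
  have hρcone : InCone K (intOrbit q) a 0 (K 1 - K 0) ρ :=
    ⟨fun y => ge_of_tendsto' (hpt y) fun n => (hr n).2.1.1 y, fun x y hxy hR =>
      le_of_tendsto_of_tendsto' (hpt x) ((hpt y).const_mul _) fun n => (hr n).2.1.2 x y hxy hR⟩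
  have hρint : ∫ y, ρ y = 1 := by
    have h1 : Tendsto (fun n => ∫ y, r n y) atTop (𝓝 (∫ y, ρ y)) := by
      refine tendsto_integral_of_dominated_convergence (fun _ => Real.exp (a * (K 1 - K 0)))
        (fun n => (hr n).1.aestronglyMeasurable) (integrable_const _) (fun n => ?_)
        (Eventually.of_forall hpt)
      filter_upwards [ae_ne (q : UnitAddCircle)] with y hy
      rw [Real.norm_of_nonneg ((hr n).2.1.1 y)]
      have := (h.bounds_of_inCone ha0.le (hr n).1.measurable (hr n).2.1 hy).2
      rwa [(hr n).2.2, mul_one] at this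
    simp only [(hr _).2.2] at h1
    exact (tendsto_nhds_unique h1 tendsto_const_nhds)
  have hρL : A.transfer ρ = ρ := by
    funext y
    have h1 : Tendsto (fun n => A.transfer (r n) y) atTop (𝓝 (A.transfer ρ y)) :=
      tendsto_finsetSum _ fun i _ => (hpt _).div_const _
    have h2 : Tendsto (fun n => r (n + 1) y) atTop (𝓝 (ρ y)) :=
      (hpt y).comp (tendsto_add_atTop_nat 1)
    have e : ∀ n, r (n + 1) = A.transfer (r n) := fun n => iterate_transfer_succ _ n
    simp only [e] at h2
    exact tendsto_nhds_unique h1 h2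
  have hpos : ∀ y, 0 < ρ y := by
    intro y
    have h1 : -ρ y ≤ -(Real.exp (a * (K 1 - K 0)))⁻¹ := by
      refine le_of_forall_ne (p := (q : UnitAddCircle)) (u := fun y => -ρ y) ρ.continuous.neg
        (fun y hy => ?_) y
      have := (h.bounds_of_inCone ha0.le ρ.continuous.measurable hρcone hy).1
      rw [hρint] at this
      simp only [neg_le_neg_iff]
      rw [inv_le_iff_one_le_mul₀ (Real.exp_pos _)]
      linarith
    have : 0 < (Real.exp (a * (K 1 - K 0)))⁻¹ := by positivity
    linarith
  refine ⟨ρ, ρ.continuous, hpos, hρint, hρL, C, θ, hC, hθ0, hθ1, fun v hvm hv hv1 n y hy => ?_⟩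
  have := hcon v ρ hvm ρ.continuous.measurable hv hρcone hv1 hρint n y hy
  rwa [Function.iterate_fixed hρL] at this

theorem IsRegular.inCone_iterate_transfer {q : ℝ} (k : ℕ) :
    ∀ {v : UnitAddCircle → ℝ},
      InCone K {x | A.F^[k] x ∈ intOrbit q} (coneExponent lam D) 0 (K 1 - K 0) v →
      InCone K (intOrbit q) (coneExponent lam D) 0 (K 1 - K 0) (A.transfer^[k] v) := by
  induction k with
  | zero => exact fun hv => hv
  | succ k ih =>
    intro v hv
    rw [Function.iterate_succ_apply]
    refine ih ((h.inCone_transfer (fun z hz => ?_) (fun z hz n => ?_) h.coneExponent_pos.le hv).mono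
      Subset.rfl ?_ ?_)
    · simpa [Function.iterate_succ_apply] using hz
    · simp only [mem_ofPred_eq] at hz ⊢
      have : ∀ m : ℕ, A.F^[m] (z + n) = A.F^[m] z + (n * A.d ^ m : ℤ) := by
        intro m
        induction m with
        | zero => simp
        | succ m ih => rw [Function.iterate_succ_apply', ih, A.map_add_int,
                        Function.iterate_succ_apply']; push_cast; ring
      rw [this]
      exact add_mem_intOrbit _ hz _
    · rw [h.coneExponent_eq]
      have : 0 < 1 / lam := one_div_pos.2 h.lam_pos
      linarith
    · nlinarith [h.one_lt, h.K_pos]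

theorem IsRegular.mixing {q : ℝ} (n₀ : ℤ) (hq : A.F q = q + n₀) :
    ∃ ρ : UnitAddCircle → ℝ, Continuous ρ ∧ (∀ y, 0 < ρ y) ∧ ∫ y, ρ y = 1 ∧ A.transfer ρ = ρ ∧
      ∀ (k : ℕ) (v : UnitAddCircle → ℝ), Measurable v →
        InCone K {x | A.F^[k] x ∈ intOrbit q} (coneExponent lam D) 0 (K 1 - K 0) v →
        0 < ∫ y, v y → ∀ ε > 0, ∃ N, ∀ n ≥ N, ∀ w : UnitAddCircle → ℝ, Measurable w →
          (∀ y, |w y| ≤ 1) →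
            |(∫ y, w (A.toMap^[n] y) * v y) - (∫ y, v y) * ∫ y, w y * ρ y| ≤ ε := by
  obtain ⟨ρ, hρc, hρ0, hρ1, hρL, C, θ, hC, hθ0, hθ1, hcon⟩ := h.exists_density hq
  refine ⟨ρ, hρc, hρ0, hρ1, hρL, fun k v hvm hv hvpos ε hε => ?_⟩
  set J := ∫ y, v y with hJ
  obtain ⟨m, hm⟩ : ∃ m : ℕ, θ ^ m < ε / (J * C) := exists_pow_lt_of_lt_one (by positivity) hθ1
  refine ⟨k + m, fun n hn w hw hw1 => ?_⟩
  obtain ⟨u1, u2, -⟩ := integral_iterate_comp (A := A) (v := v) k (w := fun _ => 1) hvm hv.1 measurable_const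
  have hint : ∫ y, A.transfer^[k] v y = J := by
    have := (integral_iterate_comp (A := A) (v := v) k (w := fun _ => 1) hvm hv.1 measurable_const).2.2
    simpa using this.symm
  have hcone := h.inCone_iterate_transfer k hv
  set u : UnitAddCircle → ℝ := J⁻¹ • A.transfer^[k] v with hu
  have hui : ∫ y, u y = 1 := by
    simp only [hu, Pi.smul_apply, smul_eq_mul]
    rw [integral_const_mul, hint, inv_mul_cancel₀ hvpos.ne']
  have hJi : 0 < J⁻¹ := by positivity
  have hucone : InCone K (intOrbit q) (coneExponent lam D) 0 (K 1 - K 0) u := by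
    refine ⟨fun y => mul_nonneg hJi.le (hcone.1 y), fun x y hxy hR => ?_⟩
    have := mul_le_mul_of_nonneg_left (hcone.2 x y hxy hR) hJi.le
    simp only [hu, Pi.smul_apply, smul_eq_mul]
    linarith
  obtain ⟨j, rfl⟩ := Nat.exists_eq_add_of_le hn
  have hsm : ∀ (i : ℕ) (z : UnitAddCircle → ℝ), A.transfer^[i] (J • z) = J • A.transfer^[i] z := by
    intro i z
    induction i with
    | zero => rfl
    | succ i ih => rw [iterate_transfer_succ, ih, A.transfer_smul, ← iterate_transfer_succ]
  have hLn : A.transfer^[k + m + j] v = J • A.transfer^[m + j] u := by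
    rw [← hsm, hu, smul_smul, mul_inv_cancel₀ hvpos.ne', one_smul, ← Function.iterate_add_apply]
    congr 1
    ring
  obtain ⟨v1, v2, v3⟩ := integral_iterate_comp (A := A) (v := v) (k + m + j) hvm hv.1 hw
  have hbound : ∀ y, y ≠ (q : UnitAddCircle) →
      |A.transfer^[k + m + j] v y - J * ρ y| ≤ ε := by
    intro y hy
    have h1 := hcon u (u1.const_smul J⁻¹) hucone hui (m + j) y hy
    rw [hLn, Pi.smul_apply, smul_eq_mul, ← mul_sub, abs_mul, abs_of_pos hvpos]
    have h2 : θ ^ (m + j) ≤ θ ^ m := pow_le_pow_of_le_one hθ0.le hθ1.le (Nat.le_add_right _ _)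
    have h3 : J * C * θ ^ m ≤ ε := by
      have := hm.le
      rw [le_div_iff₀ (by positivity)] at this
      linarith
    calc J * |A.transfer^[m + j] u y - ρ y| ≤ J * (C * θ ^ (m + j)) := by gcongr
      _ ≤ J * (C * θ ^ m) := by gcongr
      _ ≤ ε := by linarith
  have hwi : ∀ z : UnitAddCircle → ℝ, Integrable z → Integrable fun y => w y * z y := fun z hz =>
    hz.bdd_mul hw.aestronglyMeasurable (Eventually.of_forall fun y => hw1 y)
  have hvi : Integrable (A.transfer^[k + m + j] v) := by
    obtain ⟨B, -, hB⟩ := hρc.exists_abs_le_circle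
    refine Integrable.of_bound v1.aestronglyMeasurable (J * B + ε) ?_
    filter_upwards [ae_ne (q : UnitAddCircle)] with y hy
    have h1 := hbound y hy
    have h2 : |J * ρ y| ≤ J * B := by
      rw [abs_mul, abs_of_pos hvpos]
      exact mul_le_mul_of_nonneg_left (hB y) hvpos.le
    rw [Real.norm_eq_abs]
    have := abs_add_le (A.transfer^[k + m + j] v y - J * ρ y) (J * ρ y)
    rw [sub_add_cancel] at this
    linarith
  rw [v3, ← integral_const_mul, ← integral_sub (hwi _ hvi) ((hwi _ hρc.integrable_circle).const_mul J)]
  have := norm_integral_le_of_norm_le_const (μ := (volume : Measure UnitAddCircle)) (C := ε)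
    (f := fun y => w y * A.transfer^[k + m + j] v y - J * (w y * ρ y)) (by
      filter_upwards [ae_ne (q : UnitAddCircle)] with y hy
      have e : w y * A.transfer^[k + m + j] v y - J * (w y * ρ y)
          = w y * (A.transfer^[k + m + j] v y - J * ρ y) := by ring
      rw [e, norm_mul]
      have := mul_le_mul (hw1 y) (hbound y hy) (abs_nonneg _) zero_le_one
      simpa using this)
  simpa [measureReal_def] using this

end CircleLift

end RuellePerronFrobenius

section SlowFunction

open Set Filter Topology Function

theorem le_measureReal_of_moments {X : Type*} [MeasurableSpace X] {μ : Measure X}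
    [IsProbabilityMeasure μ] {Y : X → ℝ} (hY : Measurable Y) (hi : Integrable Y μ)
    (hi2 : Integrable (fun x => Y x ^ 2) μ) (hi4 : Integrable (fun x => Y x ^ 4) μ)
    (h1 : ∫ x, Y x ∂μ = 0) (h2 : 1 / 2 ≤ ∫ x, Y x ^ 2 ∂μ)
    (h4 : ∫ x, Y x ^ 4 ∂μ ≤ 5) : 1 / 2500 ≤ μ.real {x | 1 / 100 ≤ Y x} := by
  have hE : MeasurableSet {x | 1 / 100 ≤ Y x} := measurableSet_le measurable_const hY
  set E := {x | 1 / 100 ≤ Y x} with hEdef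
  have hind : Integrable (E.indicator fun _ => (1 : ℝ)) μ :=
    (integrable_const 1).indicator hE
  have hp : ∫ x, E.indicator (fun _ => (1 : ℝ)) x ∂μ = μ.real E := by
    rw [integral_indicator_const _ hE, smul_eq_mul, mul_one]
  have key : ∀ x, Y x ^ 2 / 6 - Y x ^ 4 / 216 ≤
      2 * (1 / 100 + 25 * E.indicator (fun _ => (1 : ℝ)) x + Y x ^ 2 / 100) - Y x := by
    intro x
    have hz : Y x ^ 2 / 6 - Y x ^ 4 / 216 ≤ |Y x| := by
      rw [← sq_abs, ← (show |Y x| ^ 4 = Y x ^ 4 by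
        rw [show (4 : ℕ) = 2 * 2 from rfl, pow_mul, pow_mul, sq_abs])]
      have h0 := abs_nonneg (Y x)
      generalize |Y x| = z at *
      rcases le_total z 6 with hz | hz
      · nlinarith [pow_nonneg h0 4]
      · nlinarith [mul_nonneg (sq_nonneg z) (sub_nonneg.2 (pow_le_pow_left₀ (by norm_num) hz 2))]
    have hm : |Y x| ≤ 2 * max (Y x) 0 - Y x := by
      rcases le_total (Y x) 0 with h | h
      · rw [abs_of_nonpos h, max_eq_right h]; linarith
      · rw [abs_of_nonneg h, max_eq_left h]; linarith
    have hx : max (Y x) 0 ≤ 1 / 100 + 25 * E.indicator (fun _ => (1 : ℝ)) x + Y x ^ 2 / 100 := by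
      by_cases hx : x ∈ E
      · rw [indicator_of_mem hx]
        refine max_le ?_ ?_ <;> nlinarith [sq_nonneg (Y x - 50), sq_nonneg (Y x)]
      · rw [indicator_of_notMem hx]
        have : Y x < 1 / 100 := not_le.1 hx
        refine max_le ?_ ?_ <;> nlinarith [sq_nonneg (Y x)]
    linarith
  have j1 : Integrable (fun x => 25 * E.indicator (fun _ => (1 : ℝ)) x) μ := hind.const_mul 25
  have j2 : Integrable (fun x => 1 / 100 + 25 * E.indicator (fun _ => (1 : ℝ)) x) μ :=
    (integrable_const _).add j1
  have j3 : Integrable (fun x => 1 / 100 + 25 * E.indicator (fun _ => (1 : ℝ)) x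
      + Y x ^ 2 / 100) μ := j2.add (hi2.div_const 100)
  have h := integral_mono ((hi2.div_const 6).sub (hi4.div_const 216)) ((j3.const_mul 2).sub hi) key
  simp only [Pi.sub_apply] at h
  rw [integral_sub (hi2.div_const 6) (hi4.div_const 216), integral_sub (j3.const_mul 2) hi,
    integral_const_mul, integral_add j2 (hi2.div_const 100), integral_add (integrable_const _) j1,
    integral_const_mul, hp, integral_div, integral_div, integral_div, h1, integral_const] at h
  simp only [probReal_univ, one_smul] at h
  rw [integral_div] at h
  linarith

theorem _root_.Continuous.birkhoffSum {X : Type*} [TopologicalSpace X] {f : X → X} {ψ : X → ℝ}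
    (hf : Continuous f) (hψ : Continuous ψ) (n : ℕ) :
    Continuous (birkhoffSum f ψ n) := by
  unfold _root_.birkhoffSum
  exact continuous_finsetSum _ fun i _ => hψ.comp (hf.iterate i)

variable {X : Type*} [TopologicalSpace X] [CompactSpace X] [MeasurableSpace X] [BorelSpace X]
  {μ : Measure X} [IsProbabilityMeasure μ] {f : X → X} {φ ψ : X → ℝ}

theorem integral_birkhoffSum_moments (hf : Continuous f) (hφ : Continuous φ) (hψ : Continuous ψ)
    (hinv : ∀ w : X → ℝ, Continuous w → ∫ x, w (f x) ∂μ = ∫ x, w x ∂μ)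
    (hφ0 : ∀ w : X → ℝ, Continuous w → ∫ x, φ x * w (f x) ∂μ = 0)
    (hψ0 : ∀ w : X → ℝ, Continuous w → ∫ x, ψ x * w (f x) ∂μ = 0)
    (hvar : ∀ w : X → ℝ, Continuous w → ∫ x, (φ x ^ 2 + ψ x ^ 2) * w (f x) ∂μ = ∫ x, w x ∂μ)
    {B : ℝ} (hB : ∀ x, φ x ^ 2 + ψ x ^ 2 ≤ B) (n : ℕ) :
    ∫ x, birkhoffSum f φ n x ∂μ = 0 ∧ ∫ x, birkhoffSum f ψ n x ∂μ = 0 ∧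
      ∫ x, (birkhoffSum f φ n x ^ 2 + birkhoffSum f ψ n x ^ 2) ∂μ = n ∧
      ∫ x, (birkhoffSum f φ n x ^ 2 + birkhoffSum f ψ n x ^ 2) ^ 2 ∂μ ≤ 4 * n ^ 2 + 3 * B * n := by
  have int : ∀ {w : X → ℝ}, Continuous w → Integrable w μ := fun hw =>
    hw.integrable_of_hasCompactSupport (HasCompactSupport.of_compactSpace _)
  induction n with
  | zero => simp
  | succ n ih =>
    obtain ⟨e1, e2, e3, e4⟩ := ih
    have hS := hf.birkhoffSum hφ n
    have hT := hf.birkhoffSum hψ n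
    simp only [birkhoffSum_succ']
    generalize birkhoffSum f φ n = S at *
    generalize birkhoffSum f ψ n = T at *
    have one : ∀ {g : X → ℝ}, (∀ w : X → ℝ, Continuous w → ∫ x, g x * w (f x) ∂μ = 0) →
        ∫ x, g x ∂μ = 0 := fun hg => by simpa using hg (fun _ => 1) continuous_const
    refine ⟨?_, ?_, ?_, ?_⟩
    · rw [integral_add (int hφ) (int (by fun_prop)), one hφ0, hinv S hS, e1, add_zero]
    · rw [integral_add (int hψ) (int (by fun_prop)), one hψ0, hinv T hT, e2, add_zero]
    · have e : ∀ x, (φ x + S (f x)) ^ 2 + (ψ x + T (f x)) ^ 2 =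
          (φ x ^ 2 + ψ x ^ 2) * 1 + 2 * (φ x * S (f x)) + 2 * (ψ x * T (f x)) +
            (S (f x) ^ 2 + T (f x) ^ 2) := fun x => by ring
      simp_rw [e]
      rw [integral_add (int (by fun_prop)) (int (by fun_prop)),
        integral_add (int (by fun_prop)) (int (by fun_prop)),
        integral_add (int (by fun_prop)) (int (by fun_prop)), integral_const_mul,
        integral_const_mul, hφ0 S hS, hψ0 T hT, hvar (fun _ => 1) continuous_const,
        hinv (fun x => S x ^ 2 + T x ^ 2) (by fun_prop), e3]
      simp
      ring
    · have hle : ∀ x, ((φ x + S (f x)) ^ 2 + (ψ x + T (f x)) ^ 2) ^ 2 ≤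
          (S (f x) ^ 2 + T (f x) ^ 2) ^ 2
            + 4 * (φ x * ((S (f x) ^ 2 + T (f x) ^ 2) * S (f x)))
            + 4 * (ψ x * ((S (f x) ^ 2 + T (f x) ^ 2) * T (f x)))
            + 8 * ((φ x ^ 2 + ψ x ^ 2) * (S (f x) ^ 2 + T (f x) ^ 2))
            + 3 * B * ((φ x ^ 2 + ψ x ^ 2) * 1) := by
        intro x
        have h1 := hB x
        generalize φ x = a at *
        generalize ψ x = b at *
        generalize S (f x) = s
        generalize T (f x) = t
        have h0 : 0 ≤ a ^ 2 + b ^ 2 := by positivity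
        have i1 : (a * s + b * t) ^ 2 ≤ (a ^ 2 + b ^ 2) * (s ^ 2 + t ^ 2) := by
          nlinarith [sq_nonneg (a * t - b * s)]
        have i2 : 2 * (a * s + b * t) ≤ (a ^ 2 + b ^ 2) + (s ^ 2 + t ^ 2) := by
          nlinarith [sq_nonneg (a - s), sq_nonneg (b - t)]
        have i3 := mul_le_mul_of_nonneg_left i2 h0
        have i4 := mul_le_mul_of_nonneg_left h1 h0
        nlinarith
      have := integral_mono (int (by fun_prop)) (int (by fun_prop)) hle
      rw [integral_add (int (by fun_prop)) (int (by fun_prop)),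
        integral_add (int (by fun_prop)) (int (by fun_prop)),
        integral_add (int (by fun_prop)) (int (by fun_prop)),
        integral_add (int (by fun_prop)) (int (by fun_prop)), integral_const_mul,
        integral_const_mul, integral_const_mul, integral_const_mul,
        hφ0 (fun x => (S x ^ 2 + T x ^ 2) * S x) (by fun_prop),
        hψ0 (fun x => (S x ^ 2 + T x ^ 2) * T x) (by fun_prop),
        hvar (fun x => S x ^ 2 + T x ^ 2) (by fun_prop), hvar (fun _ => 1) continuous_const,
        hinv (fun x => (S x ^ 2 + T x ^ 2) ^ 2) (by fun_prop), e3] at this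
      refine this.trans ?_
      simp
      nlinarith

/-- A bounded function that is almost invariant and not concentrated, produced from a
two-dimensional martingale difference by the moments of its Birkhoff sums. -/
theorem exists_almost_invariant (hf : Continuous f) (hφ : Continuous φ) (hψ : Continuous ψ)
    (hinv : ∀ w : X → ℝ, Continuous w → ∫ x, w (f x) ∂μ = ∫ x, w x ∂μ)
    (hφ0 : ∀ w : X → ℝ, Continuous w → ∫ x, φ x * w (f x) ∂μ = 0)
    (hψ0 : ∀ w : X → ℝ, Continuous w → ∫ x, ψ x * w (f x) ∂μ = 0)
    (hvar : ∀ w : X → ℝ, Continuous w → ∫ x, (φ x ^ 2 + ψ x ^ 2) * w (f x) ∂μ = ∫ x, w x ∂μ)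
    {B : ℝ} (hB : ∀ x, |φ x| ≤ B ∧ |ψ x| ≤ B) {ε : ℝ} (hε : 0 < ε) :
    ∃ u : X → ℝ, Continuous u ∧ (∀ x, |u x| ≤ 2) ∧ (∀ x, |u (f x) - u x| ≤ ε) ∧
      1 / 2500 ≤ μ.real {x | u x = 2} ∧ 1 / 2500 ≤ μ.real {x | u x = -2} := by
  have int : ∀ {w : X → ℝ}, Continuous w → Integrable w μ := fun hw =>
    hw.integrable_of_hasCompactSupport (HasCompactSupport.of_compactSpace _)
  obtain ⟨x₀⟩ : Nonempty X := by
    by_contra h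
    rw [not_nonempty_iff] at h
    exact IsProbabilityMeasure.ne_zero μ (Subsingleton.elim _ _)
  have hB0 : 0 ≤ B := (abs_nonneg _).trans (hB x₀).1
  have hB2 : ∀ x, φ x ^ 2 + ψ x ^ 2 ≤ 2 * B ^ 2 := fun x => by
    have h1 := sq_le_sq.2 ((hB x).1.trans (le_abs_self B))
    have h2 := sq_le_sq.2 ((hB x).2.trans (le_abs_self B))
    linarith
  set e := ε / (2 * B + 1) with he
  have he0 : 0 < e := by positivity
  have heB : e * (2 * B) ≤ ε := by
    rw [he, div_mul_eq_mul_div, div_le_iff₀ (by positivity)]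
    nlinarith
  obtain ⟨n, hn⟩ := exists_nat_ge (max (max 1 (6 * B ^ 2)) ((200 / e) ^ 2))
  have hn1 : (1 : ℝ) ≤ n := (le_max_left _ _).trans ((le_max_left _ _).trans hn)
  have hn2 : 6 * B ^ 2 ≤ n := (le_max_right _ _).trans ((le_max_left _ _).trans hn)
  have hn3 : 200 / e ≤ √n := Real.le_sqrt_of_sq_le ((le_max_right _ _).trans hn)
  have hn0 : (0 : ℝ) < n := by linarith
  have hs0 : 0 < √(n : ℝ) := Real.sqrt_pos.2 hn0
  have hs2 : √(n : ℝ) ^ 2 = n := Real.sq_sqrt hn0.le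
  obtain ⟨m1, m2, m3, m4⟩ := integral_birkhoffSum_moments hf hφ hψ hinv hφ0 hψ0 hvar hB2 n
  have hcφ := hf.birkhoffSum hφ n
  have hcψ := hf.birkhoffSum hψ n
  obtain ⟨X', hc, hinc, k1, k2, k4⟩ : ∃ Y : X → ℝ, Continuous Y ∧
      (∀ x, |Y (f x) - Y x| ≤ 2 * B) ∧ ∫ x, Y x ∂μ = 0 ∧ n / 2 ≤ ∫ x, Y x ^ 2 ∂μ ∧
      ∫ x, Y x ^ 4 ∂μ ≤ 5 * n ^ 2 := by
    have hinc : ∀ ζ : X → ℝ, (∀ x, |ζ x| ≤ B) → ∀ x,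
        |birkhoffSum f ζ n (f x) - birkhoffSum f ζ n x| ≤ 2 * B := fun ζ hζ x => by
      rw [birkhoffSum_apply_sub_birkhoffSum]
      have := abs_sub (ζ (f^[n] x)) (ζ x)
      linarith [hζ x, hζ (f^[n] x)]
    have hm4 : 4 * (n : ℝ) ^ 2 + 3 * (2 * B ^ 2) * n ≤ 5 * n ^ 2 := by nlinarith
    have p1 : 0 ≤ ∫ x, birkhoffSum f φ n x ^ 2 ∂μ := integral_nonneg fun x => sq_nonneg _
    have p2 : 0 ≤ ∫ x, birkhoffSum f ψ n x ^ 2 ∂μ := integral_nonneg fun x => sq_nonneg _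
    rw [integral_add (int (by fun_prop)) (int (by fun_prop))] at m3
    rcases le_total (∫ x, birkhoffSum f ψ n x ^ 2 ∂μ) (∫ x, birkhoffSum f φ n x ^ 2 ∂μ) with h | h
    · refine ⟨birkhoffSum f φ n, hcφ, hinc φ fun x => (hB x).1, m1, by linarith,
        (integral_mono (int (by fun_prop)) (int (by fun_prop)) fun x => ?_).trans (m4.trans hm4)⟩
      change birkhoffSum f φ n x ^ 4 ≤ (birkhoffSum f φ n x ^ 2 + birkhoffSum f ψ n x ^ 2) ^ 2
      nlinarith [mul_nonneg (sq_nonneg (birkhoffSum f φ n x)) (sq_nonneg (birkhoffSum f ψ n x)),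
        sq_nonneg (birkhoffSum f ψ n x ^ 2)]
    · refine ⟨birkhoffSum f ψ n, hcψ, hinc ψ fun x => (hB x).2, m2, by linarith,
        (integral_mono (int (by fun_prop)) (int (by fun_prop)) fun x => ?_).trans (m4.trans hm4)⟩
      change birkhoffSum f ψ n x ^ 4 ≤ (birkhoffSum f φ n x ^ 2 + birkhoffSum f ψ n x ^ 2) ^ 2
      nlinarith [mul_nonneg (sq_nonneg (birkhoffSum f φ n x)) (sq_nonneg (birkhoffSum f ψ n x)),
        sq_nonneg (birkhoffSum f φ n x ^ 2)]
  have tail : ∀ c : ℝ, c ^ 2 = 1 → 1 / 2500 ≤ μ.real {x | 1 / 100 ≤ c * X' x / √n} := by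
    intro c hc2
    have hc4 : c ^ 4 = 1 := by nlinarith
    have q2 : ∀ x, (c * X' x / √n) ^ 2 = X' x ^ 2 / n := fun x => by
      rw [div_pow, mul_pow, hc2, hs2, one_mul]
    have q4 : ∀ x, (c * X' x / √n) ^ 4 = X' x ^ 4 / n ^ 2 := fun x => by
      rw [div_pow, mul_pow, hc4, one_mul, show (4 : ℕ) = 2 * 2 from rfl, pow_mul √(n : ℝ), hs2]
    refine le_measureReal_of_moments (Continuous.measurable (by fun_prop)) (int (by fun_prop))
      (int (by fun_prop)) (int (by fun_prop)) ?_ ?_ ?_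
    · rw [integral_div, integral_const_mul, k1, mul_zero, zero_div]
    · simp_rw [q2]
      rw [integral_div, le_div_iff₀ hn0]
      linarith
    · simp_rw [q4]
      rw [integral_div, div_le_iff₀ (by positivity)]
      linarith
  have he2 : ∀ z : ℝ, 1 / 100 ≤ z / √n → 2 ≤ e * z := by
    intro z hz
    rw [div_le_iff₀ he0] at hn3
    rw [le_div_iff₀ hs0] at hz
    nlinarith
  refine ⟨fun x => max (-2) (min 2 (e * X' x)), by fun_prop, fun x => ?_, fun x => ?_,
    (tail 1 (by norm_num)).trans (measureReal_mono fun x hx => ?_),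
    (tail (-1) (by norm_num)).trans (measureReal_mono fun x hx => ?_)⟩
  · exact abs_le.2 ⟨le_max_left _ _, max_le (by norm_num) (min_le_left _ _)⟩
  · refine (abs_max_sub_max_le_max _ _ _ _).trans (max_le (by simpa using hε.le) ?_)
    refine (abs_min_sub_min_le_max _ _ _ _).trans (max_le (by simpa using hε.le) ?_)
    rw [← mul_sub, abs_mul, abs_of_pos he0]
    exact (mul_le_mul_of_nonneg_left (hinc x) he0.le).trans heB
  · have h := he2 _ hx
    rw [one_mul] at h
    simp only [mem_ofPred_eq]
    rw [min_eq_left h]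
    norm_num
  · have h := he2 _ hx
    simp only [mem_ofPred_eq]
    rw [min_eq_right (by linarith), max_eq_left (by linarith)]

namespace CircleLift

variable (A : CircleLift) {ρ : UnitAddCircle → ℝ}

omit A in
theorem integral_withDensity_ofReal (hρ : Continuous ρ) (hρ0 : ∀ y, 0 < ρ y)
    (w : UnitAddCircle → ℝ) :
    ∫ y, w y ∂(volume.withDensity fun y => ENNReal.ofReal (ρ y)) = ∫ y, w y * ρ y := by
  rw [integral_withDensity_eq_integral_toReal_smul hρ.measurable.ennreal_ofReal
    (Eventually.of_forall fun _ => ENNReal.ofReal_lt_top)]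
  refine integral_congr_ae (Eventually.of_forall fun y => ?_)
  simp [ENNReal.toReal_ofReal (hρ0 y).le, mul_comm]

/-- Continuous functions with vanishing conditional expectation and unit conditional variance. -/
theorem exists_martingale_difference (hd : 2 ≤ |A.d|) (hρ : Continuous ρ) (hρ0 : ∀ y, 0 < ρ y)
    (hρA : A.transfer ρ = ρ) :
    ∃ φ ψ : UnitAddCircle → ℝ, Continuous φ ∧ Continuous ψ ∧
      A.transfer (fun y => φ y * ρ y) = 0 ∧ A.transfer (fun y => ψ y * ρ y) = 0 ∧
      A.transfer (fun y => (φ y ^ 2 + ψ y ^ 2) * ρ y) = ρ := by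
  have hf := A.continuous_toMap
  let L : (UnitAddCircle → ℝ) → UnitAddCircle → ℝ := fun w y =>
    A.transfer (fun y => ρ y * w y) y / ρ y
  have hL : ∀ {w}, Continuous w → Continuous (L w) := fun hw =>
    (A.continuous_transfer (hρ.mul hw)).div hρ fun y => (hρ0 y).ne'
  let X : UnitAddCircle → ℝ := fun y => (AddCircle.toCircle y : ℂ).re
  let Y : UnitAddCircle → ℝ := fun y => (AddCircle.toCircle y : ℂ).im
  have hcirc : Continuous fun y : UnitAddCircle => (AddCircle.toCircle y : ℂ) :=
    continuous_subtype_val.comp AddCircle.continuous_toCircle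
  have hX : Continuous X := Complex.continuous_re.comp hcirc
  have hY : Continuous Y := Complex.continuous_im.comp hcirc
  let χ : (UnitAddCircle → ℝ) → UnitAddCircle → ℝ := fun w y => w y - L w (A.toMap y)
  have hχ : ∀ {w}, Continuous w → Continuous (χ w) := fun hw => hw.sub ((hL hw).comp hf)
  have hχ0 : ∀ w, A.transfer (fun y => ρ y * χ w y) = 0 := by
    intro w
    have e : (fun y => ρ y * χ w y) = (fun y => ρ y * w y) + (-1 : ℝ) • fun y =>
        ρ y * L w (A.toMap y) := by
      funext y
      simp only [χ, Pi.add_apply, Pi.smul_apply, smul_eq_mul]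
      ring
    rw [e, A.transfer_add, A.transfer_smul, A.transfer_mul_comp, hρA]
    funext y
    have := (hρ0 y).ne'
    simp only [L, Pi.add_apply, Pi.smul_apply, smul_eq_mul, Pi.zero_apply]
    field_simp
    ring
  let V : UnitAddCircle → ℝ := L fun y => χ X y ^ 2 + χ Y y ^ 2
  have hVc : Continuous V := hL (((hχ hX).pow 2).add ((hχ hY).pow 2))
  have hV : ∀ y, 0 < V y := by
    intro y
    refine div_pos ?_ (hρ0 y)
    refine lt_of_le_of_ne (A.transfer_nonneg (fun y => mul_nonneg (hρ0 y).le (by positivity)) y)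
      fun h0 => ?_
    obtain ⟨x, rfl⟩ := exists_coe_eq y
    rw [A.transfer_coe, eq_comm, Finset.sum_eq_zero_iff_of_nonneg fun i _ =>
      div_nonneg (mul_nonneg (hρ0 _).le (by positivity)) (abs_nonneg _)] at h0
    have hz : ∀ i : ℕ, i < A.d.natAbs → X (A.Φ (x + i) : ℝ) = L X (x : UnitAddCircle) ∧
        Y (A.Φ (x + i) : ℝ) = L Y (x : UnitAddCircle) := by
      intro i hi
      have h1 := h0 i (Finset.mem_range.2 hi)
      rw [div_eq_zero_iff, or_iff_left (abs_pos.2 (A.deriv_ne_zero _)).ne', mul_eq_zero,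
        or_iff_right (hρ0 _).ne'] at h1
      change χ X (A.Φ (x + i) : ℝ) ^ 2 + χ Y (A.Φ (x + i) : ℝ) ^ 2 = 0 at h1
      have e : A.toMap (A.Φ (x + i) : ℝ) = (x : UnitAddCircle) := by
        rw [A.toMap_coe, A.right_inv, coe_add_nat]
      have sX := sq_nonneg (χ X (A.Φ (x + i) : ℝ))
      have sY := sq_nonneg (χ Y (A.Φ (x + i) : ℝ))
      have h2 : χ X (A.Φ (x + i) : ℝ) = 0 :=
        pow_eq_zero_iff two_ne_zero |>.1 (by linarith)
      have h3 : χ Y (A.Φ (x + i) : ℝ) = 0 :=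
        pow_eq_zero_iff two_ne_zero |>.1 (by linarith)
      simp only [χ, e, sub_eq_zero] at h2 h3
      exact ⟨h2, h3⟩
    have h1 : 1 < A.d.natAbs := by
      rw [Int.abs_eq_natAbs] at hd
      omega
    obtain ⟨a1, a2⟩ := hz 0 (by omega)
    obtain ⟨b1, b2⟩ := hz 1 h1
    have hc : AddCircle.toCircle ((A.Φ (x + (0 : ℕ)) : ℝ) : UnitAddCircle)
        = AddCircle.toCircle ((A.Φ (x + (1 : ℕ)) : ℝ) : UnitAddCircle) := by
      ext
      exact Complex.ext (a1.trans b1.symm) (a2.trans b2.symm)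
    have hc' := AddCircle.injective_toCircle one_ne_zero hc
    obtain ⟨n, hn⟩ := coe_eq_coe_iff_int.1 hc'
    have h2 := congrArg A.F hn
    rw [A.map_add_int, A.right_inv, A.right_inv] at h2
    push_cast at h2
    have h4 : A.d ∣ 1 := by
      refine ⟨n, ?_⟩
      have : (1 : ℝ) = A.d * n := by linarith
      exact_mod_cast this
    have h5 := Int.natAbs_dvd_natAbs.2 h4
    have := Nat.le_of_dvd (by norm_num) h5
    simp at this
    omega
  have hsc : Continuous fun y => (√(V y))⁻¹ :=
    (Real.continuous_sqrt.comp hVc).inv₀ fun y => (Real.sqrt_pos.2 (hV y)).ne'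
  have h0 : ∀ w, A.transfer (fun y => χ w y * (√(V (A.toMap y)))⁻¹ * ρ y) = 0 := by
    intro w
    have e : (fun y => χ w y * (√(V (A.toMap y)))⁻¹ * ρ y)
        = fun y => ρ y * χ w y * (fun z => (√(V z))⁻¹) (A.toMap y) := by
      funext y; ring
    rw [e, A.transfer_mul_comp (fun y => ρ y * χ w y) fun z => (√(V z))⁻¹, hχ0]
    funext y
    simp
  refine ⟨fun y => χ X y * (√(V (A.toMap y)))⁻¹, fun y => χ Y y * (√(V (A.toMap y)))⁻¹,
    (hχ hX).mul (hsc.comp hf), (hχ hY).mul (hsc.comp hf), h0 X, h0 Y, ?_⟩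
  have e : (fun y => ((χ X y * (√(V (A.toMap y)))⁻¹) ^ 2 + (χ Y y * (√(V (A.toMap y)))⁻¹) ^ 2)
      * ρ y) = fun y => ρ y * (χ X y ^ 2 + χ Y y ^ 2) * (fun z => (V z)⁻¹) (A.toMap y) := by
    funext y
    simp only [mul_pow, inv_pow, Real.sq_sqrt (hV _).le]
    ring
  rw [e, A.transfer_mul_comp (fun y => ρ y * (χ X y ^ 2 + χ Y y ^ 2)) fun z => (V z)⁻¹]
  funext y
  have h1 : A.transfer (fun y => ρ y * (χ X y ^ 2 + χ Y y ^ 2)) y = V y * ρ y := by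
    simp only [V, L]
    rw [div_mul_cancel₀ _ (hρ0 y).ne']
  rw [h1]
  have := (hV y).ne'
  field_simp

theorem exists_slow (hd : 2 ≤ |A.d|) (hρ : Continuous ρ) (hρ0 : ∀ y, 0 < ρ y)
    (hρ1 : ∫ y, ρ y = 1) (hρA : A.transfer ρ = ρ) {ε : ℝ} (hε : 0 < ε) :
    ∃ u : UnitAddCircle → ℝ, Continuous u ∧ (∀ y, |u y| ≤ 2) ∧
      (∀ y, |u (A.toMap y) - u y| ≤ ε) ∧
      1 / 2500 ≤ ∫ y, {y | u y = 2}.indicator (fun _ => 1) y * ρ y ∧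
      1 / 2500 ≤ ∫ y, {y | u y = -2}.indicator (fun _ => 1) y * ρ y := by
  obtain ⟨φ, ψ, hφ, hψ, h1, h2, h3⟩ := A.exists_martingale_difference hd hρ hρ0 hρA
  set μ := (volume : Measure UnitAddCircle).withDensity fun y => ENNReal.ofReal (ρ y) with hμ
  have hint : ∀ w : UnitAddCircle → ℝ, ∫ y, w y ∂μ = ∫ y, w y * ρ y :=
    integral_withDensity_ofReal hρ hρ0
  have : IsProbabilityMeasure μ := by
    refine ⟨?_⟩
    rw [hμ, withDensity_apply _ MeasurableSet.univ, Measure.restrict_univ,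
      ← ofReal_integral_eq_lintegral_ofReal hρ.integrable_circle
        (Eventually.of_forall fun y => (hρ0 y).le), hρ1, ENNReal.ofReal_one]
  have hz : ∀ g w : UnitAddCircle → ℝ, Continuous g → Continuous w →
      ∫ y, g y * w (A.toMap y) ∂μ = ∫ y, w y * A.transfer (fun y => g y * ρ y) y := by
    intro g w hg hw
    rw [hint, ← A.integral_comp_mul (v := fun y => g y * ρ y) (hg.mul hρ) hw]
    congr 1
    funext y
    ring
  obtain ⟨B1, -, hB1⟩ := hφ.exists_abs_le_circle
  obtain ⟨B2, -, hB2⟩ := hψ.exists_abs_le_circle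
  obtain ⟨u, hu, hu2, hinc, hp, hm⟩ := exists_almost_invariant (μ := μ) A.continuous_toMap hφ hψ
    (fun w hw => by
      rw [hint, hint, A.integral_comp_mul hρ hw, hρA])
    (fun w hw => by rw [hz φ w hφ hw, h1]; simp) (fun w hw => by rw [hz ψ w hψ hw, h2]; simp)
    (fun w hw => by rw [hz (fun y => φ y ^ 2 + ψ y ^ 2) w (by fun_prop) hw, h3, hint])
    (B := max B1 B2)
    (fun y => ⟨(hB1 y).trans (le_max_left _ _), (hB2 y).trans (le_max_right _ _)⟩) hε
  refine ⟨u, hu, hu2, hinc, ?_, ?_⟩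
  · have hs : MeasurableSet {y | u y = 2} := hu.measurable (measurableSet_singleton 2)
    rwa [← hint, integral_indicator_const _ hs, smul_eq_mul, mul_one]
  · have hs : MeasurableSet {y | u y = -2} := hu.measurable (measurableSet_singleton (-2))
    rwa [← hint, integral_indicator_const _ hs, smul_eq_mul, mul_one]

end CircleLift

end SlowFunction

section ReturnDensity

open Set Filter Topology Function
open scoped ENNReal

section General

variable {X Y : Type*} [MeasurableSpace X] [MeasurableSpace Y]

theorem exists_le_stopped_apply {f : X → X} {I : Set X} {ν μ : Measure X} [IsFiniteMeasure μ]
    (hf : Measurable f) (hI : MeasurableSet I) (hμ : Measure.map f μ = μ) (h : ν ≤ μ) {ε : ℝ}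
    (hε : 0 < ε) : ∃ N, ν.real I - ε ≤ (stopped f I ν N).real I := by
  have hν : IsFiniteMeasure ν := ⟨(h univ).trans_lt (measure_lt_top _ _)⟩
  have hfin := isFiniteMeasure_stopped (f := f) (I := I) (ν := ν)
  by_contra! hcon
  have key : ∀ n : ℕ, n * ε ≤ (stopped f I ν n).real univ := by
    intro n
    induction n with
    | zero => simp
    | succ n ih =>
      have h1 : (stopped f I ν (n + 1)).real univ = ν.real I + (stopped f I ν n).real Iᶜ := by
        simp only [measureReal_def]
        rw [stopped_univ hf, ENNReal.toReal_add (measure_ne_top _ _) (measure_ne_top _ _)]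
      have h2 := measureReal_add_measureReal_compl (μ := stopped f I ν n) hI
      have h3 := hcon n
      push_cast
      linarith
  obtain ⟨n, hn⟩ := exists_nat_gt (μ.real univ / ε)
  rw [div_lt_iff₀ hε] at hn
  have h1 : (stopped f I ν n).real univ ≤ μ.real univ :=
    ENNReal.toReal_mono (measure_ne_top _ _) (stopped_le hf hI hμ h n univ)
  linarith [key n]

theorem exists_le_returnPush_apply {f : X → X} {I : Set X} {ν μ : Measure X} [IsFiniteMeasure μ]
    (hf : Measurable f) (hI : MeasurableSet I) (hμ : Measure.map f μ = μ) (h : ν ≤ μ) (r : ℕ) :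
    ∀ ε > 0, ∃ l : List ℕ, l.length = r ∧ ν.real I - ε ≤ (returnPush f I ν l).real I := by
  induction r with
  | zero => exact fun ε hε => ⟨[], rfl, by simp only [returnPush]; linarith⟩
  | succ r ih =>
    intro ε hε
    obtain ⟨l, hl, hle⟩ := ih (ε / 2) (by linarith)
    obtain ⟨N, hN⟩ := exists_le_stopped_apply hf hI hμ (returnPush_le hf hI hμ h l)
      (half_pos hε)
    exact ⟨N :: l, by simp [hl], by simp only [returnPush]; linarith⟩

theorem stopped_map {f : X → X} {g : Y → Y} {h : X → Y} (hf : Measurable f) (hg : Measurable g)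
    (hh : Measurable h) (hfg : ∀ x, g (h x) = h (f x)) {J : Set Y} (hJ : MeasurableSet J)
    (ν : Measure X) (n : ℕ) :
    stopped g J (Measure.map h ν) n = Measure.map h (stopped f (h ⁻¹' J) ν n) := by
  induction n with
  | zero => simp [stopped]
  | succ n ih =>
    simp only [stopped]
    rw [ih, Measure.restrict_map hh hJ, Measure.restrict_map hh hJ.compl, ← Measure.map_add _ _ hh,
      Measure.map_map hg hh, Measure.map_map hh hf, preimage_compl]
    congr 1
    funext x
    exact hfg x

theorem returnPush_map {f : X → X} {g : Y → Y} {h : X → Y} (hf : Measurable f) (hg : Measurable g)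
    (hh : Measurable h) (hfg : ∀ x, g (h x) = h (f x)) {J : Set Y} (hJ : MeasurableSet J)
    (ν : Measure X) (l : List ℕ) :
    returnPush g J (Measure.map h ν) l = Measure.map h (returnPush f (h ⁻¹' J) ν l) := by
  induction l with
  | nil => rfl
  | cons N l ih => simp only [returnPush]; rw [ih, stopped_map hf hg hh hfg hJ]

end General

namespace CircleLift

/-- The set `I` is a union of components of the complement of (the projection of) `Z`. -/
def IsSaturated (Z : Set ℝ) (I : Set UnitAddCircle) : Prop :=
  ∀ x y : ℝ, Disjoint (uIcc x y) Z → ((x : UnitAddCircle) ∈ I ↔ (y : UnitAddCircle) ∈ I)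

theorem IsSaturated.compl {Z : Set ℝ} {I : Set UnitAddCircle} (h : IsSaturated Z I) :
    IsSaturated Z Iᶜ := fun x y hxy => not_congr (h x y hxy)

theorem IsSaturated.inCone_indicator {Z : Set ℝ} {I : Set UnitAddCircle} (h : IsSaturated Z I)
    {K : ℝ → ℝ} {a b R : ℝ} {v : UnitAddCircle → ℝ} (hv : InCone K Z a b R v) :
    InCone K Z a b R (I.indicator v) := by
  refine ⟨fun y => indicator_nonneg (fun y _ => hv.1 y) y, fun x y hxy hR => ?_⟩
  by_cases hx : (x : UnitAddCircle) ∈ I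
  · rw [indicator_of_mem hx, indicator_of_mem ((h x y hxy).1 hx)]
    exact hv.2 x y hxy hR
  · rw [indicator_of_notMem hx, indicator_of_notMem fun hy => hx ((h x y hxy).2 hy), mul_zero]

theorem InCone.add {K : ℝ → ℝ} {Z : Set ℝ} {a b R : ℝ} {v w : UnitAddCircle → ℝ}
    (hv : InCone K Z a b R v) (hw : InCone K Z a b R w) : InCone K Z a b R (v + w) := by
  refine ⟨fun y => add_nonneg (hv.1 y) (hw.1 y), fun x y hxy hR => ?_⟩
  have h1 := hv.2 x y hxy hR
  have h2 := hw.2 x y hxy hR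
  simp only [Pi.add_apply, mul_add]
  linarith

variable {A : CircleLift} {κ K : ℝ → ℝ} {lam D : ℝ}

theorem IsRegular.exists_density_stopped (h : A.IsRegular κ K lam D) {Z : Set ℝ}
    (hZ : ∀ z ∈ Z, A.F z ∈ Z) (hZ' : ∀ z ∈ Z, ∀ n : ℤ, z + n ∈ Z) {b R : ℝ} (hR : 0 ≤ R)
    {I : Set UnitAddCircle} (hI : MeasurableSet I) (hIZ : IsSaturated Z I)
    {v : UnitAddCircle → ℝ} (hvm : Measurable v) (hv : InCone K Z (coneExponent lam D) b R v)
    (n : ℕ) : ∃ w : UnitAddCircle → ℝ, Measurable w ∧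
      InCone K Z (coneExponent lam D) b (lam * R) w ∧
      stopped A.toMap I (volume.withDensity fun y => ENNReal.ofReal (v y)) n
        = volume.withDensity fun y => ENNReal.ofReal (w y) := by
  have hRR : R ≤ lam * R := by nlinarith [h.one_lt]
  induction n with
  | zero =>
    refine ⟨fun _ => 0, measurable_const, ⟨fun _ => le_rfl, by simp⟩, ?_⟩
    simp only [stopped, ENNReal.ofReal_zero]
    exact withDensity_zero.symm
  | succ n ih =>
    obtain ⟨w, hwm, hw, hwe⟩ := ih
    have hc := (hIZ.inCone_indicator hv).add
      (hIZ.compl.inCone_indicator (hw.mono Subset.rfl le_rfl hRR))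
    have hm : Measurable (I.indicator v + Iᶜ.indicator w) :=
      (hvm.indicator hI).add (hwm.indicator hI.compl)
    refine ⟨A.transfer (I.indicator v + Iᶜ.indicator w), A.measurable_transfer hm,
      (h.inCone_transfer hZ hZ' h.coneExponent_pos.le hc).mono Subset.rfl ?_ le_rfl, ?_⟩
    · rw [h.coneExponent_eq]
      have : 0 < 1 / lam := one_div_pos.2 h.lam_pos
      linarith
    · simp only [stopped]
      rw [hwe, ← A.map_withDensity hm hc.1, restrict_withDensity hI,
        restrict_withDensity hI.compl, ← withDensity_indicator hI,
        ← withDensity_indicator hI.compl, ← withDensity_add_left (hvm.ennreal_ofReal.indicator hI)]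
      congr 2
      funext y
      by_cases hy : y ∈ I <;> simp [hy]

theorem IsRegular.exists_density_returnPush (h : A.IsRegular κ K lam D) {Z : Set ℝ}
    (hZ : ∀ z ∈ Z, A.F z ∈ Z) (hZ' : ∀ z ∈ Z, ∀ n : ℤ, z + n ∈ Z) {b R : ℝ} (hR : 0 ≤ R)
    {I : Set UnitAddCircle} (hI : MeasurableSet I) (hIZ : IsSaturated Z I)
    {v : UnitAddCircle → ℝ} (hvm : Measurable v) (hv : InCone K Z (coneExponent lam D) b R v)
    (l : List ℕ) : ∃ w : UnitAddCircle → ℝ, Measurable w ∧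
      InCone K Z (coneExponent lam D) b (lam ^ l.length * R) w ∧
      returnPush A.toMap I (volume.withDensity fun y => ENNReal.ofReal (v y)) l
        = volume.withDensity fun y => ENNReal.ofReal (w y) := by
  induction l with
  | nil => exact ⟨v, hvm, by simpa using hv, rfl⟩
  | cons N l ih =>
    obtain ⟨w, hwm, hw, hwe⟩ := ih
    obtain ⟨w', hwm', hw', hwe'⟩ := h.exists_density_stopped hZ hZ'
      (mul_nonneg (pow_nonneg h.lam_pos.le _) hR) hI hIZ hwm hw N
    refine ⟨w', hwm', ?_, ?_⟩
    · rw [List.length_cons, pow_succ', mul_assoc]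
      exact hw'
    · simp only [returnPush]
      rw [hwe, hwe']

end CircleLift

end ReturnDensity

section Cells

open Set Filter Topology Function

theorem setIntegral_coe_image_Ioo {a b : ℝ} (hb : b ≤ a + 1) {φ : UnitAddCircle → ℝ}
    (hφ : Continuous φ) :
    ∫ y in ((↑) : ℝ → UnitAddCircle) '' Ioo a b, φ y = ∫ x in Ioo a b, φ x := by
  have hm : MeasurableSet (((↑) : ℝ → UnitAddCircle) '' Ioo a b) :=
    (QuotientAddGroup.isOpenMap_coe _ isOpen_Ioo).measurableSet
  have hp := UnitAddCircle.measurePreserving_mk a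
  rw [← hp.map_eq, setIntegral_map hm hφ.aestronglyMeasurable hp.measurable.aemeasurable,
    Measure.restrict_restrict (hp.measurable hm)]
  congr 2
  ext x
  constructor
  · rintro ⟨⟨y, hy, hxy⟩, hx⟩
    obtain ⟨n, hn⟩ := coe_eq_coe_iff_int.1 hxy
    have h1 : (-1 : ℝ) < n := by linarith [hx.1, hy.2]
    have h2 : (n : ℝ) < 1 := by linarith [hx.2, hy.1]
    have h3 : -1 < n := by exact_mod_cast h1
    have h4 : n < 1 := by exact_mod_cast h2
    obtain rfl : n = 0 := by omega
    simpa [hn] using hy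
  · exact fun hx => ⟨⟨x, hx, rfl⟩, hx.1, hx.2.le.trans hb⟩

namespace CircleLift

variable (A : CircleLift) (q : ℝ) (k : ℕ)

/-- The preimages under the iterate of the integer translates of `q`. -/
def cuts : Set ℝ := {x | A.F^[k] x ∈ intOrbit q}

/-- An enumeration of the preimages. -/
noncomputable def cut (j : ℤ) : ℝ := A.Φ^[k] (q + j)

/-- The components of the complement of the preimages, on the circle. -/
def cell (j : ℤ) : Set UnitAddCircle := (↑) '' (A.F^[k] ⁻¹' Ioo (q + j) (q + j + 1))

theorem iterate_add_int (x : ℝ) (n : ℤ) : A.F^[k] (x + n) = A.F^[k] x + n * (A.d : ℝ) ^ k := by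
  induction k with
  | zero => simp
  | succ k ih =>
    have := A.map_add_int (A.F^[k] x) (n * A.d ^ k)
    push_cast at this
    rw [iterate_succ_apply', iterate_succ_apply', ih, this]
    ring

theorem iterate_inv (x : ℝ) : A.F^[k] (A.Φ^[k] x) = x := LeftInverse.iterate A.right_inv k x

theorem iterate_cut (j : ℤ) : A.F^[k] (A.cut q k j) = q + j := A.iterate_inv k _

theorem add_mem_cuts : ∀ z ∈ A.cuts q k, ∀ n : ℤ, z + n ∈ A.cuts q k := by
  rintro z ⟨m, hm⟩ n
  refine ⟨m + n * A.d ^ k, ?_⟩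
  simp only at hm ⊢
  rw [A.iterate_add_int, ← hm]
  push_cast
  ring

theorem map_mem_cuts {n₀ : ℤ} (hq : A.F q = q + n₀) : ∀ z ∈ A.cuts q k, A.F z ∈ A.cuts q k := by
  intro z hz
  change A.F^[k] (A.F z) ∈ intOrbit q
  rw [← iterate_succ_apply, iterate_succ_apply']
  exact map_mem_intOrbit hq _ hz

theorem iterate_strictMono_or_strictAnti : StrictMono A.F^[k] ∨ StrictAnti A.F^[k] :=
  (A.continuous_F.iterate k).strictMono_of_inj
    (LeftInverse.injective (LeftInverse.iterate A.left_inv k))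

theorem preimage_Ioo (j : ℤ) : A.F^[k] ⁻¹' Ioo (q + j) (q + j + 1) =
    Ioo (min (A.cut q k j) (A.cut q k (j + 1))) (max (A.cut q k j) (A.cut q k (j + 1))) := by
  have e1 := A.iterate_cut q k j
  have e2 := A.iterate_cut q k (j + 1)
  push_cast at e2
  rw [← add_assoc] at e2
  have hlt : A.F^[k] (A.cut q k j) < A.F^[k] (A.cut q k (j + 1)) := by rw [e1, e2]; linarith
  ext x
  rw [mem_preimage, ← e2, ← e1]
  rcases A.iterate_strictMono_or_strictAnti k with hm | hm
  · have h1 := hm.lt_iff_lt.1 hlt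
    rw [min_eq_left h1.le, max_eq_right h1.le, mem_Ioo, mem_Ioo, hm.lt_iff_lt, hm.lt_iff_lt]
  · have h1 := hm.lt_iff_gt.1 hlt
    rw [min_eq_right h1.le, max_eq_left h1.le, mem_Ioo, mem_Ioo, hm.lt_iff_gt, hm.lt_iff_gt,
      and_comm]

theorem isOpen_cell (j : ℤ) : IsOpen (A.cell q k j) :=
  QuotientAddGroup.isOpenMap_coe _ (isOpen_Ioo.preimage (A.continuous_F.iterate k))

theorem nonempty_cell (j : ℤ) : (A.cell q k j).Nonempty := by
  refine ⟨_, mem_image_of_mem _ (show A.Φ^[k] (q + j + 1 / 2) ∈ _ from ?_)⟩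
  rw [mem_preimage, A.iterate_inv]
  constructor <;> linarith

theorem coe_mem_cell {j : ℤ} {x : ℝ} : (x : UnitAddCircle) ∈ A.cell q k j ↔
    ∃ n : ℤ, A.F^[k] x + n * (A.d : ℝ) ^ k ∈ Ioo (q + j) (q + j + 1) := by
  constructor
  · rintro ⟨y, hy, hxy⟩
    obtain ⟨n, hn⟩ := coe_eq_coe_iff_int.1 hxy.symm
    refine ⟨n, ?_⟩
    rw [← A.iterate_add_int, ← hn]
    exact hy
  · rintro ⟨n, hn⟩
    rw [← A.iterate_add_int] at hn
    exact ⟨x + n, hn, coe_add_int x n⟩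

theorem isSaturated_cell (j : ℤ) : IsSaturated (A.cuts q k) (A.cell q k j) := by
  have key : ∀ x y : ℝ, Disjoint (uIcc x y) (A.cuts q k) →
      (x : UnitAddCircle) ∈ A.cell q k j → (y : UnitAddCircle) ∈ A.cell q k j := by
    intro x y hxy hx
    obtain ⟨n, hn⟩ := (A.coe_mem_cell q k).1 hx
    refine (A.coe_mem_cell q k).2 ⟨n, ?_⟩
    have hno : ∀ i : ℤ, q + (i : ℝ) - n * (A.d : ℝ) ^ k ∉ uIcc (A.F^[k] x) (A.F^[k] y) := by
      intro i hi
      obtain ⟨z, hz, hzi⟩ :=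
        intermediate_value_uIcc (A.continuous_F.iterate k).continuousOn hi
      refine Set.disjoint_left.1 hxy hz ⟨i - n * A.d ^ k, ?_⟩
      simp only
      rw [hzi]
      push_cast
      ring
    have h1 := hno j
    have h2 := hno (j + 1)
    push_cast at h2
    constructor
    · by_contra! hc
      exact h1 (mem_uIcc.2 (Or.inr ⟨by linarith, by linarith [hn.1]⟩))
    · by_contra! hc
      exact h2 (mem_uIcc.2 (Or.inl ⟨by linarith [hn.2], by linarith⟩))
  exact fun x y hxy => ⟨key x y hxy, key y x (by rwa [uIcc_comm])⟩

theorem pairwise_disjoint_cell :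
    Pairwise (Disjoint on fun j : Fin (A.d ^ k).natAbs => A.cell q k ((j : ℕ) : ℤ)) := by
  intro i j hij
  refine Set.disjoint_left.2 fun y hi hj => hij ?_
  obtain ⟨x, rfl⟩ := exists_coe_eq y
  obtain ⟨n, hn⟩ := (A.coe_mem_cell q k).1 hi
  obtain ⟨m, hm⟩ := (A.coe_mem_cell q k).1 hj
  push_cast at hn hm
  have h1 : ((i : ℕ) : ℝ) - n * (A.d : ℝ) ^ k < (j : ℕ) - m * (A.d : ℝ) ^ k + 1 := by
    linarith [hn.1, hm.2]
  have h2 : ((j : ℕ) : ℝ) - m * (A.d : ℝ) ^ k < (i : ℕ) - n * (A.d : ℝ) ^ k + 1 := by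
    linarith [hm.1, hn.2]
  have h1' : ((i : ℕ) : ℤ) - n * A.d ^ k < (j : ℕ) - m * A.d ^ k + 1 := by exact_mod_cast h1
  have h2' : ((j : ℕ) : ℤ) - m * A.d ^ k < (i : ℕ) - n * A.d ^ k + 1 := by exact_mod_cast h2
  have h3 : ((i : ℕ) : ℤ) - (j : ℕ) = (n - m) * A.d ^ k := by linarith
  have h4 := Int.eq_zero_of_dvd_of_natAbs_lt_natAbs (Dvd.intro_left _ h3.symm) (by omega)
  ext
  omega

theorem exists_int_lt_natAbs {e : ℤ} (he : e ≠ 0) (j : ℤ) :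
    ∃ (i : Fin e.natAbs) (n : ℤ), j + n * e = ((i : ℕ) : ℤ) := by
  have h1 := Int.emod_nonneg j he
  have h2 := Int.emod_lt_abs j he
  have h3 := Int.emod_add_mul_ediv j e
  rw [Int.abs_eq_natAbs] at h2
  refine ⟨⟨(j % e).toNat, by omega⟩, -(j / e), ?_⟩
  simp only [Int.toNat_of_nonneg h1]
  linarith

theorem pow_d_ne_zero : A.d ^ k ≠ 0 := pow_ne_zero _ A.d_ne_zero

theorem countable_cuts : (A.cuts q k).Countable :=
  (countable_range _).preimage (LeftInverse.injective (LeftInverse.iterate A.left_inv k))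

theorem volume_compl_iUnion_cell :
    volume (⋃ j : Fin (A.d ^ k).natAbs, A.cell q k ((j : ℕ) : ℤ))ᶜ = 0 := by
  have : (⋃ j : Fin (A.d ^ k).natAbs, A.cell q k ((j : ℕ) : ℤ))ᶜ ⊆
      ((↑) : ℝ → UnitAddCircle) '' A.cuts q k := by
    intro y hy
    obtain ⟨x, rfl⟩ := exists_coe_eq y
    refine ⟨x, ?_, rfl⟩
    by_contra hx
    apply hy
    obtain ⟨i, n, hin⟩ := exists_int_lt_natAbs (A.pow_d_ne_zero k) ⌊A.F^[k] x - q⌋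
    refine mem_iUnion.2 ⟨i, (A.coe_mem_cell q k).2 ⟨n, ?_⟩⟩
    have h1 := Int.floor_le (A.F^[k] x - q)
    have h2 := Int.lt_floor_add_one (A.F^[k] x - q)
    have h3 : ((⌊A.F^[k] x - q⌋ : ℤ) : ℝ) ≠ A.F^[k] x - q := by
      intro h
      exact hx ⟨_, by simp only; rw [h]; ring⟩
    have h4 := lt_of_le_of_ne h1 h3
    have h5 : (⌊A.F^[k] x - q⌋ : ℝ) + n * (A.d : ℝ) ^ k = ((i : ℕ) : ℤ) := by exact_mod_cast hin
    constructor <;> linarith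
  have : NullSingletonClass (volume : Measure UnitAddCircle) :=
    ⟨fun p => by simpa [ae_iff] using ae_ne p⟩
  refine measure_mono_null ‹_› (Set.Countable.measure_zero ((A.countable_cuts q k).image _) _)

variable {A} {κ K : ℝ → ℝ} {lam D : ℝ}

theorem IsRegular.pow_mul_abs_sub_le (h : A.IsRegular κ K lam D) (x y : ℝ) :
    lam ^ k * |K x - K y| ≤ |K (A.F^[k] x) - K (A.F^[k] y)| := by
  induction k with
  | zero => simp
  | succ k ih =>
    rw [iterate_succ_apply', iterate_succ_apply', pow_succ', mul_assoc]
    exact (mul_le_mul_of_nonneg_left ih h.lam_pos.le).trans (h.mul_abs_sub_le _ _)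

theorem IsRegular.abs_sub_le_div_pow (h : A.IsRegular κ K lam D) {c x y : ℝ}
    (hx : A.F^[k] x ∈ Icc c (c + 1)) (hy : A.F^[k] y ∈ Icc c (c + 1)) :
    |K x - K y| ≤ (K 1 - K 0) / lam ^ k := by
  rw [le_div_iff₀ (pow_pos h.lam_pos _), mul_comm]
  refine (h.pow_mul_abs_sub_le k x y).trans ?_
  have e := h.K_add_one c
  have a1 := h.strictMono_K.monotone hx.1
  have a2 := h.strictMono_K.monotone hx.2
  have a3 := h.strictMono_K.monotone hy.1
  have a4 := h.strictMono_K.monotone hy.2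
  rw [abs_le]
  constructor <;> linarith

theorem IsRegular.abs_sub_le_one (h : A.IsRegular κ K lam D) {x y : ℝ}
    (hxy : |K x - K y| ≤ K 1 - K 0) : |x - y| ≤ 1 := by
  rw [abs_le] at hxy ⊢
  constructor
  · by_contra! hc
    have h1 := h.strictMono_K (show x + 1 < y by linarith)
    rw [h.K_add_one] at h1
    linarith
  · by_contra! hc
    have h1 := h.strictMono_K (show y + 1 < x by linarith)
    rw [h.K_add_one] at h1
    linarith

theorem cut_mem_Icc (j : ℤ) : A.F^[k] (A.cut q k j) ∈ Icc (q + j) (q + j + 1) ∧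
    A.F^[k] (A.cut q k (j + 1)) ∈ Icc (q + j) (q + j + 1) := by
  rw [iterate_cut, iterate_cut]
  push_cast
  constructor <;> constructor <;> linarith

theorem IsRegular.abs_setIntegral_cell (h : A.IsRegular κ K lam D) (j : ℤ)
    {φ : UnitAddCircle → ℝ} (hφ : Continuous φ) :
    |∫ y in A.cell q k j, φ y| = |∫ x in A.cut q k j..A.cut q k (j + 1), φ x| := by
  have hle : |A.cut q k j - A.cut q k (j + 1)| ≤ 1 := by
    refine h.abs_sub_le_one ((h.abs_sub_le_div_pow k (cut_mem_Icc q k j).1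
      (cut_mem_Icc q k j).2).trans (div_le_self h.K_pos.le (one_le_pow₀ h.one_lt.le)))
  rw [cell, preimage_Ioo, setIntegral_coe_image_Ioo (by rw [← max_sub_min_eq_abs'] at hle; linarith)
    hφ, intervalIntegral.abs_integral_eq_abs_integral_uIoc, uIoc, integral_Ioc_eq_integral_Ioo]

end CircleLift

end Cells

section Coordinates

open Set Filter Topology Function

namespace CircleLift

theorem inCone_const {K : ℝ → ℝ} {Z : Set ℝ} {a R c : ℝ} (ha : 0 ≤ a) (hc : 0 ≤ c) :
    InCone K Z a 0 R fun _ => c := by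
  refine ⟨fun _ => hc, fun x y _ _ => le_mul_of_one_le_left hc (Real.one_le_exp ?_)⟩
  have := mul_nonneg ha (abs_nonneg (K x - K y))
  linarith

theorem integral_mul_indicator_one {I : Set UnitAddCircle} (hI : MeasurableSet I)
    (w : UnitAddCircle → ℝ) : ∫ y, w y * I.indicator (fun _ => 1) y = ∫ y in I, w y := by
  rw [← integral_indicator hI]
  congr 1
  funext y
  by_cases hy : y ∈ I <;> simp [hy]

theorem integral_indicator_one_real {I : Set UnitAddCircle} (hI : MeasurableSet I) :
    ∫ y, I.indicator (fun _ => (1 : ℝ)) y = volume.real I := by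
  rw [integral_indicator_const _ hI, smul_eq_mul, mul_one]

theorem setIntegral_indicator_one {I J : Set UnitAddCircle} (hJ : MeasurableSet J) :
    ∫ y in I, J.indicator (fun _ => (1 : ℝ)) y = volume.real (I ∩ J) := by
  rw [integral_indicator_const _ hJ, smul_eq_mul, mul_one, measureReal_restrict_apply hJ, inter_comm]

variable {A : CircleLift} {κ K : ℝ → ℝ} {lam D : ℝ}

theorem volume_real_univ : volume.real (univ : Set UnitAddCircle) = 1 := by
  simp [measureReal_def]

theorem exp_two_le : Real.exp 2 ≤ 8 := by
  have h1 : Real.exp 2 = Real.exp 1 * Real.exp 1 := by rw [← Real.exp_add]; norm_num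
  have h2 := Real.exp_one_lt_d9
  have h3 := Real.exp_pos 1
  rw [h1]
  nlinarith

theorem exp_le_eight {s : ℝ} (hs : |s| ≤ 2) : Real.exp s ≤ 8 :=
  (Real.exp_le_exp.2 (abs_le.1 hs).2).trans exp_two_le

theorem one_div_eight_le_exp {s : ℝ} (hs : |s| ≤ 2) : 1 / 8 ≤ Real.exp s := by
  have h1 := exp_le_eight (s := -s) (by rwa [abs_neg])
  rw [Real.exp_neg] at h1
  have := Real.exp_pos s
  rw [div_le_iff₀ (by norm_num)]
  rw [inv_le_iff_one_le_mul₀ this] at h1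
  linarith

theorem measureReal_cell_pos (A : CircleLift) (q : ℝ) (k : ℕ) (j : ℤ) :
    0 < volume.real (A.cell q k j) :=
  ENNReal.toReal_pos ((A.isOpen_cell q k j).measure_pos _ (A.nonempty_cell q k j)).ne'
    (measure_ne_top _ _)

/-- A slowly varying function whose exponential is equidistributed at the scale of the cells, and
which takes both of the values `2` and `-2` on a definite proportion of each cell. -/
theorem IsRegular.exists_equidistributed (h : A.IsRegular κ K lam D) {q : ℝ} {n₀ : ℤ}
    (hq : A.F q = q + n₀) (k : ℕ) {ε η : ℝ} (hε : 0 < ε) (hη : 0 < η) :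
    ∃ u : UnitAddCircle → ℝ, Continuous u ∧ (∀ y, |u y| ≤ 2) ∧
      (∀ y, |u (A.toMap y) - u y| ≤ ε) ∧ ∀ j : Fin (A.d ^ k).natAbs,
        |(∫ y in A.cell q k ((j : ℕ) : ℤ), Real.exp (u y))
          - volume.real (A.cell q k ((j : ℕ) : ℤ)) * ∫ y, Real.exp (u y)| ≤ η ∧
        volume.real (A.cell q k ((j : ℕ) : ℤ)) / 5000
          ≤ volume.real (A.cell q k ((j : ℕ) : ℤ) ∩ {y | u y = 2}) ∧
        volume.real (A.cell q k ((j : ℕ) : ℤ)) / 5000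
          ≤ volume.real (A.cell q k ((j : ℕ) : ℤ) ∩ {y | u y = -2}) := by
  obtain ⟨ρ, hρc, hρ0, hρ1, hρL, hmix⟩ := h.mixing n₀ hq
  obtain ⟨u, hu, hu2, hinc, hp, hm⟩ := A.exists_slow h.two_le hρc hρ0 hρ1 hρL hε
  set I : Fin (A.d ^ k).natAbs → Set UnitAddCircle := fun j => A.cell q k ((j : ℕ) : ℤ) with hI
  have hIm : ∀ j, MeasurableSet (I j) := fun j => (A.isOpen_cell q k _).measurableSet
  have hI0 : ∀ j, 0 < volume.real (I j) := fun j => A.measureReal_cell_pos q k _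
  have hI1 : ∀ j, volume.real (I j) ≤ 1 := fun j =>
    (measureReal_mono (subset_univ _)).trans_eq volume_real_univ
  have h1cone : InCone K (A.cuts q k) (coneExponent lam D) 0 (K 1 - K 0) fun _ => 1 :=
    inCone_const h.coneExponent_pos.le zero_le_one
  set E := ∫ y, Real.exp (u y) / 8 * ρ y with hE
  obtain ⟨N₀, hN₀⟩ := hmix k (fun _ => 1) measurable_const h1cone (by simp [measureReal_def])
    (η / 16) (by positivity)
  have hcell : ∀ j, ∃ N, ∀ n ≥ N, ∀ w : UnitAddCircle → ℝ, Measurable w → (∀ y, |w y| ≤ 1) →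
      |(∫ y in I j, w (A.toMap^[n] y)) - volume.real (I j) * ∫ y, w y * ρ y|
        ≤ min (η / 16) (volume.real (I j) / 5000) := by
    intro j
    have e := integral_indicator_one_real (hIm j)
    obtain ⟨N, hN⟩ := hmix k ((I j).indicator fun _ => 1) (measurable_const.indicator (hIm j))
      ((A.isSaturated_cell q k _).inCone_indicator h1cone) (by rw [e]; exact hI0 j)
      (min (η / 16) (volume.real (I j) / 5000)) (by have := hI0 j; positivity)
    refine ⟨N, fun n hn w hw hw1 => ?_⟩
    have := hN n hn w hw hw1
    rwa [e, integral_mul_indicator_one (hIm j)] at this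
  choose N hN using hcell
  set t := max N₀ (Finset.univ.sup N) with ht
  have htN : ∀ j, N j ≤ t := fun j => (Finset.le_sup (Finset.mem_univ j)).trans (le_max_right _ _)
  have hft : Continuous A.toMap^[t] := A.continuous_toMap.iterate t
  have hw8 : Measurable fun y => Real.exp (u y) / 8 :=
    ((Real.continuous_exp.comp hu).div_const 8).measurable
  have hw81 : ∀ y, |Real.exp (u y) / 8| ≤ 1 := fun y => by
    rw [abs_of_pos (by positivity), div_le_one (by norm_num)]
    exact exp_le_eight (hu2 y)
  refine ⟨fun y => u (A.toMap^[t] y), hu.comp hft, fun y => hu2 _, fun y => ?_, fun j => ⟨?_, ?_, ?_⟩⟩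
  · simp only
    rw [← iterate_succ_apply, iterate_succ_apply']
    exact hinc _
  · have h1 := (hN j t (htN j) _ hw8 hw81).trans (min_le_left _ _)
    have h2 := hN₀ t (le_max_left _ _) _ hw8 hw81
    simp only [mul_one, integral_const, volume_real_univ, one_smul, one_mul] at h2
    rw [integral_div] at h1 h2
    rw [← hE] at h1 h2
    have h3 : |volume.real (I j) * ((∫ y, Real.exp (u (A.toMap^[t] y))) / 8 - E)| ≤ η / 16 := by
      rw [abs_mul, abs_of_pos (hI0 j)]
      nlinarith [hI0 j, hI1 j, abs_nonneg ((∫ y, Real.exp (u (A.toMap^[t] y))) / 8 - E)]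
    rw [abs_le] at *
    constructor <;> linarith
  all_goals
    have aux : ∀ c : ℝ, 1 / 2500 ≤ ∫ y, {y | u y = c}.indicator (fun _ => 1) y * ρ y →
        volume.real (I j) / 5000 ≤ volume.real (I j ∩ {y | u (A.toMap^[t] y) = c}) := by
      intro c hc
      have hs : MeasurableSet {y | u y = c} := hu.measurable (measurableSet_singleton c)
      have h1 := (hN j t (htN j) _ (measurable_const (a := (1 : ℝ)).indicator hs)
        (fun y => by by_cases hy : u y = c <;> simp [hy])).trans (min_le_right _ _)
      have h2 := mul_le_mul_of_nonneg_left hc (hI0 j).le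
      rw [abs_le] at h1
      have e : ∫ y in I j, {y | u y = c}.indicator (fun _ => (1 : ℝ)) (A.toMap^[t] y)
          = volume.real (I j ∩ {y | u (A.toMap^[t] y) = c}) :=
        setIntegral_indicator_one (hft.measurable hs)
      rw [e] at h1
      linarith [h1.1]
  · exact aux 2 hp
  · exact aux (-2) hm

/-- The circle diffeomorphism with a given derivative. -/
theorem exists_coordinate {w : UnitAddCircle → ℝ} (hw : Continuous w) (hw0 : ∀ y, 0 < w y)
    (hw1 : ∫ y, w y = 1) (z : ℝ) : ∃ H : CircleLift, H.d = 1 ∧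
      (∀ x, H.F x = z + ∫ t in z..x, w t) ∧ ∀ x, H.F' x = w x := by
  have hc : Continuous fun x : ℝ => w x := hw.comp (AddCircle.continuous_mk' 1)
  obtain ⟨H, h1, h2, h3⟩ := exists_circleLift (F := fun x => z + ∫ t in z..x, w t)
    (F' := fun x => w x) (d := 1)
    (fun x => (hc.integral_hasStrictDerivAt z x).hasDerivAt.const_add z) hc
    (fun x => (hw0 _).ne') (fun x => by
      have e := UnitAddCircle.intervalIntegral_preimage x w
      rw [hw1] at e
      rw [← intervalIntegral.integral_add_adjacent_intervals (hc.intervalIntegrable z x)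
        (hc.intervalIntegrable x (x + 1)), e]
      push_cast
      ring)
  exact ⟨H, h3, fun x => congrFun h1 x, fun x => congrFun h2 x⟩

theorem map_withDensity_deriv {H : CircleLift} (hd : H.d = 1) {w : UnitAddCircle → ℝ}
    (hw : Continuous w) (hw0 : ∀ y, 0 < w y) (hH : ∀ x, H.F' x = w x) :
    Measure.map H.toMap (volume.withDensity fun y => ENNReal.ofReal (w y)) = volume := by
  rw [H.map_withDensity hw.measurable fun y => (hw0 y).le]
  have : H.transfer w = fun _ => 1 := by
    funext y
    obtain ⟨x, rfl⟩ := exists_coe_eq y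
    rw [H.transfer_coe, hd]
    simp only [Int.natAbs_one, Finset.range_one, Finset.sum_singleton]
    rw [hH, abs_of_pos (hw0 _), div_self (hw0 _).ne']
  rw [this]
  simp

theorem exists_inverse {H : CircleLift} (hd : H.d = 1) :
    ∃ g : UnitAddCircle → UnitAddCircle, Continuous g ∧ (∀ y, g (H.toMap y) = y) ∧
      ∀ y, H.toMap (g y) = y := by
  obtain ⟨G, hG, -⟩ := exists_circleLift (F := H.Φ) (F' := fun x => (H.F' (H.Φ x))⁻¹) (d := 1)
    H.hasDerivAt_inv ((H.continuous_deriv.comp H.continuous_inv).inv₀ fun x => H.deriv_ne_zero _)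
    (fun x => inv_ne_zero (H.deriv_ne_zero _)) (fun x => by
      have := H.inv_add x 1
      rw [hd] at this
      simpa using this)
  refine ⟨G.toMap, G.continuous_toMap, fun y => ?_, fun y => ?_⟩
  · obtain ⟨x, rfl⟩ := exists_coe_eq y
    rw [H.toMap_coe, G.toMap_coe, hG, H.left_inv]
  · obtain ⟨x, rfl⟩ := exists_coe_eq y
    rw [G.toMap_coe, H.toMap_coe, hG, H.right_inv]

theorem exists_conjugate (A : CircleLift) {H : CircleLift} (hd : H.d = 1) :
    ∃ B : CircleLift, (∀ x, B.F (H.F x) = H.F (A.F x)) ∧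
      ∀ x, B.F' (H.F x) * H.F' x = H.F' (A.F x) * A.F' x := by
  obtain ⟨B, h1, h2, h3⟩ := exists_circleLift (F := fun x => H.F (A.F (H.Φ x)))
    (F' := fun x => H.F' (A.F (H.Φ x)) * (A.F' (H.Φ x) * (H.F' (H.Φ x))⁻¹)) (d := A.d)
    (fun x => (H.hasDerivAt _).comp x ((A.hasDerivAt _).comp x (H.hasDerivAt_inv x)))
    ((H.continuous_deriv.comp (A.continuous_F.comp H.continuous_inv)).mul
      ((A.continuous_deriv.comp H.continuous_inv).mul
        ((H.continuous_deriv.comp H.continuous_inv).inv₀ fun x => H.deriv_ne_zero _)))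
    (fun x => mul_ne_zero (H.deriv_ne_zero _) (mul_ne_zero (A.deriv_ne_zero _)
      (inv_ne_zero (H.deriv_ne_zero _))))
    (fun x => by
      have e := H.inv_add x 1
      rw [hd] at e
      simp only [Int.cast_one, mul_one] at e
      rw [e, A.map_add_one, H.map_add_int, hd]
      simp)
  refine ⟨B, fun x => by simp only [h1, H.left_inv], fun x => ?_⟩
  simp only [h2, H.left_inv]
  have := H.deriv_ne_zero x
  field_simp

theorem IsAdapted.conjugate (h : A.IsAdapted κ lam) {B H : CircleLift} (hd : H.d = 1)
    (hH : ∀ x, 0 < H.F' x) (h1 : ∀ x, B.F (H.F x) = H.F (A.F x))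
    (h2 : ∀ x, B.F' (H.F x) * H.F' x = H.F' (A.F x) * A.F' x) :
    B.IsAdapted (fun x => κ (H.Φ x) / H.F' (H.Φ x)) lam where
  continuous := (h.continuous.comp H.continuous_inv).div
    (H.continuous_deriv.comp H.continuous_inv) fun x => H.deriv_ne_zero _
  periodic x := by
    have e := H.inv_add x 1
    rw [hd] at e
    simp only [Int.cast_one, mul_one] at e
    simp only
    rw [e, h.periodic, H.periodic_deriv]
  pos x := div_pos (h.pos _) (hH _)
  one_lt := h.one_lt
  le x := by
    rw [← H.right_inv x]
    generalize H.Φ x = t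
    rw [h1, H.left_inv, H.left_inv]
    have e := congrArg abs (h2 t)
    rw [abs_mul, abs_mul, abs_of_pos (hH t), abs_of_pos (hH _)] at e
    have e' : |B.F' (H.F t)| = H.F' (A.F t) * |A.F' t| / H.F' t := by
      rw [eq_div_iff (hH t).ne', e]
    rw [e', ← mul_div_assoc, div_mul_div_comm, div_le_div_iff₀ (hH t)
      (mul_pos (hH t) (hH _))]
    have := mul_le_mul_of_nonneg_right (h.le t) (mul_pos (hH t) (hH (A.F t))).le
    linarith

end CircleLift

end Coordinates

section Perturbation

open Set Filter Topology Function

namespace CircleLift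

variable {A : CircleLift} {κ K : ℝ → ℝ} {lam D : ℝ}

theorem integral_exp_mem {u : UnitAddCircle → ℝ} (hu : Continuous u) (hu2 : ∀ y, |u y| ≤ 2) :
    1 / 8 ≤ ∫ y, Real.exp (u y) ∧ ∫ y, Real.exp (u y) ≤ 8 := by
  have hc : Continuous fun y => Real.exp (u y) := Real.continuous_exp.comp hu
  have h1 := integral_mono (integrable_const (1 / 8 : ℝ)) hc.integrable_circle
    fun y => one_div_eight_le_exp (hu2 y)
  have h2 := integral_mono hc.integrable_circle (integrable_const (8 : ℝ))
    fun y => exp_le_eight (hu2 y)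
  rw [integral_const, volume_real_univ, one_smul] at h1 h2
  exact ⟨h1, h2⟩

theorem IsRegular.abs_coordinate_sub_le (h : A.IsRegular κ K lam D) {q : ℝ} {k : ℕ} {η μ : ℝ}
    {u : UnitAddCircle → ℝ} (hu : Continuous u) (hu2 : ∀ y, |u y| ≤ 2)
    (hη : ∀ j : Fin (A.d ^ k).natAbs, |(∫ y in A.cell q k ((j : ℕ) : ℤ), Real.exp (u y))
      - volume.real (A.cell q k ((j : ℕ) : ℤ)) * ∫ y, Real.exp (u y)| ≤ η)
    (hμ : ∀ (j : ℤ) (x : ℝ), A.F^[k] x ∈ Icc (q + j) (q + j + 1) → |x - A.cut q k j| ≤ μ)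
    {H : CircleLift} (hd : H.d = 1) (hH : ∀ x, H.F x = A.cut q k 0 +
      ∫ t in A.cut q k 0..x, Real.exp (u t) / ∫ y, Real.exp (u y)) (x : ℝ) :
    |H.F x - x| ≤ (A.d ^ k).natAbs * (8 * η) + 64 * μ := by
  obtain ⟨hZ1, hZ2⟩ := integral_exp_mem hu hu2
  set Z := ∫ y, Real.exp (u y) with hZ
  have hZ0 : 0 < Z := by linarith
  set ψ : UnitAddCircle → ℝ := fun y => Real.exp (u y) / Z - 1 with hψ
  have hwc : Continuous fun y => Real.exp (u y) / Z :=
    (Real.continuous_exp.comp hu).div_const _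
  have hψc : Continuous ψ := hwc.sub continuous_const
  have hψc' : Continuous fun x : ℝ => ψ x := hψc.comp (AddCircle.continuous_mk' 1)
  have hwc' : Continuous fun x : ℝ => Real.exp (u x) / Z := hwc.comp (AddCircle.continuous_mk' 1)
  have hψ64 : ∀ y, |ψ y| ≤ 64 := by
    intro y
    have h1 := exp_le_eight (hu2 y)
    have h2 : 0 ≤ Real.exp (u y) / Z := by positivity
    have h3 : Real.exp (u y) / Z ≤ 64 := by
      rw [div_le_iff₀ hZ0]
      linarith
    rw [abs_le]
    constructor <;> simp only [ψ] <;> linarith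
  have hHψ : ∀ x, H.F x - x = ∫ t in A.cut q k 0..x, ψ t := by
    intro x
    simp only [ψ]
    rw [hH, intervalIntegral.integral_sub (hwc'.intervalIntegrable _ _)
      (continuous_const.intervalIntegrable _ _), intervalIntegral.integral_const, smul_eq_mul]
    ring
  have hcell : ∀ j : Fin (A.d ^ k).natAbs,
      |∫ t in A.cut q k ((j : ℕ) : ℤ)..A.cut q k (((j : ℕ) : ℤ) + 1), ψ t| ≤ 8 * η := by
    intro j
    have hm : MeasurableSet (A.cell q k ((j : ℕ) : ℤ)) := (A.isOpen_cell q k _).measurableSet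
    have e : ∫ y in A.cell q k ((j : ℕ) : ℤ), ψ y =
        ((∫ y in A.cell q k ((j : ℕ) : ℤ), Real.exp (u y))
          - volume.real (A.cell q k ((j : ℕ) : ℤ)) * Z) / Z := by
      simp only [ψ]
      rw [integral_sub hwc.integrable_circle.restrict (integrable_const _), integral_div,
        integral_const, measureReal_restrict_apply_univ, smul_eq_mul, sub_div,
        mul_div_cancel_right₀ _ hZ0.ne', mul_one]
    rw [← h.abs_setIntegral_cell q k _ hψc, e, abs_div, abs_of_pos hZ0, div_le_iff₀ hZ0]
    have h1 := hη j
    have h2 := (abs_nonneg _).trans h1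
    nlinarith
  have hη0 : 0 ≤ 8 * η := (abs_nonneg _).trans
    (hcell ⟨0, Nat.pos_of_ne_zero (Int.natAbs_ne_zero.2 (A.pow_d_ne_zero k))⟩)
  have hcut : ∀ j : ℕ, j ≤ (A.d ^ k).natAbs →
      |∫ t in A.cut q k 0..A.cut q k (j : ℤ), ψ t| ≤ j * (8 * η) := by
    intro j
    induction j with
    | zero => simp
    | succ j ih =>
      intro hj
      have h1 := ih (by omega)
      have h2 := hcell ⟨j, by omega⟩
      rw [← intervalIntegral.integral_add_adjacent_intervals (hψc'.intervalIntegrable _ _)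
        (hψc'.intervalIntegrable (A.cut q k (j : ℤ)) _)]
      refine (abs_add_le _ _).trans ?_
      push_cast at h2 ⊢
      linarith
  obtain ⟨i, n, hin⟩ := exists_int_lt_natAbs (A.pow_d_ne_zero k) ⌊A.F^[k] x - q⌋
  have hx : A.F^[k] (x + n) ∈ Icc (q + ((i : ℕ) : ℤ)) (q + ((i : ℕ) : ℤ) + 1) := by
    have h1 := Int.floor_le (A.F^[k] x - q)
    have h2 := (Int.lt_floor_add_one (A.F^[k] x - q)).le
    have h5 : (⌊A.F^[k] x - q⌋ : ℝ) + n * (A.d : ℝ) ^ k = ((i : ℕ) : ℤ) := by exact_mod_cast hin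
    rw [A.iterate_add_int]
    constructor <;> linarith
  have e : H.F x - x = H.F (x + n) - (x + n) := by
    rw [H.map_add_int, hd]
    push_cast
    ring
  have h1 := hcut i i.2.le
  have h2 : |∫ t in A.cut q k ((i : ℕ) : ℤ)..(x + n), ψ t| ≤ 64 * μ := by
    have := intervalIntegral.norm_integral_le_of_norm_le_const (a := A.cut q k ((i : ℕ) : ℤ))
      (b := x + n) (f := fun t : ℝ => ψ t) (C := 64) fun t _ => hψ64 t
    rw [Real.norm_eq_abs] at this
    refine this.trans ?_
    linarith [hμ _ _ hx]
  rw [e, hHψ, ← intervalIntegral.integral_add_adjacent_intervals (hψc'.intervalIntegrable _ _)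
    (hψc'.intervalIntegrable (A.cut q k ((i : ℕ) : ℤ)) _)]
  refine (abs_add_le _ _).trans ?_
  have h3 : ((i : ℕ) : ℝ) ≤ (A.d ^ k).natAbs := by exact_mod_cast i.2.le
  have := mul_le_mul_of_nonneg_right h3 hη0
  linarith

theorem abs_map_sub_le {C : ℝ} (hC : ∀ x, |A.F' x| ≤ C) (x y : ℝ) :
    |A.F x - A.F y| ≤ C * |x - y| :=
  Convex.norm_image_sub_le_of_norm_hasDerivWithin_le (f := A.F)
    (fun x _ => (A.hasDerivAt x).hasDerivWithinAt) (fun x _ => hC x) convex_univ (mem_univ y)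
    (mem_univ x)

theorem abs_conjugate_sub_le {B H : CircleLift} (h1 : ∀ x, B.F (H.F x) = H.F (A.F x))
    (h2 : ∀ x, B.F' (H.F x) * H.F' x = H.F' (A.F x) * A.F' x) {u : UnitAddCircle → ℝ} {Z : ℝ}
    (hZ : 0 < Z) (hH : ∀ x : ℝ, H.F' x = Real.exp (u x) / Z) {η₁ η₂ ε C : ℝ}
    (hid : ∀ x, |H.F x - x| ≤ η₁) (hC : ∀ x, |A.F' x| ≤ C)
    (hmod : ∀ x y, |x - y| ≤ η₁ → |A.F' x - A.F' y| ≤ η₂) (hε : ε ≤ 1)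
    (hinc : ∀ y, |u (A.toMap y) - u y| ≤ ε) (x : ℝ) :
    |B.F x - A.F x| ≤ (1 + C) * η₁ ∧ |B.F' x - A.F' x| ≤ C * (2 * ε) + η₂ := by
  rw [← H.right_inv x]
  generalize H.Φ x = t
  have hC0 : 0 ≤ C := (abs_nonneg _).trans (hC 0)
  constructor
  · rw [h1]
    have e1 := hid (A.F t)
    have e2 := (abs_map_sub_le hC t (H.F t)).trans
      (mul_le_mul_of_nonneg_left ((abs_sub_comm _ _).trans_le (hid t)) hC0)
    have := abs_add_le (H.F (A.F t) - A.F t) (A.F t - A.F (H.F t))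
    rw [sub_add_sub_cancel] at this
    linarith
  · have hs := hinc t
    rw [A.toMap_coe] at hs
    set s := u (A.F t : ℝ) - u t with hsdef
    have e : B.F' (H.F t) = Real.exp s * A.F' t := by
      have := h2 t
      rw [hH, hH] at this
      rw [hsdef, Real.exp_sub]
      have p := Real.exp_pos (u t)
      field_simp at this ⊢
      linarith
    have e1 : |Real.exp s - 1| ≤ 2 * ε :=
      (Real.abs_exp_sub_one_le (hs.trans hε)).trans (by linarith)
    have e2 := hmod t (H.F t) ((abs_sub_comm _ _).trans_le (hid t))
    have e3 : |(Real.exp s - 1) * A.F' t| ≤ 2 * ε * C := by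
      rw [abs_mul]
      exact mul_le_mul e1 (hC t) (abs_nonneg _) ((abs_nonneg _).trans e1)
    have := abs_add_le ((Real.exp s - 1) * A.F' t) (A.F' t - A.F' (H.F t))
    rw [e]
    have e4 : Real.exp s * A.F' t - A.F' (H.F t)
        = (Real.exp s - 1) * A.F' t + (A.F' t - A.F' (H.F t)) := by ring
    rw [e4]
    linarith

theorem withDensity_real_le {v : UnitAddCircle → ℝ} {B : Set UnitAddCircle} (hB : MeasurableSet B)
    {C : ℝ} (hC : 0 ≤ C) (h : ∀ y ∈ B, v y ≤ C) :
    (volume.withDensity fun y => ENNReal.ofReal (v y)).real B ≤ C * volume.real B := by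
  rw [measureReal_def, withDensity_apply _ hB, measureReal_def, ← ENNReal.toReal_ofReal hC,
    ← ENNReal.toReal_mul]
  refine ENNReal.toReal_mono (ENNReal.mul_ne_top ENNReal.ofReal_ne_top (measure_ne_top _ _)) ?_
  rw [← setLIntegral_const]
  exact setLIntegral_mono measurable_const fun y hy => ENNReal.ofReal_le_ofReal (h y hy)

theorem le_withDensity_real {v : UnitAddCircle → ℝ} (hv : Measurable v) {B : Set UnitAddCircle}
    (hB : MeasurableSet B) [IsFiniteMeasure (volume.withDensity fun y => ENNReal.ofReal (v y))]
    {c : ℝ} (hc : 0 ≤ c) (h : ∀ y ∈ B, c ≤ v y) :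
    c * volume.real B ≤ (volume.withDensity fun y => ENNReal.ofReal (v y)).real B := by
  have h1 : ENNReal.ofReal c * volume B ≤
      (volume.withDensity fun y => ENNReal.ofReal (v y)) B := by
    rw [withDensity_apply _ hB, ← setLIntegral_const]
    exact setLIntegral_mono hv.ennreal_ofReal fun y hy => ENNReal.ofReal_le_ofReal (h y hy)
  have h2 := ENNReal.toReal_mono (measure_ne_top _ _) h1
  rwa [ENNReal.toReal_mul, ENNReal.toReal_ofReal hc] at h2

/-- After the change of coordinates with density `exp u / Z`, a cell on which the return density is
almost constant becomes a good cell. -/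
theorem isGoodCell_of_density {f g h h' : UnitAddCircle → UnitAddCircle} (hf : Measurable f)
    (hg : Measurable g) (hh : Measurable h) (hh' : Measurable h') (hfg : ∀ y, g (h y) = h (f y))
    (hl : ∀ y, h' (h y) = y) {u v : UnitAddCircle → ℝ} (hu : Measurable u) (hu2 : ∀ y, |u y| ≤ 2)
    {Z : ℝ} (hZ : 0 < Z)
    (hmap : Measure.map h (volume.withDensity fun y => ENNReal.ofReal (Real.exp (u y) / Z)) = volume)
    {I : Set UnitAddCircle} (hI : MeasurableSet I) (hI0 : 0 < volume.real I)
    (hp : volume.real I / 5000 ≤ volume.real (I ∩ {y | u y = 2}))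
    (hm : volume.real I / 5000 ≤ volume.real (I ∩ {y | u y = -2})) {l : List ℕ}
    (hv : Measurable v) (hv0 : ∀ y, 0 ≤ v y) (hvl : returnPush f I
      (volume.withDensity fun y => ENNReal.ofReal (Real.exp (u y) / Z)) l
        = volume.withDensity fun y => ENNReal.ofReal (v y))
    (hvI : ∀ x ∈ I, ∀ y ∈ I, v x ≤ 6 / 5 * v y) {ε : ℝ}
    (hmass : (1 - ε) * (volume.withDensity fun y => ENNReal.ofReal (Real.exp (u y) / Z)).real I
      ≤ (volume.withDensity fun y => ENNReal.ofReal (v y)).real I) (hε : 0 ≤ ε) :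
    0 < volume.real (h' ⁻¹' I) ∧ IsGoodCell volume (1 / 10 ^ 6) 100 g ε (h' ⁻¹' I) := by
  set w : UnitAddCircle → ℝ := fun y => Real.exp (u y) / Z with hw
  set ν := (volume : Measure UnitAddCircle).withDensity fun y => ENNReal.ofReal (w y) with hν
  set τ := (volume : Measure UnitAddCircle).withDensity fun y => ENNReal.ofReal (v y) with hτ
  have hwm : Measurable w := (Real.measurable_exp.comp hu).div_const _
  have hνfin : IsFiniteMeasure ν := by
    refine ⟨?_⟩
    have := congrArg (fun μ : Measure UnitAddCircle => μ univ) hmap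
    simp only [Measure.map_apply hh MeasurableSet.univ, preimage_univ] at this
    rw [this]
    exact measure_lt_top _ _
  have hτfin : IsFiniteMeasure τ := by
    rw [← hvl]
    exact isFiniteMeasure_returnPush l
  have hpre : ∀ S, h ⁻¹' (h' ⁻¹' S) = S := fun S => by
    rw [← preimage_comp, show h' ∘ h = id from funext hl, preimage_id]
  have hvol : ∀ B, MeasurableSet B → volume.real B = ν.real (h ⁻¹' B) := fun B hB => by
    rw [measureReal_def, measureReal_def, ← Measure.map_apply hh hB, hmap]
  set E := Real.exp 2 with hE
  have hE8 : E ≤ 8 := exp_two_le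
  have hE7 : 5 ≤ E := by
    have h1 : E = Real.exp 1 * Real.exp 1 := by rw [hE, ← Real.exp_add]; norm_num
    have h2 := Real.exp_one_gt_d9
    rw [h1]
    nlinarith
  have hE0 : 0 < E := by linarith
  have hEn : Real.exp (-2) = E⁻¹ := Real.exp_neg 2
  have hw1 : ∀ y, w y ≤ E / Z := fun y =>
    div_le_div_of_nonneg_right (Real.exp_le_exp.2 (abs_le.1 (hu2 y)).2) hZ.le
  have hw2 : ∀ y, E⁻¹ / Z ≤ w y := fun y => by
    rw [← hEn]
    exact div_le_div_of_nonneg_right (Real.exp_le_exp.2 (abs_le.1 (hu2 y)).1) hZ.le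
  have hret : ∀ B, MeasurableSet B →
      (returnPush g (h' ⁻¹' I) volume l).real B = τ.real (h ⁻¹' B) := fun B hB => by
    rw [← hvl, measureReal_def, measureReal_def, ← Measure.map_apply hh hB, ← hpre I,
      ← returnPush_map hf hg hh hfg (hh' hI), hmap, hpre]
  obtain ⟨x₀, hx₀⟩ : I.Nonempty := by
    by_contra hcon
    rw [not_nonempty_iff_eq_empty] at hcon
    simp [hcon] at hI0
  set c := v x₀ with hc
  have hc0 : 0 ≤ c := hv0 _
  have hJ : MeasurableSet (h' ⁻¹' I) := hh' hI
  have hvJ : volume.real (h' ⁻¹' I) = ν.real I := by rw [hvol _ hJ, hpre]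
  have hνI1 : ν.real I ≤ E / Z * volume.real I :=
    withDensity_real_le hI (by positivity) fun y _ => hw1 y
  have hνI2 : E⁻¹ / Z * volume.real I ≤ ν.real I :=
    le_withDensity_real hwm hI (by positivity) fun y _ => hw2 y
  have hup : ∀ B, MeasurableSet B → B ⊆ I → τ.real B ≤ 6 / 5 * c * volume.real B :=
    fun B hB hBI => withDensity_real_le hB (by positivity) fun y hy => hvI y (hBI hy) x₀ hx₀
  have hlo : ∀ B, MeasurableSet B → B ⊆ I → 5 / 6 * c * volume.real B ≤ τ.real B :=
    fun B hB hBI => le_withDensity_real hv hB (by positivity) fun y hy => by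
      have := hvI x₀ hx₀ y (hBI hy)
      linarith
  have hcZ : c * Z ≤ 6 / 5 * E := by
    have h1 := hlo I hI Subset.rfl
    have h2 : τ.real I ≤ ν.real I := by
      rw [← hvl]
      exact ENNReal.toReal_mono (measure_ne_top _ _) (returnPush_apply_le hf hI l)
    have h3 : 5 / 6 * c * volume.real I ≤ E / Z * volume.real I := by linarith
    have h4 := le_of_mul_le_mul_right h3 hI0
    rw [le_div_iff₀ hZ] at h4
    linarith
  have hlift : ∀ S B, B ⊆ h' ⁻¹' S → h ⁻¹' B ⊆ S := fun S B hB => by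
    rw [← hpre S]
    exact preimage_mono hB
  have hUm : MeasurableSet (I ∩ {y | u y = -2}) := hI.inter (hu (measurableSet_singleton _))
  have hVm : MeasurableSet (I ∩ {y | u y = 2}) := hI.inter (hu (measurableSet_singleton _))
  have hIle : volume.real (h' ⁻¹' I) ≤ E / Z * volume.real I := hvJ.trans_le hνI1
  refine ⟨hvJ ▸ lt_of_lt_of_le (by positivity) hνI2,
    l, h' ⁻¹' (I ∩ {y | u y = -2}), h' ⁻¹' (I ∩ {y | u y = 2}), 6 / 5 * c * Z / E,
    hh' hUm, hh' hVm, preimage_mono inter_subset_left, preimage_mono inter_subset_left,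
    ?_, ?_, ?_, fun B hB hBm => ?_, fun B hB hBm => ?_, fun B hB hBm => ?_⟩
  · rw [hvol _ (hh' hUm), hpre]
    have h1 : E⁻¹ / Z * volume.real (I ∩ {y | u y = -2}) ≤ ν.real (I ∩ {y | u y = -2}) :=
      le_withDensity_real hwm hUm (by positivity) fun y _ => hw2 y
    have h2 : E⁻¹ / Z * (volume.real I / 5000) ≤ E⁻¹ / Z * volume.real (I ∩ {y | u y = -2}) := by
      gcongr
    have h3 : 1 / 10 ^ 6 * (E / Z * volume.real I) ≤ E⁻¹ / Z * (volume.real I / 5000) := by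
      have : E * E ≤ 64 := by nlinarith
      have e1 : E⁻¹ / Z * (volume.real I / 5000) = volume.real I / Z / (5000 * E) := by field_simp
      have e2 : 1 / 10 ^ 6 * (E / Z * volume.real I) = volume.real I / Z * (E / 10 ^ 6) := by ring
      rw [e1, e2, div_eq_mul_inv _ (5000 * E)]
      refine mul_le_mul_of_nonneg_left ?_ (by positivity)
      rw [← one_div, div_le_div_iff₀ (by positivity) (by positivity)]
      nlinarith
    linarith
  · rw [hvol _ (hh' hVm), hpre]
    have h1 : E / Z * volume.real (I ∩ {y | u y = 2}) ≤ ν.real (I ∩ {y | u y = 2}) :=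
      le_withDensity_real hwm hVm (by positivity) fun y hy => by
        simp only [w]
        rw [show u y = 2 from hy.2]
    have h2 : E / Z * (volume.real I / 5000) ≤ E / Z * volume.real (I ∩ {y | u y = 2}) := by
      gcongr
    have h3 : 0 ≤ E / Z * volume.real I := by positivity
    linarith
  · rw [hvJ, hret _ hJ, hpre]
    exact hmass
  · have hB' := hlift _ _ hB
    have hBm' : MeasurableSet (h ⁻¹' B) := hh hBm
    rw [hret _ hBm, hvol _ hBm]
    have h1 := hup _ hBm' hB'
    have h2 : E⁻¹ / Z * volume.real (h ⁻¹' B) ≤ ν.real (h ⁻¹' B) :=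
      le_withDensity_real hwm hBm' (by positivity) fun y _ => hw2 y
    have h3 : volume.real (h ⁻¹' B) ≤ E * Z * ν.real (h ⁻¹' B) := by
      have := mul_le_mul_of_nonneg_left h2 (show 0 ≤ E * Z by positivity)
      have e : E * Z * (E⁻¹ / Z * volume.real (h ⁻¹' B)) = volume.real (h ⁻¹' B) := by field_simp
      linarith
    have h4 : 6 / 5 * c * (E * Z) ≤ 100 := by nlinarith
    have h5 := mul_le_mul_of_nonneg_left h3 (show 0 ≤ 6 / 5 * c by positivity)
    have h6 := mul_le_mul_of_nonneg_right h4 (measureReal_nonneg (μ := ν) (s := h ⁻¹' B))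
    have h7 : 0 ≤ ε * volume.real (h' ⁻¹' I) := mul_nonneg hε measureReal_nonneg
    linarith
  · have hB' := hlift _ _ hB
    have hBm' : MeasurableSet (h ⁻¹' B) := hh hBm
    rw [hret _ hBm, hvol _ hBm]
    have h1 := hlo _ hBm' (hB'.trans inter_subset_left)
    have h2 : ν.real (h ⁻¹' B) ≤ E⁻¹ / Z * volume.real (h ⁻¹' B) :=
      withDensity_real_le hBm' (by positivity) fun y hy => by
        simp only [w]
        rw [show u y = -2 from (hB' hy).2, hEn]
    have h3 : 16 * (6 / 5 * c * Z / E) * ν.real (h ⁻¹' B) ≤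
        16 * (6 / 5 * c * Z / E) * (E⁻¹ / Z * volume.real (h ⁻¹' B)) := by gcongr
    have e : 16 * (6 / 5 * c * Z / E) * (E⁻¹ / Z * volume.real (h ⁻¹' B))
        = 96 / 5 * (c * volume.real (h ⁻¹' B)) / (E * E) := by field_simp; ring
    have h4 : 96 / 5 * (c * volume.real (h ⁻¹' B)) / (E * E)
        ≤ 5 / 6 * (c * volume.real (h ⁻¹' B)) := by
      rw [div_le_iff₀ (by positivity)]
      have : 0 ≤ c * volume.real (h ⁻¹' B) := by positivity
      have h25 : 25 ≤ E * E := by nlinarith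
      nlinarith
    have h7 : 0 ≤ ε * volume.real (h' ⁻¹' I) := mul_nonneg hε measureReal_nonneg
    linarith
  · have hB' := hlift _ _ hB
    have hBm' : MeasurableSet (h ⁻¹' B) := hh hBm
    rw [hret _ hBm, hvol _ hBm]
    have h1 := hup _ hBm' (hB'.trans inter_subset_left)
    have h2 : E / Z * volume.real (h ⁻¹' B) ≤ ν.real (h ⁻¹' B) :=
      le_withDensity_real hwm hBm' (by positivity) fun y hy => by
        simp only [w]
        rw [show u y = 2 from (hB' hy).2]
    have h3 := mul_le_mul_of_nonneg_left h2 (show 0 ≤ 6 / 5 * c * Z / E by positivity)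
    have e : 6 / 5 * c * Z / E * (E / Z * volume.real (h ⁻¹' B))
        = 6 / 5 * c * volume.real (h ⁻¹' B) := by field_simp
    have h7 : 0 ≤ ε * volume.real (h' ⁻¹' I) := mul_nonneg hε measureReal_nonneg
    linarith

end CircleLift

end Perturbation

section GoodPerturbation

open Set Filter Topology Function

namespace CircleLift

variable {A : CircleLift} {κ K : ℝ → ℝ} {lam D : ℝ}

theorem IsRegular.exists_invariant (h : A.IsRegular κ K lam D) {q : ℝ} {n₀ : ℤ}
    (hq : A.F q = q + n₀) {c : ℝ} (hc : 0 ≤ c) : ∃ μ : Measure UnitAddCircle, IsFiniteMeasure μ ∧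
      Measure.map A.toMap μ = μ ∧ ∀ w : UnitAddCircle → ℝ, (∀ y, w y ≤ c) →
        (volume.withDensity fun y => ENNReal.ofReal (w y)) ≤ μ := by
  obtain ⟨ρ, hρ, hρ0, -, hρL, -⟩ := h.exists_density hq
  obtain ⟨y₀, -, hy₀⟩ := isCompact_univ.exists_isMinOn univ_nonempty hρ.continuousOn
  have hρc : Continuous ((c / ρ y₀) • ρ) := hρ.const_smul _
  have hpos : ∀ y, 0 ≤ ((c / ρ y₀) • ρ) y := fun y =>
    mul_nonneg (div_nonneg hc (hρ0 _).le) (hρ0 _).le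
  refine ⟨volume.withDensity fun y => ENNReal.ofReal (((c / ρ y₀) • ρ) y), ?_, ?_, fun w hw => ?_⟩
  · exact isFiniteMeasure_withDensity_ofReal hρc.integrable_circle.2
  · rw [A.map_withDensity hρc.measurable hpos, A.transfer_smul, hρL]
  · refine withDensity_mono (Eventually.of_forall fun y => ENNReal.ofReal_le_ofReal ?_)
    refine (hw y).trans ?_
    have h1 : ρ y₀ ≤ ρ y := hy₀ (mem_univ y)
    simp only [Pi.smul_apply, smul_eq_mul]
    rw [div_mul_eq_mul_div, le_div_iff₀ (hρ0 _)]
    gcongr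

theorem exists_modulus {φ : UnitAddCircle → ℝ} (hφ : Continuous φ) {ε : ℝ} (hε : 0 < ε) :
    ∃ δ : ℝ, 0 < δ ∧ ∀ x y : ℝ, |x - y| ≤ δ → |φ x - φ y| ≤ ε := by
  obtain ⟨δ, hδ, hd⟩ := Metric.uniformContinuous_iff.1
    (CompactSpace.uniformContinuous_of_continuous hφ) ε hε
  refine ⟨δ / 2, by linarith, fun x y hxy => ?_⟩
  have := hd (a := (x : UnitAddCircle)) (b := y)
    ((dist_coe_le x y).trans_lt (hxy.trans_lt (by linarith)))
  exact (Real.dist_eq _ _ ▸ this).le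

theorem exists_mem_cell {q : ℝ} {k : ℕ} {j : ℤ} {y : UnitAddCircle} (hy : y ∈ A.cell q k j) :
    ∃ x : ℝ, (x : UnitAddCircle) = y ∧ A.F^[k] x ∈ Ioo (q + j) (q + j + 1) := by
  obtain ⟨x, hx, rfl⟩ := hy
  exact ⟨x, rfl, hx⟩

theorem disjoint_uIcc_cuts {q : ℝ} {k : ℕ} {j : ℤ} {x y : ℝ}
    (hx : A.F^[k] x ∈ Ioo (q + j) (q + j + 1)) (hy : A.F^[k] y ∈ Ioo (q + j) (q + j + 1)) :
    Disjoint (uIcc x y) (A.cuts q k) := by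
  refine Set.disjoint_left.2 fun z hz hzc => ?_
  have hoc : OrdConnected (A.F^[k] ⁻¹' Ioo (q + j) (q + j + 1)) := by
    rw [preimage_Ioo]
    exact ordConnected_Ioo
  have hz' := hoc.uIcc_subset hx hy hz
  exact Set.disjoint_left.1 (disjoint_uIcc_intOrbit j hz' hz') left_mem_uIcc hzc

theorem IsRegular.exists_isGoodCell (h : A.IsRegular κ K lam D) {q : ℝ} {n₀ : ℤ}
    (hq : A.F q = q + n₀) {k : ℕ} (hk : coneExponent lam D * ((K 1 - K 0) / lam ^ k) ≤ 1 / 20)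
    {g T T' : UnitAddCircle → UnitAddCircle} (hg : Measurable g) (hT : Measurable T)
    (hT' : Measurable T') (hconj : ∀ y, g (T y) = T (A.toMap y)) (hl : ∀ y, T' (T y) = y)
    {u : UnitAddCircle → ℝ} (hu : Continuous u) (hu2 : ∀ y, |u y| ≤ 2)
    (hmap : Measure.map T (volume.withDensity fun y =>
      ENNReal.ofReal (Real.exp (u y) / ∫ y, Real.exp (u y))) = volume) {j : ℤ}
    (hp : volume.real (A.cell q k j) / 5000 ≤ volume.real (A.cell q k j ∩ {y | u y = 2}))
    (hm : volume.real (A.cell q k j) / 5000 ≤ volume.real (A.cell q k j ∩ {y | u y = -2}))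
    {ε : ℝ} (hε : 0 < ε) :
    0 < volume.real (T' ⁻¹' A.cell q k j) ∧
      IsGoodCell volume (1 / 10 ^ 6) 100 g ε (T' ⁻¹' A.cell q k j) := by
  obtain ⟨hZ1, hZ2⟩ := integral_exp_mem hu hu2
  set Z := ∫ y, Real.exp (u y) with hZ
  have hZ0 : 0 < Z := by linarith
  set I := A.cell q k j with hIdef
  have hI : MeasurableSet I := (A.isOpen_cell q k j).measurableSet
  have hI0 : 0 < volume.real I := A.measureReal_cell_pos q k j
  set w : UnitAddCircle → ℝ := fun y => Real.exp (u y) / Z with hw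
  have hwc : Continuous w := (Real.continuous_exp.comp hu).div_const _
  set a := coneExponent lam D with ha
  have ha0 : 0 < a := h.coneExponent_pos
  obtain ⟨c, hc0, hc⟩ := exists_pos_le_abs_of_periodic h.continuous h.periodic fun x => (h.pos x).ne'
  obtain ⟨δ, hδ, hmod⟩ := exists_modulus hu (show (0 : ℝ) < 1 / 20 by norm_num)
  have hR0 : 0 < c * δ := by positivity
  have hwcone : InCone K (A.cuts q k) a (1 / 20) (c * δ) w := by
    refine ⟨fun y => by positivity, fun x y _ hxy => ?_⟩
    have h1 : |x - y| ≤ δ :=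
      le_of_mul_le_mul_left ((mul_abs_sub_le_abs_sub h.hasDerivAt_K hc x y).trans hxy) hc0
    have h2 := (abs_le.1 (hmod x y h1)).2
    simp only [w]
    rw [← mul_div_assoc, ← Real.exp_add]
    refine div_le_div_of_nonneg_right (Real.exp_le_exp.2 ?_) hZ0.le
    have := mul_nonneg ha0.le (abs_nonneg (K x - K y))
    linarith
  obtain ⟨r, hr⟩ := pow_unbounded_of_one_lt ((K 1 - K 0) / (c * δ)) h.one_lt
  rw [div_lt_iff₀ hR0] at hr
  obtain ⟨μ, hμfin, hμ, hμle⟩ := h.exists_invariant hq (c := 64) (by norm_num)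
  have hνμ := hμle w fun y => by
    simp only [w]
    rw [div_le_iff₀ hZ0]
    linarith [exp_le_eight (hu2 y)]
  have hνfin : IsFiniteMeasure (volume.withDensity fun y => ENNReal.ofReal (w y)) :=
    ⟨(hνμ univ).trans_lt (measure_lt_top _ _)⟩
  have hνI : 0 < (volume.withDensity fun y => ENNReal.ofReal (w y)).real I := by
    refine lt_of_lt_of_le (show 0 < 1 / 64 * volume.real I by positivity)
      (le_withDensity_real hwc.measurable hI (by norm_num) fun y _ => ?_)
    simp only [w]
    rw [le_div_iff₀ hZ0]
    linarith [one_div_eight_le_exp (hu2 y)]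
  obtain ⟨l, hlr, hlm⟩ := exists_le_returnPush_apply A.continuous_toMap.measurable hI hμ hνμ r _
    (mul_pos hε hνI)
  obtain ⟨v, hvm, hvcone, hvl⟩ := h.exists_density_returnPush (A.map_mem_cuts q k hq)
    (A.add_mem_cuts q k) hR0.le hI (A.isSaturated_cell q k j) hwc.measurable hwcone l
  rw [hvl] at hlm
  refine isGoodCell_of_density A.continuous_toMap.measurable hg hT hT' hconj hl hu.measurable hu2
    hZ0 hmap hI hI0 hp hm hvm hvcone.1 hvl (fun x hx y hy => ?_) (by linarith) hε.le
  obtain ⟨x, rfl, hxm⟩ := exists_mem_cell hx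
  obtain ⟨y, rfl, hym⟩ := exists_mem_cell hy
  have h1 := h.abs_sub_le_div_pow k (Ioo_subset_Icc_self hxm) (Ioo_subset_Icc_self hym)
  have h2 : (K 1 - K 0) / lam ^ k ≤ K 1 - K 0 :=
    div_le_self h.K_pos.le (one_le_pow₀ h.one_lt.le)
  refine (hvcone.2 x y (disjoint_uIcc_cuts hxm hym) (by rw [hlr]; linarith)).trans ?_
  refine mul_le_mul_of_nonneg_right ?_ (hvcone.1 _)
  have h3 : a * |K x - K y| ≤ 1 / 20 := (mul_le_mul_of_nonneg_left h1 ha0.le).trans hk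
  have h4 := Real.abs_exp_sub_one_le (x := 1 / 10) (by rw [abs_of_pos] <;> norm_num)
  rw [abs_of_pos (show (0 : ℝ) < 1 / 10 by norm_num)] at h4
  have h5 := (abs_le.1 h4).2
  refine (Real.exp_le_exp.2 (show _ ≤ (1 / 10 : ℝ) by linarith)).trans (by linarith)

theorem IsRegular.exists_perturbation (h : A.IsRegular κ K lam D) {η ε : ℝ} (hη : 0 < η)
    (hε : 0 < ε) : ∃ B : CircleLift, (∃ κ' lam', B.IsAdapted κ' lam') ∧
      (∀ x, |B.F x - A.F x| ≤ η ∧ |B.F' x - A.F' x| ≤ η) ∧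
      HasGoodPartition volume (1 / 10 ^ 6) 100 B.toMap ε := by
  obtain ⟨q, n₀, hq⟩ := h.exists_fixed
  obtain ⟨C, hC0, hC⟩ := exists_abs_le_of_periodic A.continuous_deriv A.periodic_deriv
  obtain ⟨δ, hδ, hmod⟩ := exists_modulus A.toC1.continuous_deriv (half_pos hη)
  have hmod' : ∀ x y, |x - y| ≤ δ → |A.F' x - A.F' y| ≤ η / 2 := fun x y hxy => by
    rw [← A.circleDeriv_toMap, ← A.circleDeriv_toMap]
    exact hmod x y hxy
  obtain ⟨c, hc0, hc⟩ := exists_pos_le_abs_of_periodic h.continuous h.periodic fun x => (h.pos x).ne'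
  have ha0 : 0 < coneExponent lam D := h.coneExponent_pos
  set η₁ := min δ (min (η / (1 + C)) (ε / 4)) with hη₁
  have hη₁0 : 0 < η₁ := by positivity
  have hη₁1 : η₁ ≤ δ := min_le_left _ _
  have hη₁2 : (1 + C) * η₁ ≤ η := by
    have : η₁ ≤ η / (1 + C) := (min_le_right _ _).trans (min_le_left _ _)
    rw [le_div_iff₀ (by positivity)] at this
    linarith
  have hη₁3 : η₁ ≤ ε / 4 := (min_le_right _ _).trans (min_le_right _ _)
  set m := min (c * (η₁ / 128)) (1 / (20 * coneExponent lam D)) with hmdef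
  have hm0 : 0 < m := by positivity
  obtain ⟨k, hk⟩ := pow_unbounded_of_one_lt ((K 1 - K 0) / m) h.one_lt
  have hkm : (K 1 - K 0) / lam ^ k ≤ m := by
    rw [div_lt_iff₀ hm0] at hk
    rw [div_le_iff₀ (pow_pos h.lam_pos k)]
    linarith
  have hk1 : coneExponent lam D * ((K 1 - K 0) / lam ^ k) ≤ 1 / 20 := by
    have := mul_le_mul_of_nonneg_left (hkm.trans (min_le_right _ _)) ha0.le
    refine this.trans_eq ?_
    field_simp
  have hmesh : ∀ (j : ℤ) (x : ℝ), A.F^[k] x ∈ Icc (q + j) (q + j + 1) →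
      |x - A.cut q k j| ≤ η₁ / 128 := by
    intro j x hx
    refine le_of_mul_le_mul_left ((mul_abs_sub_le_abs_sub h.hasDerivAt_K hc _ _).trans ?_) hc0
    exact ((h.abs_sub_le_div_pow k hx (cut_mem_Icc q k j).1).trans hkm).trans (min_le_left _ _)
  have hn0 : (0 : ℝ) < ((A.d ^ k).natAbs : ℕ) := by
    exact_mod_cast Nat.pos_of_ne_zero (Int.natAbs_ne_zero.2 (A.pow_d_ne_zero k))
  obtain ⟨u, hu, hu2, hinc, hcell⟩ := h.exists_equidistributed hq k
    (ε := min 1 (η / (4 * C))) (η := η₁ / (16 * ((A.d ^ k).natAbs : ℕ))) (by positivity)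
    (by positivity)
  obtain ⟨hZ1, hZ2⟩ := integral_exp_mem hu hu2
  have hZ0 : 0 < ∫ y, Real.exp (u y) := by linarith
  have hwc : Continuous fun y => Real.exp (u y) / ∫ y, Real.exp (u y) :=
    (Real.continuous_exp.comp hu).div_const _
  have hw0 : ∀ y, 0 < Real.exp (u y) / ∫ y, Real.exp (u y) := fun y => by positivity
  obtain ⟨H, hd, hH, hH'⟩ := exists_coordinate hwc hw0
    (by rw [integral_div, div_self hZ0.ne']) (A.cut q k 0)
  have hid : ∀ x, |H.F x - x| ≤ η₁ := fun x => by
    refine (h.abs_coordinate_sub_le hu hu2 (fun j => (hcell j).1) hmesh hd hH x).trans_eq ?_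
    field_simp
    norm_num
  obtain ⟨B, hB, hB'⟩ := exists_conjugate A hd
  obtain ⟨T', hT'c, hT'l, hT'r⟩ := exists_inverse hd
  have hmap := map_withDensity_deriv hd hwc hw0 hH'
  have hconj : ∀ y, B.toMap (H.toMap y) = H.toMap (A.toMap y) := fun y => by
    obtain ⟨x, rfl⟩ := exists_coe_eq y
    rw [H.toMap_coe, B.toMap_coe, hB, A.toMap_coe, H.toMap_coe]
  refine ⟨B, ⟨_, _, h.toIsAdapted.conjugate hd (fun x => (hH' x).symm ▸ hw0 _) hB hB'⟩,
    fun x => ?_, ?_⟩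
  · have := abs_conjugate_sub_le hB hB' hZ0 hH' hid hC
      (fun x y hxy => hmod' x y (hxy.trans hη₁1)) (min_le_left _ _) hinc x
    refine ⟨this.1.trans hη₁2, this.2.trans ?_⟩
    have h1 : min 1 (η / (4 * C)) ≤ η / (4 * C) := min_le_right _ _
    rw [le_div_iff₀ (by positivity)] at h1
    linarith
  · have hgood := fun j : Fin (A.d ^ k).natAbs => h.exists_isGoodCell hq hk1
      B.continuous_toMap.measurable H.continuous_toMap.measurable hT'c.measurable hconj hT'l hu hu2
      hmap (hcell j).2.1 (hcell j).2.2 hε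
    refine ⟨_, fun j : Fin (A.d ^ k).natAbs => T' ⁻¹' A.cell q k ((j : ℕ) : ℤ),
      fun j => hT'c.measurable (A.isOpen_cell q k _).measurableSet,
      fun i j hij => (A.pairwise_disjoint_cell q k hij).preimage T', ?_, fun j x hx y hy => ?_,
      fun j => (hgood j).1, fun j => (hgood j).2⟩
    · have hU : MeasurableSet (⋃ j : Fin (A.d ^ k).natAbs, A.cell q k ((j : ℕ) : ℤ))ᶜ :=
        (MeasurableSet.iUnion fun j => (A.isOpen_cell q k _).measurableSet).compl
      rw [← preimage_iUnion, ← preimage_compl, ← hmap,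
        Measure.map_apply H.continuous_toMap.measurable (hT'c.measurable hU), ← preimage_comp,
        show T' ∘ H.toMap = id from funext hT'l, preimage_id]
      exact withDensity_absolutelyContinuous _ _ (A.volume_compl_iUnion_cell q k)
    · obtain ⟨x', hx', hxm⟩ := exists_mem_cell hx
      obtain ⟨y', hy', hym⟩ := exists_mem_cell hy
      rw [← hT'r x, ← hT'r y, ← hx', ← hy', H.toMap_coe, H.toMap_coe]
      refine (dist_coe_le _ _).trans ?_
      have e1 := abs_le.1 (hid x')
      have e2 := abs_le.1 (hid y')
      have e3 := abs_le.1 (hmesh _ _ (Ioo_subset_Icc_self hxm))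
      have e4 := abs_le.1 (hmesh _ _ (Ioo_subset_Icc_self hym))
      rw [abs_le]
      constructor <;> linarith [e1.1, e1.2, e2.1, e2.2, e3.1, e3.2, e4.1, e4.2]

end CircleLift

end GoodPerturbation

section Regularization

open Set Filter Topology Function

namespace CircleLift

variable {A : CircleLift} {κ : ℝ → ℝ} {lam : ℝ}

theorem IsAdapted.exists_of_close (h : A.IsAdapted κ lam) : ∃ η lam' : ℝ, 0 < η ∧
    ∀ B : CircleLift, (∀ x, |B.F x - A.F x| ≤ η ∧ |B.F' x - A.F' x| ≤ η) →
      B.IsAdapted κ lam' := by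
  obtain ⟨c, hc0, hc⟩ := exists_pos_le_abs_of_periodic h.continuous h.periodic fun x => (h.pos x).ne'
  obtain ⟨C₁, hC₁0, hC₁⟩ := exists_abs_le_of_periodic h.continuous h.periodic
  obtain ⟨C₂, hC₂0, hC₂⟩ := exists_abs_le_of_periodic A.continuous_deriv A.periodic_deriv
  simp only [abs_of_pos (h.pos _)] at hc hC₁
  set s := (lam - 1) / 2 * c with hs
  have hs0 : 0 < s := mul_pos (by linarith [h.one_lt]) hc0
  have hκ : Continuous h.periodic.lift :=
    (isQuotientMap_quotient_mk').continuous_iff.2 h.continuous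
  obtain ⟨δ, hδ, hmod⟩ := exists_modulus hκ (show 0 < s / (2 * C₂) by positivity)
  refine ⟨min δ (s / (2 * C₁)), (1 + lam) / 2, by positivity, fun B hB =>
    ⟨h.continuous, h.periodic, h.pos, by linarith [h.one_lt], fun x => ?_⟩⟩
  obtain ⟨h1, h2⟩ := hB x
  have h3 : |κ (B.F x) - κ (A.F x)| ≤ s / (2 * C₂) := hmod _ _ (h1.trans (min_le_left _ _))
  have h4 := h2.trans (min_le_right _ _)
  rw [le_div_iff₀ (by positivity)] at h3 h4
  have h5 := abs_sub_abs_le_abs_sub (A.F' x) (B.F' x)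
  rw [abs_sub_comm] at h5
  have h6 : (|A.F' x| - |B.F' x|) * κ (B.F x) ≤ |B.F' x - A.F' x| * C₁ :=
    mul_le_mul h5 (hC₁ _) (h.pos _).le (abs_nonneg _)
  have h7 : |A.F' x| * (κ (A.F x) - κ (B.F x)) ≤ C₂ * |κ (B.F x) - κ (A.F x)| := by
    refine (mul_le_mul_of_nonneg_left ?_ (abs_nonneg _)).trans
      (mul_le_mul_of_nonneg_right (hC₂ x) (abs_nonneg _))
    rw [abs_sub_comm]
    exact le_abs_self _
  have h8 := h.le x
  have h9 : s ≤ (lam - 1) / 2 * κ x :=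
    mul_le_mul_of_nonneg_left (hc x) (by linarith [h.one_lt])
  nlinarith

theorem exists_lipschitz_deriv (A : CircleLift) {η : ℝ} (hη : 0 < η) :
    ∃ (B : CircleLift) (L : ℝ), (∀ x, |B.F x - A.F x| ≤ η ∧ |B.F' x - A.F' x| ≤ η) ∧
      ∀ x y, |B.F' x - B.F' y| ≤ L * |x - y| := by
  obtain ⟨C, hC0, hC⟩ := exists_abs_le_of_periodic A.continuous_deriv A.periodic_deriv
  obtain ⟨δ, hδ, hmod⟩ := exists_modulus A.toC1.continuous_deriv hη
  have hmod' : ∀ x y, |x - y| ≤ δ → |A.F' x - A.F' y| ≤ η := fun x y hxy => by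
    rw [← A.circleDeriv_toMap, ← A.circleDeriv_toMap]
    exact hmod x y hxy
  set s := min δ (η / C) with hs
  have hs0 : 0 < s := by positivity
  have hsC : C * s ≤ η := by
    have : s ≤ η / C := min_le_right _ _
    rw [le_div_iff₀ hC0] at this
    linarith
  set P : ℝ → ℝ := fun x => ∫ t in (0 : ℝ)..x, A.F t with hP
  have hPd : ∀ x, HasDerivAt P (A.F x) x := fun x =>
    (A.continuous_F.integral_hasStrictDerivAt 0 x).hasDerivAt
  have hPs : ∀ x y, P y - P x = ∫ t in x..y, A.F t := fun x y =>
    intervalIntegral.integral_interval_sub_left (A.continuous_F.intervalIntegrable _ _)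
      (A.continuous_F.intervalIntegrable _ _)
  have slope : ∀ {g g' : ℝ → ℝ}, (∀ x, HasDerivAt g (g' x) x) → ∀ x,
      ∃ z, |z - x| ≤ s ∧ (g (x + s) - g x) / s = g' z := fun {g g'} hg x => by
    obtain ⟨z, hz, hz'⟩ := exists_hasDerivAt_eq_slope g g' (show x < x + s by linarith)
      (fun z _ => (hg z).continuousAt.continuousWithinAt) fun z _ => hg z
    refine ⟨z, abs_le.2 ⟨by linarith [hz.1], by linarith [hz.2]⟩, ?_⟩
    rw [hz', add_sub_cancel_left]
  obtain ⟨B, hB, hB', -⟩ := exists_circleLift (F := fun x => (P (x + s) - P x) / s)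
    (F' := fun x => (A.F (x + s) - A.F x) / s) (d := A.d)
    (fun x => ((HasDerivAt.comp_add_const x s (hPd (x + s))).sub (hPd x)).div_const s)
    (((A.continuous_F.comp (continuous_id.add continuous_const)).sub A.continuous_F).div_const s)
    (fun x => by
      obtain ⟨z, -, hz⟩ := slope A.hasDerivAt x
      rw [hz]
      exact A.deriv_ne_zero z)
    (fun x => by
      have e : ∫ t in (x + 1)..(x + s + 1), A.F t = (∫ t in x..(x + s), A.F t) + s * A.d := by
        rw [← intervalIntegral.integral_comp_add_right]
        simp_rw [A.map_add_one]
        rw [intervalIntegral.integral_add (A.continuous_F.intervalIntegrable _ _)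
          (continuous_const.intervalIntegrable _ _), intervalIntegral.integral_const, smul_eq_mul]
        ring
      rw [hPs, hPs, show x + 1 + s = x + s + 1 by ring, e]
      field_simp)
  refine ⟨B, 2 * C / s, fun x => ⟨?_, ?_⟩, fun x y => ?_⟩
  · obtain ⟨z, hz, hzx⟩ := slope hPd x
    rw [hB]
    simp only
    rw [hzx]
    exact (abs_map_sub_le hC z x).trans ((mul_le_mul_of_nonneg_left hz hC0.le).trans hsC)
  · obtain ⟨z, hz, hzx⟩ := slope A.hasDerivAt x
    rw [hB']
    simp only
    rw [hzx]
    exact hmod' z x (hz.trans (min_le_left _ _))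
  · rw [hB']
    simp only
    have e : (A.F (x + s) - A.F x) / s - (A.F (y + s) - A.F y) / s
        = ((A.F (x + s) - A.F (y + s)) - (A.F x - A.F y)) / s := by ring
    rw [e, abs_div, abs_of_pos hs0, div_mul_eq_mul_div]
    refine div_le_div_of_nonneg_right ?_ hs0.le
    have h1 := abs_map_sub_le hC (x + s) (y + s)
    have h2 := abs_map_sub_le hC x y
    rw [add_sub_add_right_eq_sub] at h1
    have := abs_sub (A.F (x + s) - A.F (y + s)) (A.F x - A.F y)
    linarith

theorem IsAdapted.exists_isRegular (h : A.IsAdapted κ lam) {L : ℝ}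
    (hL : ∀ x y, |A.F' x - A.F' y| ≤ L * |x - y|) : ∃ K D, A.IsRegular κ K lam D := by
  obtain ⟨c, hc0, hc⟩ := exists_pos_le_abs_of_periodic h.continuous h.periodic fun x => (h.pos x).ne'
  obtain ⟨c', hc'0, hc'⟩ := A.exists_lower
  have hL0 : 0 ≤ L := by simpa using (abs_nonneg _).trans (hL 1 0)
  have hK : ∀ x, HasDerivAt (fun x => ∫ t in (0 : ℝ)..x, κ t) (κ x) x := fun x =>
    (h.continuous.integral_hasStrictDerivAt 0 x).hasDerivAt
  refine ⟨fun x => ∫ t in (0 : ℝ)..x, κ t, L / c' / c, h, hK, by positivity, fun x y => ?_⟩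
  have h1 := mul_abs_sub_le_abs_sub hK hc x y
  set Δ := |(∫ t in (0 : ℝ)..x, κ t) - ∫ t in (0 : ℝ)..y, κ t| with hΔ
  have h2 : |A.F' y| ≤ |A.F' x| + L * |x - y| := by
    have e1 := abs_sub_abs_le_abs_sub (A.F' y) (A.F' x)
    rw [abs_sub_comm] at e1
    linarith [hL x y]
  have h3 : L * |x - y| ≤ L / c' / c * Δ * |A.F' x| := by
    have e : L * |x - y| = L / c' / c * (c * |x - y|) * c' := by field_simp
    rw [e]
    exact mul_le_mul (mul_le_mul_of_nonneg_left h1 (by positivity)) (hc' x) hc'0.le (by positivity)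
  have h4 := mul_le_mul_of_nonneg_right (Real.add_one_le_exp (L / c' / c * Δ)) (abs_nonneg (A.F' x))
  linarith

end CircleLift

theorem dense_hasGoodPartition {ε : ℝ} (hε : 0 < ε) :
    Dense {g : ExpandingC1 | HasGoodPartition volume (1 / 10 ^ 6) 100 g.1.toFun ε} := by
  intro f
  rw [mem_closure_iff_nhds]
  intro W hW
  obtain ⟨η, hη, hfW⟩ := ExpandingC1.exists_forall_mem hW
  obtain ⟨A, hA, -⟩ := f.exists_lift _ (coe_circleRep (f.1.toFun 0))
  obtain ⟨κ, lam, hκ⟩ := CircleLift.exists_isAdapted (A := A) (hA ▸ f.2)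
  obtain ⟨η₁, lam', hη₁, hstable⟩ := hκ.exists_of_close
  obtain ⟨B, L, hBA, hL⟩ := A.exists_lipschitz_deriv (lt_min hη₁ (show 0 < η / 3 by linarith))
  obtain ⟨K, D, hreg⟩ := (hstable B fun x => ⟨(hBA x).1.trans (min_le_left _ _),
    (hBA x).2.trans (min_le_left _ _)⟩).exists_isRegular hL
  obtain ⟨G, ⟨κ', lam'', hG⟩, hGB, hgood⟩ :=
    hreg.exists_perturbation (show 0 < η / 3 by linarith) hε
  refine ⟨⟨G.toC1, hG.isExpanding⟩, hfW _ (fun y => ?_) fun y => ?_, hgood⟩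
  · obtain ⟨x, rfl⟩ := exists_coe_eq y
    rw [← hA]
    change dist (G.toMap x) (A.toMap x) < η
    rw [G.toMap_coe, A.toMap_coe]
    refine (dist_coe_le _ _).trans_lt ?_
    have h1 := (hBA x).1.trans (min_le_right _ _)
    have := abs_add_le (G.F x - B.F x) (B.F x - A.F x)
    rw [sub_add_sub_cancel] at this
    linarith [(hGB x).1]
  · obtain ⟨x, rfl⟩ := exists_coe_eq y
    rw [← hA]
    change |circleDeriv G.toMap x - circleDeriv A.toMap x| < η
    rw [G.circleDeriv_toMap, A.circleDeriv_toMap]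
    have h1 := (hBA x).2.trans (min_le_right _ _)
    have := abs_add_le (G.F' x - B.F' x) (B.F' x - A.F' x)
    rw [sub_add_sub_cancel] at this
    linarith [(hGB x).2]

end Regularization

theorem theorem1 :
    ∃ R : Set ExpandingC1, R ∈ residual ExpandingC1 ∧
      ∀ f ∈ R, IsNonsingularCircleMap f.1.toFun ∧
        ¬ ∃ μ : Measure UnitAddCircle, IsAciSigma f.1.toFun μ :=
  exists_residual_of_dense (by norm_num) (by norm_num) fun _ hε => dense_hasGoodPartition hε
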